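/- **Setting.** There are $K<\infty$ cluster types; a cluster of type $L=k$ has $M_k$ units. A cluster has observed data $(O,L)$, $O=(Y,A,X)$, with outcomes $Y\in\mathbb R^{M_k}$, treatments $A\in\mathcal A(M_k)=\{0,1\}^{M_k}$ and covariates $X\in\mathcal X(k)$ when $L=k$, and potential outcomes $Y(a)$, $a\in\mathcal A(M_k)$. Write $p_k^*=\mathrm{pr}(L=k)>0$, $e^*(a\mid x,k)=\mathrm{pr}(A=a\mid X=x,L=k)$, $g^*(a,x,k)=E(Y\mid A=a,X=x,L=k)$, $\Sigma^*(a,x,k)=\mathrm{var}(Y\mid A=a,X=x,L=k)$. The observed data $(O_i,L_i)$, $i=1,2,\dots$, of the clusters are independent copies of $(O,L)$. Assume: (A1) $Y=Y(A)$ almost surely; (A2) $Y(a)$ is independent of $A$ given $X$, $L=k$; (A3) for some $c>0$, $c<e^*(a\mid x,k)<1-c$ for all $a,x,k$; (A4) $E\{g^*(a,X,k)\mid L=k\}$ and $E\{\Sigma^*(a,X,k)\mid L=k\}$ exist and are finite and $\Sigma^*(a,x,k)$ is positive definite. The estimand is $\tau^*=\sum_k v_k(p_k^*)\theta_k^*$,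 $\theta_k^*=\sum_{a}E\{w_k(a,X)^{\mathsf T}Y(a)\mid L=k\}$, where the $w_k$ are measurable weights for which these expectations exist and $v_k:(0,1]\to\mathbb R$ is continuously differentiable. For an observed-data law $Q$ put $\tau(Q)=\sum_k v_k(Q(L=k))\sum_a E_Q\{w_k(a,X)^{\mathsf T}g_Q(a,X,k)\mid L=k\}$, with $g_Q$ the outcome regression under $Q$. **Estimator.** Let $e(a\mid x,k;\beta_e)$ and $g(a,x,k;\beta_g)$ be finite-dimensional parametric models, $\Psi_\beta(\beta)=(\Psi_e(\beta_e),\Psi_g(\beta_g))$ an estimating function for $\beta=(\beta_e,\beta_g)$, and let $\Psi_\theta(\theta,\beta)$ have components $$\Psi_{\theta,k}=\mathbb 1(L=k)\Big[\frac{w_k(A,X)^{\mathsf T}\{Y-g(A,X,k;\beta_g)\}}{e(A\mid X,k;\beta_e)}+\sum_{a}w_k(a,X)^{\mathsf T}g(a,X,k;\beta_g)-\theta_k\Big].$$ Let $\hat\beta$ and $\hat\theta$ solve $\sum_{i\le N}\Psi_\beta(O_i,L_i;\hat\beta)=0$ and $\sum_{i\le N}\Psi_\theta(O_i,L_i;\hat\theta,\hat\beta)=0$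 (with probability tending to one), suppose $\hat\beta\to\beta^\dagger$ in probability, and put $\hat\tau=\sum_k v_k(\hat p_k)\hat\theta_k$, $\hat p_k=N_k/N$, where $N_k$ is the number of clusters of type $k$ among the first $N$. Assume for $\Psi=(\Psi_\theta,\Psi_\beta)$: (R1) $(\theta,\beta)$ ranges over an open, relatively compact set, in which $\beta_e$ and $\beta_g$ are variationally independent; (R2) $\Psi$ is twice continuously differentiable in $(\theta,\beta)$; (R3) $E\Psi=0$ has a unique root $(\theta^\dagger,\beta^\dagger)$, at which $E\|\Psi\|^2<\infty$ and $E\{\partial\Psi/\partial(\theta,\beta)\}$ exists and is nonsingular; (R4) the second derivatives of $\Psi$ are dominated by an integrable function near $(\theta^\dagger,\beta^\dagger)$. Assume that both models are correct: $\beta_e^\dagger$ is the unique parameter with $e(\cdot;\beta_e^\dagger)=e^*$ and $\beta_g^\dagger$ the unique parameter with $g(\cdot;\beta_g^\dagger)=g^*$. **Models and bounds.** $\mathcal M_{\rm NP}$ is the set of all laws of $(O,L)$ whose propensity score lies between $c$ and $1-c$, whose conditional moments exist as in (A4) (positive definiteness is not required), and for which the expectations in $\tau(Q)$ exist; $\mathcal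 M_{{\rm NP},e^*}$ is the subset of laws with propensity score $e^*$. A regular parametric submodel of a model through the true law $P$ is a family $(Q_\eta)$, $\eta\in\mathbb R^d$, with $Q_{\eta^*}=P$, that for $\eta$ near $\eta^*$ is contained in the model and dominated by a $\sigma$-finite measure, whose root-densities are differentiable in quadratic mean at $\eta^*$ with score $s\in L^2(P)$ and nonsingular information $I=E(ss^{\mathsf T})$, and along which $E_\eta[\{w_L(A,X)^{\mathsf T}(Y-g^*(A,X,L))\}^2]$ and $E_\eta[\{\sum_a w_L(a,X)^{\mathsf T}g^*(a,X,L)\}^2]$ stay bounded near $\eta^*$. The semiparametric efficiency bound of $\tau$ at $P$ in a model is $V$ if $\eta\mapsto\tau(Q_\eta)$ is differentiable at $\eta^*$ along all regular parametric submodels and $V$ is the supremum over them of the Cramér–Rao bounds $\nabla\tau(Q_{\eta^*})^{\mathsf T}I^{-1}\nabla\tau(Q_{\eta^*})$. **Theorem (Adaptation to known propensity score).** Under these conditions $\tau^*=\tau(P)$, and there is a finite $V\ge 0$ such that $\sqrt N(\hat\tau-\tau^*)$ converges in distribution to $N(0,V)$ and $V$ is the semiparametric efficiency bound of $\tau$ at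 $P$ in the model $\mathcal M_{{\rm NP},e^*}$, in which the propensity score is known. The same $V$ is also the bound in $\mathcal M_{\rm NP}$, where $e^*$ is unknown, so knowing the propensity score yields no efficiency gain. -/

import Mathlib

open MeasureTheory ProbabilityTheory Filter Topology
open scoped Matrix NNReal ENNReal

noncomputable section

namespace PartialInterference

/-! ### Data -/

/-- Outcome vectors of a cluster with `m` units. -/
abbrev Outcome (m : ℕ) := Fin m → ℝ

/-- Treatment vectors of a cluster with `m` units. -/
abbrev Treat (m : ℕ) := Fin m → Bool

/-- Observed data `(Y, A, X)` of a cluster of type `k`. -/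
abbrev ClusterObs {K : ℕ} (M : Fin K → ℕ) (X : Fin K → Type*) (k : Fin K) :=
  Outcome (M k) × Treat (M k) × X k

/-- Observed data `(O, L)` of a cluster: the type `L` and then `O = (Y, A, X)`, whose dimension
depends on `L`. -/
abbrev Obs {K : ℕ} (M : Fin K → ℕ) (X : Fin K → Type*) := Σ k : Fin K, ClusterObs M X k

/-- Full data of a cluster of type `k`: the potential outcomes `a ↦ Y(a)` and `(Y, A, X)`. -/
abbrev ClusterFull {K : ℕ} (M : Fin K → ℕ) (X : Fin K → Type*) (k : Fin K) :=
  (Treat (M k) → Outcome (M k)) × ClusterObs M X k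

/-- Full data of a cluster together with its type. -/
abbrev Full {K : ℕ} (M : Fin K → ℕ) (X : Fin K → Type*) := Σ k : Fin K, ClusterFull M X k

/-- Forget the potential outcomes. -/
def observe {K : ℕ} {M : Fin K → ℕ} {X : Fin K → Type*} (z : Full M X) : Obs M X :=
  ⟨z.1, z.2.2⟩

/-! ### Conditioning on the cluster type -/

section TypeLaw

variable {K : ℕ} {α : Fin K → Type*} [∀ k, MeasurableSpace (α k)]

/-- `pr(L = k)`. -/
def typeProb (Q : Measure (Σ k, α k)) (k : Fin K) : ℝ := Q.real (Sigma.fst ⁻¹' {k})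

/-- Conditional law given `L = k`, as a measure on the space of data of type `k`
(the zero measure when `pr(L = k) = 0`). -/
def typeLaw (Q : Measure (Σ k, α k)) (k : Fin K) : Measure (α k) :=
  (Q (Sigma.fst ⁻¹' {k}))⁻¹ • Q.comap (Sigma.mk k)

theorem measurableSet_image_sigmaMk (k : Fin K) {s : Set (α k)} (hs : MeasurableSet s) :
    MeasurableSet (Sigma.mk k '' s : Set (Σ k, α k)) := by
  refine MeasurableSpace.measurableSet_iInf.2 fun j => ?_
  change MeasurableSet (Sigma.mk j ⁻¹' (Sigma.mk k '' s))
  by_cases h : j = k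
  · subst h
    rwa [Set.preimage_image_eq _ sigma_mk_injective]
  · convert MeasurableSet.empty
    ext x
    simp only [Set.mem_preimage, Set.mem_image, Set.mem_empty_iff_false, iff_false, not_exists,
      not_and]
    intro y _ hy
    exact h (congrArg Sigma.fst hy).symm

theorem typeLaw_apply (Q : Measure (Σ k, α k)) (k : Fin K) {s : Set (α k)}
    (hs : MeasurableSet s) :
    typeLaw Q k s = (Q (Sigma.fst ⁻¹' {k}))⁻¹ * Q (Sigma.mk k '' s) := by
  rw [typeLaw, Measure.smul_apply, smul_eq_mul,
    Measure.comap_apply _ sigma_mk_injective (fun t ht => measurableSet_image_sigmaMk k ht) _ hs]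

instance (Q : Measure (Σ k, α k)) (k : Fin K) : IsFiniteMeasure (typeLaw Q k) := by
  refine ⟨?_⟩
  have h : (Sigma.mk k '' Set.univ : Set (Σ k, α k)) = Sigma.fst ⁻¹' {k} := by
    rw [Set.image_univ, Set.range_sigmaMk]
  rw [typeLaw_apply Q k MeasurableSet.univ, h]
  exact lt_of_le_of_lt (ENNReal.inv_mul_le_one _) ENNReal.one_lt_top

end TypeLaw

/-! ### Propensity score, outcome regression and conditional covariance -/

/-- Functions of the form `e(a | x, k)`. -/
abbrev PropFun {K : ℕ} (M : Fin K → ℕ) (X : Fin K → Type*) :=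
  ∀ k : Fin K, Treat (M k) → X k → ℝ

/-- Vector-valued functions of the form `g(a, x, k)` (or `w_k(a, x)`). -/
abbrev RegFun {K : ℕ} (M : Fin K → ℕ) (X : Fin K → Type*) :=
  ∀ k : Fin K, Treat (M k) → X k → Outcome (M k)

variable {K : ℕ} {M : Fin K → ℕ} {X : Fin K → Type*} [∀ k, MeasurableSpace (X k)]

/-- Law of the covariates given `L = k`. -/
def covLaw (Q : Measure (Obs M X)) (k : Fin K) : Measure (X k) :=
  (typeLaw Q k).map fun o => o.2.2

/-- Law of `Y` given `A = a`, `X = x`, `L = k`. -/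
def outcomeLaw (Q : Measure (Obs M X)) (k : Fin K) (a : Treat (M k)) (x : X k) :
    Measure (Outcome (M k)) :=
  condDistrib (fun o : ClusterObs M X k => o.1) (fun o => o.2) (typeLaw Q k) (a, x)

/-- Propensity score `pr(A = a | X = x, L = k)`. -/
def propensity (Q : Measure (Obs M X)) : PropFun M X := fun k a x =>
  (condDistrib (fun o : ClusterObs M X k => o.2.1) (fun o => o.2.2) (typeLaw Q k) x).real {a}

/-- Outcome regression `E(Y | A = a, X = x, L = k)`. -/
def outcomeReg (Q : Measure (Obs M X)) : RegFun M X := fun k a x j =>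
  ∫ y, y j ∂outcomeLaw Q k a x

/-- Conditional covariance matrix `var(Y | A = a, X = x, L = k)`. -/
def outcomeCov (Q : Measure (Obs M X)) (k : Fin K) (a : Treat (M k)) (x : X k) :
    Matrix (Fin (M k)) (Fin (M k)) ℝ :=
  Matrix.of fun i j => ∫ y, (y i - outcomeReg Q k a x i) * (y j - outcomeReg Q k a x j)
    ∂outcomeLaw Q k a x

/-- Two propensity functions agree under `Q`. -/
def PropEq (Q : Measure (Obs M X)) (e e' : PropFun M X) : Prop :=
  ∀ k a, ∀ᵐ x ∂covLaw Q k, e k a x = e' k a x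

/-- Two outcome regressions agree under `Q`. -/
def RegEq (Q : Measure (Obs M X)) (g g' : RegFun M X) : Prop :=
  ∀ k a, ∀ᵐ x ∂covLaw Q k, g k a x = g' k a x

/-- The conditional second moments of the outcome exist, and
`E{g(a, X, k) | L = k}`, `E{Σ(a, X, k) | L = k}` exist and are finite. -/
structure MomentsExist (Q : Measure (Obs M X)) : Prop where
  memLp : ∀ k a, ∀ᵐ x ∂covLaw Q k, ∀ j, MemLp (fun y : Outcome (M k) => y j) 2 (outcomeLaw Q k a x)
  reg : ∀ k a j, Integrable (fun x => outcomeReg Q k a x j) (covLaw Q k)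
  cov : ∀ k a i j, Integrable (fun x => outcomeCov Q k a x i j) (covLaw Q k)

/-! ### Estimands -/

/-- The causal estimand `τ = ∑ₖ vₖ(pₖ) θₖ`, `θₖ = ∑ₐ E{wₖ(a, X)ᵀ Y(a) | L = k}`. -/
def causalEstimand (w : RegFun M X) (v : Fin K → ℝ → ℝ) (F : Measure (Full M X)) : ℝ :=
  ∑ k, v k (typeProb F k) *
    ∑ a, ∫ z : ClusterFull M X k, w k a z.2.2.2 ⬝ᵥ z.1 a ∂typeLaw F k

/-- The observed-data functional `τ(Q) = ∑ₖ vₖ(pₖ) ∑ₐ E{wₖ(a, X)ᵀ g(a, X, k) | L = k}`. -/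
def estimand (w : RegFun M X) (v : Fin K → ℝ → ℝ) (Q : Measure (Obs M X)) : ℝ :=
  ∑ k, v k (typeProb Q k) * ∑ a, ∫ x, w k a x ⬝ᵥ outcomeReg Q k a x ∂covLaw Q k

/-! ### Causal assumptions -/

/-- Assumptions on the law `F` of the full data of a cluster, with propensity score `e` and
overlap constant `c`. -/
structure CausalAssumptions [∀ k, StandardBorelSpace (X k)] (F : Measure (Full M X))
    (e : PropFun M X) (c : ℝ) : Prop where
  /-- every cluster type occurs -/
  typeProb_pos : ∀ k, 0 < typeProb F k
  /-- `e` is the propensity score -/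
  prop_measurable : ∀ k a, Measurable (e k a)
  prop_eq : PropEq (F.map observe) (propensity (F.map observe)) e
  /-- consistency: `Y = Y(A)` -/
  consistency : ∀ᵐ z ∂F, z.2.2.1 = z.2.1 z.2.2.2.1
  /-- conditional ignorability: `Y(a) ⫫ A | X, L = k` -/
  ignorability : ∀ k a,
    CondIndepFun (MeasurableSpace.comap (fun z : ClusterFull M X k => z.2.2.2) inferInstance)
      (Measurable.comap_le (by fun_prop))
      (fun z : ClusterFull M X k => z.1 a) (fun z => z.2.2.1) (typeLaw F k)
  /-- overlap -/
  c_pos : 0 < c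
  overlap : ∀ k a x, c < e k a x ∧ e k a x < 1 - c
  /-- moments -/
  moments : MomentsExist (F.map observe)
  cov_posDef : ∀ k a, ∀ᵐ x ∂covLaw (F.map observe) k,
    (outcomeCov (F.map observe) k a x).PosDef

/-! ### Semiparametric models and efficiency bounds -/

/-- The nonparametric model: `(O, L)` has an arbitrary law satisfying overlap with constant `c`,
the moment conditions, and such that the expectations that define the estimand exist. -/
def modelNP (w : RegFun M X) (c : ℝ) : Set (Measure (Obs M X)) :=
  {Q | IsProbabilityMeasure Q ∧
    (∀ k a, ∀ᵐ x ∂covLaw Q k, c < propensity Q k a x ∧ propensity Q k a x < 1 - c) ∧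
    MomentsExist Q ∧
    ∀ k a, Integrable (fun x => w k a x ⬝ᵥ outcomeReg Q k a x) (covLaw Q k)}

/-- The nonparametric model with known propensity score `e`. -/
def modelNPKnown (w : RegFun M X) (c : ℝ) (e : PropFun M X) : Set (Measure (Obs M X)) :=
  {Q | Q ∈ modelNP w c ∧ PropEq Q (propensity Q) e}

/-- Fisher information matrix of a score `s` under `P`. -/
def information {𝓞 : Type*} [MeasurableSpace 𝓞] (P : Measure 𝓞) {d : ℕ} (s : 𝓞 → Fin d → ℝ) :
    Matrix (Fin d) (Fin d) ℝ :=
  Matrix.of fun i j => ∫ o, s o i * s o j ∂P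

/-- `Q` is a regular `d`-dimensional parametric submodel of `𝓜`, passing through `P` at the
parameter value `η₀`, with score `s` there: it is dominated, root-densities are differentiable in
quadratic mean, the information is nonsingular, and the functions in `𝓗` have second moments that
are bounded uniformly in a neighbourhood of `η₀`. -/
structure IsRegularSubmodel {𝓞 : Type*} [MeasurableSpace 𝓞] (𝓜 : Set (Measure 𝓞))
    (𝓗 : Set (𝓞 → ℝ)) (P : Measure 𝓞) {d : ℕ} (Q : (Fin d → ℝ) → Measure 𝓞) (η₀ : Fin d → ℝ)
    (s : 𝓞 → Fin d → ℝ) : Prop where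
  at_center : Q η₀ = P
  mem_model : ∀ᶠ η in 𝓝 η₀, Q η ∈ 𝓜
  score_measurable : Measurable s
  score_memLp : ∀ j, MemLp (fun o => s o j) 2 P
  qmd : ∃ (μ : Measure 𝓞) (f : (Fin d → ℝ) → 𝓞 → ℝ), SigmaFinite μ ∧
    (∀ η, Measurable (f η)) ∧ (∀ η o, 0 ≤ f η o) ∧
    (∀ᶠ η in 𝓝 η₀, Q η = μ.withDensity fun o => ENNReal.ofReal (f η o)) ∧
    (fun η => ∫ o, (√(f η o) - √(f η₀ o) - 1 / 2 * ((η - η₀) ⬝ᵥ s o) * √(f η₀ o)) ^ 2 ∂μ)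
      =o[𝓝 η₀] fun η => ‖η - η₀‖ ^ 2
  information_nonsingular : IsUnit (information P s).det
  moments_bounded : ∀ h ∈ 𝓗, ∃ C : ℝ≥0, ∀ᶠ η in 𝓝 η₀, ∫⁻ o, ‖h o‖ₑ ^ 2 ∂Q η ≤ C

/-- Gradient at `η₀` of the parameter `τ` along a submodel. -/
def submodelGradient {𝓞 : Type*} [MeasurableSpace 𝓞] (τ : Measure 𝓞 → ℝ) {d : ℕ}
    (Q : (Fin d → ℝ) → Measure 𝓞) (η₀ : Fin d → ℝ) : Fin d → ℝ :=
  fun j => fderiv ℝ (fun η => τ (Q η)) η₀ (Pi.single j 1)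

/-- `V` is the semiparametric efficiency bound of `τ` at `P` in the model `𝓜`: `τ` is
differentiable along every regular parametric submodel, and `V` is the supremum of the Cramér–Rao
bounds of the regular parametric submodels. -/
def IsEfficiencyBound {𝓞 : Type*} [MeasurableSpace 𝓞] (𝓜 : Set (Measure 𝓞)) (𝓗 : Set (𝓞 → ℝ))
    (P : Measure 𝓞) (τ : Measure 𝓞 → ℝ) (V : ℝ) : Prop :=
  (∀ (d : ℕ) (Q : (Fin d → ℝ) → Measure 𝓞) (η₀ : Fin d → ℝ) (s : 𝓞 → Fin d → ℝ),
    IsRegularSubmodel 𝓜 𝓗 P Q η₀ s → DifferentiableAt ℝ (fun η => τ (Q η)) η₀) ∧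
  IsLUB {b : ℝ | ∃ (d : ℕ) (Q : (Fin d → ℝ) → Measure 𝓞) (η₀ : Fin d → ℝ) (s : 𝓞 → Fin d → ℝ),
    IsRegularSubmodel 𝓜 𝓗 P Q η₀ s ∧
    b = submodelGradient τ Q η₀ ⬝ᵥ ((information P s)⁻¹ *ᵥ submodelGradient τ Q η₀)} V

/-- The weighted residual `w(A, X)ᵀ {Y - g(A, X)}`. -/
def weightedResidual (w g : RegFun M X) (o : Obs M X) : ℝ :=
  w o.1 o.2.2.1 o.2.2.2 ⬝ᵥ (o.2.1 - g o.1 o.2.2.1 o.2.2.2)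

/-- The weighted outcome regression `∑ₐ w(a, X)ᵀ g(a, X)`. -/
def weightedRegression (w g : RegFun M X) (o : Obs M X) : ℝ :=
  ∑ a, w o.1 a o.2.2.2 ⬝ᵥ g o.1 a o.2.2.2

/-- The functions whose second moments stay bounded along regular submodels through `P`. -/
def momentFunctions (w : RegFun M X) (P : Measure (Obs M X)) : Set (Obs M X → ℝ) :=
  {weightedResidual w (outcomeReg P), weightedRegression w (outcomeReg P)}

/-! ### The estimator -/

/-- Parameters `(β_e, β_g)` of the propensity score and outcome models. -/
abbrev Nuis (de dg : ℕ) := (Fin de → ℝ) × (Fin dg → ℝ)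

/-- Parameters `(θ, β)`. -/
abbrev Par (K de dg : ℕ) := (Fin K → ℝ) × Nuis de dg

/-- `Ψ_θ(θ, β) = (𝟙(L = k) {φₖ(O, e(· ; β_e), g(· ; β_g)) - θₖ})ₖ`. -/
def psiTheta {de dg : ℕ} (w : RegFun M X) (e : (Fin de → ℝ) → PropFun M X)
    (g : (Fin dg → ℝ) → RegFun M X) (z : Par K de dg) (o : Obs M X) : Fin K → ℝ := fun k =>
  if o.1 = k then
    weightedResidual w (g z.2.2) o / e z.2.1 o.1 o.2.2.1 o.2.2.2
      + weightedRegression w (g z.2.2) o - z.1 k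
  else 0

/-- `Ψ_β(β) = (Ψ_e(β_e), Ψ_g(β_g))`. -/
def psiBeta {de dg : ℕ} (ψe : (Fin de → ℝ) → Obs M X → Fin de → ℝ)
    (ψg : (Fin dg → ℝ) → Obs M X → Fin dg → ℝ) (β : Nuis de dg) (o : Obs M X) : Nuis de dg :=
  (ψe β.1 o, ψg β.2 o)

/-- The stacked estimating function `Ψ(θ, β)`. -/
def psi {de dg : ℕ} (w : RegFun M X) (e : (Fin de → ℝ) → PropFun M X)
    (g : (Fin dg → ℝ) → RegFun M X) (ψe : (Fin de → ℝ) → Obs M X → Fin de → ℝ)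
    (ψg : (Fin dg → ℝ) → Obs M X → Fin dg → ℝ) (z : Par K de dg) (o : Obs M X) : Par K de dg :=
  (psiTheta w e g z o, psiBeta ψe ψg z.2 o)

/-- Regularity conditions on the estimating function `Ψ`, with parameter set `Ω₀` and population
root `z₀`. -/
structure RegularityConditions {𝓞 : Type*} [MeasurableSpace 𝓞] {de dg : ℕ}
    (P : Measure 𝓞) (Ψ : Par K de dg → 𝓞 → Par K de dg) (Ω₀ : Set (Par K de dg))
    (z₀ : Par K de dg) : Prop where
  /-- the parameters lie in an open, relatively compact set -/
  isOpen : IsOpen Ω₀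
  subset_compact : ∃ C, IsCompact C ∧ Ω₀ ⊆ C
  /-- `β_e` and `β_g` are variationally independent -/
  var_indep : ∀ z ∈ Ω₀, ∀ z' ∈ Ω₀, ∃ θ, (θ, z.2.1, z'.2.2) ∈ Ω₀
  /-- `Ψ` is twice continuously differentiable in the parameters -/
  contDiff : ∀ᵐ o ∂P, ContDiffOn ℝ 2 (fun z => Ψ z o) Ω₀
  /-- `z₀` is the unique root of `E{Ψ(z)} = 0`, and `E{‖Ψ(z₀)‖²} < ∞` -/
  mem : z₀ ∈ Ω₀
  root : ∫ o, Ψ z₀ o ∂P = 0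
  root_unique : ∀ z ∈ Ω₀, Integrable (Ψ z) P → ∫ o, Ψ z o ∂P = 0 → z = z₀
  memLp : MemLp (Ψ z₀) 2 P
  /-- the expected Jacobian at `z₀` exists and is nonsingular -/
  jacobian_integrable : Integrable (fun o => fderiv ℝ (fun z => Ψ z o) z₀) P
  jacobian_nonsingular : IsUnit (∫ o, fderiv ℝ (fun z => Ψ z o) z₀ ∂P)
  /-- the second derivatives are dominated near `z₀` by an integrable function -/
  dominated : ∃ U ∈ 𝓝 z₀, ∃ H : 𝓞 → ℝ, Integrable H P ∧
    ∀ᵐ o ∂P, ∀ z ∈ U, ‖iteratedFDeriv ℝ 2 (fun z => Ψ z o) z‖ ≤ H o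

/-- `p̂ₖ = Nₖ / N` for the sample `o₀, …, o_{N-1}`. -/
def typeFreq (o : ℕ → Obs M X) (N : ℕ) (k : Fin K) : ℝ :=
  (((Finset.range N).filter fun i => (o i).1 = k).card : ℝ) / N

end PartialInterference

end

open PartialInterference

set_option linter.unusedSectionVars false

noncomputable section

namespace PartialInterference

/-! Everything rests on one function `D`, called `effInfluence`. It is the sum over `k` of
`v_k(p_k)/p_k · 1(L=k)(φ - θ_k) + v_k'(p_k) θ_k (1(L=k) - p_k)`, where `φ` is the augmented inverse
probability weighted (AIPW) function at the true propensity score and the true regression. It has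
mean zero, and `V = ∫ D² dP`. The causal estimand equals `τ(P)` because the factor `1(A=a)/e*(a|X)`
has mean one given `X` and `Y(a)`, and on `A = a` consistency replaces `Y(a)` by `Y`
(`map_potentialOutcome`).

The gradient of `τ` along any regular submodel of the nonparametric model is the covariance of `D`
with the score (`LawConditions.hasFDerivAt_estimand`). The reason is that `p_k θ_k` under `Q` is the
`Q`-mean of the AIPW function built from the propensity score of `Q` and any fixed regression
(`typeProb_mul_typeMean`). With the regression frozen at that of `P`, this mean splits in two. One
piece is the `Q`-mean of a fixed function with bounded second moments, which is differentiable by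
quadratic mean differentiability (`IsQMD.hasFDerivAt_integral`). The other is the `Q`-mean of the
residual times the difference of inverse propensity scores. Its `P`-mean is zero, and the difference
is bounded and tends to zero in `L¹(P)`, so the piece is of second order
(`IsQMD.isLittleO_integral_mul`). No direction that perturbs the propensity score therefore
contributes.

Projecting `D` on the score of a submodel bounds each Cramér–Rao bound by `V` (`cramerRao_le`). The
supremum is `V` already when the propensity score is known. Indeed `D` is a function with
conditional mean zero given `(A, X, L)` plus a centred function of `(X, L)` (`effInfluence_eq_add`),
and both kinds of functions are limits in `L²` of bounded scores `s` of the same kind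
(`exists_boundedScore`). The densities `1 + t s` leave the propensity score unchanged and stay in
the smaller model (`IsBoundedScore.mem_modelNPKnown`). The two models are thus the extremes of a
range in which the bound is constant.

The estimator is asymptotically linear with influence function `D`. The AIPW moment stays zero when
only one of the two nuisance functions is perturbed, so the expected Jacobian of the `θ`-components
in the nuisance directions vanishes (`LawConditions.jacobian_fst_eq_zero`). Estimating `β` then has
no first-order effect on them (`RegularityConditions.tendsto_sqrt_mul_norm_sub`). Because `Ψ_θ` is
affine in `θ`, the root equation yields `p̂_k(θ̂_k - θ_k)` exactly and no prior consistency of `θ̂`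
is needed. A delta method handles `v_k(p̂_k)` (`tendsto_delta`), and the central limit theorem
applied to averages of `D` finishes the proof. -/

/-! ### Disintegration of the law of `(Y, A, X)` -/

section Disintegration

variable {β α γ : Type*} [MeasurableSpace β] [StandardBorelSpace β] [Nonempty β]
  [MeasurableSpace α] [MeasurableSingletonClass α] [Fintype α] [Nonempty α] [MeasurableSpace γ]
  (ν : Measure (β × α × γ)) [IsFiniteMeasure ν]

/-- Conditional law of the response given treatment and covariates. -/
abbrev respKernel : Kernel (α × γ) β := condDistrib (fun o : β × α × γ => o.1) (fun o => o.2) ν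

/-- Conditional law of the treatment given covariates. -/
abbrev trtKernel : Kernel γ α := condDistrib (fun o : β × α × γ => o.2.1) (fun o => o.2.2) ν

/-- Joint law of treatment and covariates. -/
abbrev trtCovLaw : Measure (α × γ) := ν.map fun o => o.2

/-- Law of the covariates. -/
abbrev covMarginal : Measure γ := ν.map fun o => o.2.2

variable {ν}

theorem trtCovLaw_compProd_respKernel :
    trtCovLaw ν ⊗ₘ respKernel ν = ν.map fun o => (o.2, o.1) :=
  compProd_map_condDistrib (by fun_prop)

theorem covMarginal_compProd_trtKernel :
    covMarginal ν ⊗ₘ trtKernel ν = (trtCovLaw ν).map Prod.swap := by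
  rw [compProd_map_condDistrib (by fun_prop), Measure.map_map (by fun_prop) (by fun_prop)]
  rfl

theorem lintegral_trtCovLaw {h : α × γ → ℝ≥0∞} (hh : Measurable h) :
    ∫⁻ p, h p ∂trtCovLaw ν =
      ∫⁻ x, ∑ a, trtKernel ν x {a} * h (a, x) ∂covMarginal ν := by
  have h1 : ∫⁻ p, h p ∂trtCovLaw ν = ∫⁻ q, h q.swap ∂(trtCovLaw ν).map Prod.swap := by
    rw [lintegral_map (by fun_prop) measurable_swap]
    simp only [Prod.swap_swap]
  rw [h1, ← covMarginal_compProd_trtKernel, Measure.lintegral_compProd (by fun_prop)]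
  refine lintegral_congr fun x => ?_
  rw [lintegral_fintype]
  exact Finset.sum_congr rfl fun a _ => mul_comm _ _

theorem lintegral_resp {f : β × α × γ → ℝ≥0∞} (hf : Measurable f) :
    ∫⁻ o, f o ∂ν = ∫⁻ p, ∫⁻ y, f (y, p) ∂respKernel ν p ∂trtCovLaw ν := by
  have h1 : ∫⁻ o, f o ∂ν = ∫⁻ q, f q.swap ∂ν.map fun o => (o.2, o.1) := by
    rw [lintegral_map (by fun_prop) (by fun_prop)]
    rfl
  rw [h1, ← trtCovLaw_compProd_respKernel, Measure.lintegral_compProd (by fun_prop)]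
  rfl

theorem measurable_lintegral_resp {f : β × α × γ → ℝ≥0∞} (hf : Measurable f) :
    Measurable fun p => ∫⁻ y, f (y, p) ∂respKernel ν p :=
  Measurable.lintegral_kernel_prod_right (f := fun p y => f (y, p)) (by fun_prop)

theorem stronglyMeasurable_integral_resp {f : β × α × γ → ℝ} (hf : Measurable f) :
    StronglyMeasurable fun p => ∫ y, f (y, p) ∂respKernel ν p :=
  StronglyMeasurable.integral_condDistrib (f := fun q : (α × γ) × β => f (q.2, q.1))
    (hf.comp (by fun_prop)).stronglyMeasurable

theorem measurable_trtKernel_real (a : α) : Measurable fun x => (trtKernel ν x).real {a} :=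
  ((trtKernel ν).measurable_coe (measurableSet_singleton a)).ennreal_toReal

theorem lintegral_disintegrate {f : β × α × γ → ℝ≥0∞} (hf : Measurable f) :
    ∫⁻ o, f o ∂ν =
      ∫⁻ x, ∑ a, trtKernel ν x {a} * ∫⁻ y, f (y, a, x) ∂respKernel ν (a, x) ∂covMarginal ν := by
  rw [lintegral_resp hf, lintegral_trtCovLaw (measurable_lintegral_resp hf)]

theorem integrable_swap_resp {f : β × α × γ → ℝ} (hf : Integrable f ν) :
    Integrable (fun q : (α × γ) × β => f (q.2, q.1)) (ν.map fun o => (o.2, o.1)) := by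
  have e : MeasurableEmbedding fun o : β × α × γ => (o.2, o.1) :=
    (MeasurableEquiv.prodComm (α := β) (β := α × γ)).measurableEmbedding
  rw [e.integrable_map_iff]
  exact hf

theorem integral_resp {f : β × α × γ → ℝ} (hf : Integrable f ν) :
    ∫ o, f o ∂ν = ∫ p, ∫ y, f (y, p) ∂respKernel ν p ∂trtCovLaw ν := by
  have e : MeasurableEmbedding fun o : β × α × γ => (o.2, o.1) :=
    (MeasurableEquiv.prodComm (α := β) (β := α × γ)).measurableEmbedding
  have h1 : ∫ o, f o ∂ν = ∫ q, f q.swap ∂ν.map fun o => (o.2, o.1) := by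
    rw [e.integral_map]
    rfl
  have h2 := integrable_swap_resp hf
  rw [← trtCovLaw_compProd_respKernel] at h2
  rw [h1, ← trtCovLaw_compProd_respKernel]
  exact Measure.integral_compProd h2

theorem integrable_integral_resp {f : β × α × γ → ℝ} (hf : Integrable f ν) :
    Integrable (fun p => ∫ y, f (y, p) ∂respKernel ν p) (trtCovLaw ν) :=
  (integrable_swap_resp hf).integral_condDistrib_map (by fun_prop)

theorem integrable_swap_trt {h : α × γ → ℝ} (hh : Integrable h (trtCovLaw ν)) :
    Integrable (fun q : γ × α => h q.swap) (covMarginal ν ⊗ₘ trtKernel ν) := by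
  have e : MeasurableEmbedding (Prod.swap : α × γ → γ × α) :=
    (MeasurableEquiv.prodComm (α := α) (β := γ)).measurableEmbedding
  rw [covMarginal_compProd_trtKernel, e.integrable_map_iff]
  exact hh

theorem integral_trt {h : α × γ → ℝ} (hh : Integrable h (trtCovLaw ν)) :
    ∫ p, h p ∂trtCovLaw ν = ∫ x, ∑ a, (trtKernel ν x).real {a} * h (a, x) ∂covMarginal ν := by
  have e : MeasurableEmbedding (Prod.swap : α × γ → γ × α) :=
    (MeasurableEquiv.prodComm (α := α) (β := γ)).measurableEmbedding
  have h1 : ∫ p, h p ∂trtCovLaw ν = ∫ q, h q.swap ∂(trtCovLaw ν).map Prod.swap := by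
    rw [e.integral_map]
    simp
  rw [h1, ← covMarginal_compProd_trtKernel, Measure.integral_compProd (integrable_swap_trt hh)]
  refine integral_congr_ae (Eventually.of_forall fun x => ?_)
  simp only
  rw [integral_fintype (Integrable.of_finite)]
  rfl

theorem integrable_trt {h : α × γ → ℝ} (hh : Integrable h (trtCovLaw ν)) (a : α) :
    Integrable (fun x => (trtKernel ν x).real {a} * h (a, x)) (covMarginal ν) := by
  classical
  have h1 : Integrable ((Prod.fst ⁻¹' {a}).indicator h) (trtCovLaw ν) :=
    hh.indicator (measurable_fst (measurableSet_singleton a))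
  have h2 := (integrable_swap_trt h1).integral_compProd
  refine h2.congr (Eventually.of_forall fun x => ?_)
  simp only
  rw [integral_fintype (Integrable.of_finite), Finset.sum_eq_single a]
  · simp
  · intro b _ hb
    simp [Set.indicator, hb]
  · simp

theorem ae_trtCovLaw_of_ae {S : α × γ → Prop} (h : ∀ a, ∀ᵐ x ∂covMarginal ν, S (a, x)) :
    ∀ᵐ p ∂trtCovLaw ν, S p := by
  have h1 : ∀ᵐ x ∂covMarginal ν, ∀ a, S (a, x) := ae_all_iff.2 h
  have h2 : covMarginal ν = (trtCovLaw ν).map Prod.snd := by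
    rw [Measure.map_map (by fun_prop) (by fun_prop)]
    rfl
  rw [h2] at h1
  filter_upwards [ae_of_ae_map (by fun_prop) h1] with p hp using hp p.1

/-- At almost every `x` the exceptional treatments have conditional probability zero, so a treatment
of positive conditional probability is not among them. Positivity is what turns statements about the
joint law into statements about every arm. -/
theorem ae_of_ae_trtCovLaw {S : α × γ → Prop} (h : ∀ᵐ p ∂trtCovLaw ν, S p)
    (hpos : ∀ a, ∀ᵐ x ∂covMarginal ν, 0 < (trtKernel ν x).real {a}) (a : α) :
    ∀ᵐ x ∂covMarginal ν, S (a, x) := by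
  have e : MeasurableEmbedding (Prod.swap : α × γ → γ × α) :=
    (MeasurableEquiv.prodComm (α := α) (β := γ)).measurableEmbedding
  have h1 : ∀ᵐ q ∂covMarginal ν ⊗ₘ trtKernel ν, S q.swap := by
    rw [covMarginal_compProd_trtKernel, e.ae_map_iff]
    simpa using h
  filter_upwards [Measure.ae_ae_of_ae_compProd h1, hpos a] with x hx hpx
  by_contra hS
  have : trtKernel ν x {a} ≤ trtKernel ν x {b | ¬ S (b, x)} :=
    measure_mono (by simpa using hS)
  have h0 : trtKernel ν x {b | ¬ S (b, x)} = 0 := ae_iff.1 hx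
  rw [h0] at this
  simp [Measure.real, le_antisymm this zero_le] at hpx

theorem sum_trtKernel_real (x : γ) : ∑ a, (trtKernel ν x).real {a} = 1 := by
  rw [sum_measureReal_singleton]
  simp

theorem ae_integrable_resp {f : β × α × γ → ℝ} (hf : Integrable f ν) :
    ∀ᵐ p ∂trtCovLaw ν, Integrable (fun y => f (y, p)) (respKernel ν p) :=
  (integrable_swap_resp hf).condDistrib_ae_map (by fun_prop)

/-- `E[f | A, X]` is square integrable when `f` is. -/
theorem MemLp.integral_resp {f : β × α × γ → ℝ} (hfm : Measurable f) (hf : MemLp f 2 ν) :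
    MemLp (fun o => ∫ y, f (y, o.2) ∂respKernel ν o.2) 2 ν := by
  -- The kernel integral is a version of the conditional expectation, which preserves square
  -- integrability.
  have h1 := condExp_prod_ae_eq_integral_condDistrib (μ := ν)
    (X := fun o : β × α × γ => o.2) (Y := fun o => o.1) (f := fun q => f (q.2, q.1))
    (by fun_prop) (by fun_prop) (hfm.comp (by fun_prop)).stronglyMeasurable
    (by simpa using hf.integrable (by norm_num))
  refine MemLp.ae_eq h1 ?_
  exact MemLp.condExp (by norm_num) (by simpa using hf)

end Disintegration

/-! ### The augmented inverse probability weighted function -/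

section AIPW

variable {m : ℕ} {α γ : Type*} [MeasurableSpace α] [MeasurableSingletonClass α] [Fintype α]
  [Nonempty α] [MeasurableSpace γ]

/-- `w(a, x)ᵀ {y - g(a, x)} / ε(a, x) + ∑ₐ w(a, x)ᵀ g(a, x)`. -/
def aipw (w g : α → γ → Fin m → ℝ) (ε : α → γ → ℝ) (o : (Fin m → ℝ) × α × γ) : ℝ :=
  w o.2.1 o.2.2 ⬝ᵥ (o.1 - g o.2.1 o.2.2) / ε o.2.1 o.2.2 + ∑ a, w a o.2.2 ⬝ᵥ g a o.2.2

/-- Outcome regression of a law of `(Y, A, X)`. -/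
def respMean (ν : Measure ((Fin m → ℝ) × α × γ)) [IsFiniteMeasure ν] (a : α) (x : γ) : Fin m → ℝ :=
  fun j => ∫ y, y j ∂respKernel ν (a, x)

variable {ν : Measure ((Fin m → ℝ) × α × γ)} [IsFiniteMeasure ν]

theorem integral_dotProduct_sub {κ : Measure (Fin m → ℝ)} [IsProbabilityMeasure κ]
    (h : ∀ j, Integrable (fun y : Fin m → ℝ => y j) κ) (u b : Fin m → ℝ) :
    Integrable (fun y => u ⬝ᵥ (y - b)) κ ∧
      ∫ y, u ⬝ᵥ (y - b) ∂κ = u ⬝ᵥ ((fun j => ∫ y, y j ∂κ) - b) := by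
  have h1 : ∀ j, Integrable (fun y : Fin m → ℝ => u j * (y j - b j)) κ := fun j =>
    ((h j).sub (integrable_const _)).const_mul _
  constructor
  · exact integrable_finsetSum _ fun j _ => h1 j
  · simp only [dotProduct, Pi.sub_apply]
    rw [integral_finsetSum _ fun j _ => h1 j]
    refine Finset.sum_congr rfl fun j _ => ?_
    rw [integral_const_mul, integral_sub (h j) (integrable_const _)]
    simp

theorem measurable_uncurry_of_finite {δ : Type*} [MeasurableSpace δ] {f : α → γ → δ}
    (hf : ∀ a, Measurable (f a)) : Measurable fun p : α × γ => f p.1 p.2 :=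
  measurable_from_prod_countable_right hf

theorem measurable_dotProduct {δ : Type*} [MeasurableSpace δ] {f g : δ → Fin m → ℝ}
    (hf : Measurable f) (hg : Measurable g) : Measurable fun x => f x ⬝ᵥ g x := by
  simp only [dotProduct]
  fun_prop

theorem measurable_residual {w g : α → γ → Fin m → ℝ} (hw : ∀ a, Measurable (w a))
    (hg : ∀ a, Measurable (g a)) :
    Measurable fun o : (Fin m → ℝ) × α × γ => w o.2.1 o.2.2 ⬝ᵥ (o.1 - g o.2.1 o.2.2) :=
  measurable_dotProduct ((measurable_uncurry_of_finite hw).comp measurable_snd)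
    (measurable_fst.sub ((measurable_uncurry_of_finite hg).comp measurable_snd))

theorem measurable_aipw {w g : α → γ → Fin m → ℝ} {ε : α → γ → ℝ} (hw : ∀ a, Measurable (w a))
    (hg : ∀ a, Measurable (g a)) (hε : ∀ a, Measurable (ε a)) : Measurable (aipw w g ε) := by
  refine ((measurable_residual hw hg).div
    ((measurable_uncurry_of_finite hε).comp measurable_snd)).add ?_
  exact Finset.measurable_sum _ fun a _ => measurable_dotProduct
    ((hw a).comp (by fun_prop)) ((hg a).comp (by fun_prop))

theorem integral_aipw_resp {w g : α → γ → Fin m → ℝ} {ε : α → γ → ℝ} {p : α × γ}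
    (h : ∀ j, Integrable (fun y : Fin m → ℝ => y j) (respKernel ν p)) :
    ∫ y, aipw w g ε (y, p) ∂respKernel ν p =
      w p.1 p.2 ⬝ᵥ (respMean ν p.1 p.2 - g p.1 p.2) / ε p.1 p.2 + ∑ a, w a p.2 ⬝ᵥ g a p.2 := by
  obtain ⟨h1, h2⟩ := integral_dotProduct_sub h (w p.1 p.2) (g p.1 p.2)
  simp only [aipw]
  rw [integral_add (h1.div_const _) (integrable_const _), integral_div, h2]
  simp
  rfl

/-- The AIPW function has mean `∑ₐ E{w(a, X)ᵀ g_ν(a, X)}` if the propensity score is correct. -/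
theorem integral_aipw_of_propensity {w g : α → γ → Fin m → ℝ} {ε : α → γ → ℝ}
    (hint : ∀ a, ∀ᵐ x ∂covMarginal ν, ∀ j,
      Integrable (fun y : Fin m → ℝ => y j) (respKernel ν (a, x)))
    (hε : ∀ a, ∀ᵐ x ∂covMarginal ν, (trtKernel ν x).real {a} = ε a x ∧ ε a x ≠ 0)
    (hφ : Integrable (aipw w g ε) ν) :
    ∫ o, aipw w g ε o ∂ν = ∫ x, ∑ a, w a x ⬝ᵥ respMean ν a x ∂covMarginal ν := by
  rw [integral_resp hφ, integral_trt (integrable_integral_resp hφ)]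
  refine integral_congr_ae ?_
  filter_upwards [ae_all_iff.2 hint, ae_all_iff.2 hε] with x h1 h2
  -- The propensity score cancels the denominator. Summed over `a`, the error of `g` is then removed
  -- by the augmentation term, because the propensities add up to one.
  have h3 : ∀ a, (trtKernel ν x).real {a} * ∫ y, aipw w g ε (y, a, x) ∂respKernel ν (a, x) =
      (w a x ⬝ᵥ respMean ν a x - w a x ⬝ᵥ g a x)
        + (trtKernel ν x).real {a} * ∑ b, w b x ⬝ᵥ g b x := by
    intro a
    rw [integral_aipw_resp (h1 a), (h2 a).1, dotProduct_sub, mul_add, mul_div_cancel₀ _ (h2 a).2]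
  simp_rw [h3]
  rw [Finset.sum_add_distrib, Finset.sum_sub_distrib, ← Finset.sum_mul, sum_trtKernel_real]
  ring

/-- The AIPW function has mean `∑ₐ E{w(a, X)ᵀ g_ν(a, X)}` if the outcome regression is correct. -/
theorem integral_aipw_of_regression {w g : α → γ → Fin m → ℝ} {ε : α → γ → ℝ}
    (hint : ∀ a, ∀ᵐ x ∂covMarginal ν, ∀ j,
      Integrable (fun y : Fin m → ℝ => y j) (respKernel ν (a, x)))
    (hg : ∀ a, ∀ᵐ x ∂covMarginal ν, g a x = respMean ν a x)
    (hφ : Integrable (aipw w g ε) ν) :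
    ∫ o, aipw w g ε o ∂ν = ∫ x, ∑ a, w a x ⬝ᵥ respMean ν a x ∂covMarginal ν := by
  rw [integral_resp hφ, integral_trt (integrable_integral_resp hφ)]
  refine integral_congr_ae ?_
  filter_upwards [ae_all_iff.2 hint, ae_all_iff.2 hg] with x h1 h2
  -- The residual has conditional mean zero, so nothing is required of `ε`; where it vanishes the
  -- quotient is `0 / 0 = 0`.
  have h3 : ∀ a, (trtKernel ν x).real {a} * ∫ y, aipw w g ε (y, a, x) ∂respKernel ν (a, x) =
      (trtKernel ν x).real {a} * ∑ b, w b x ⬝ᵥ respMean ν b x := by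
    intro a
    rw [integral_aipw_resp (h1 a), h2 a]
    simp [h2]
  simp_rw [h3]
  rw [← Finset.sum_mul, sum_trtKernel_real, one_mul]

/-- A square-integrable AIPW function with correct regression has square-integrable
conditional mean and residual. -/
theorem memLp_of_memLp_aipw {w g : α → γ → Fin m → ℝ} {ε : α → γ → ℝ}
    (hw : ∀ a, Measurable (w a)) (hgm : ∀ a, Measurable (g a)) (hεm : ∀ a, Measurable (ε a))
    (hint : ∀ a, ∀ᵐ x ∂covMarginal ν, ∀ j,
      Integrable (fun y : Fin m → ℝ => y j) (respKernel ν (a, x)))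
    (hg : ∀ a, ∀ᵐ x ∂covMarginal ν, g a x = respMean ν a x)
    (hε : ∀ a x, 0 < ε a x ∧ ε a x ≤ 1)
    (hφ : MemLp (aipw w g ε) 2 ν) :
    MemLp (fun o => ∑ a, w a o.2.2 ⬝ᵥ g a o.2.2) 2 ν ∧
      MemLp (fun o => w o.2.1 o.2.2 ⬝ᵥ (o.1 - g o.2.1 o.2.2)) 2 ν := by
  have hφm := measurable_aipw hw hgm hεm
  -- With the correct regression, this sum is the conditional mean of the AIPW function given
  -- treatment and covariates.
  have h1 : MemLp (fun o : (Fin m → ℝ) × α × γ => ∑ a, w a o.2.2 ⬝ᵥ g a o.2.2) 2 ν := by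
    refine (MemLp.integral_resp hφm hφ).ae_eq ?_
    have h2 : ∀ᵐ p ∂trtCovLaw ν, ∫ y, aipw w g ε (y, p) ∂respKernel ν p =
        ∑ a, w a p.2 ⬝ᵥ g a p.2 := by
      refine ae_trtCovLaw_of_ae fun a => ?_
      filter_upwards [hint a, hg a] with x hx1 hx2
      rw [integral_aipw_resp hx1]
      simp [hx2]
    exact ae_of_ae_map (by fun_prop) h2
  refine ⟨h1, ?_⟩
  have h3 := measurable_residual hw hgm
  have h4 : Measurable fun o : (Fin m → ℝ) × α × γ => ε o.2.1 o.2.2 :=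
    (measurable_uncurry_of_finite hεm).comp measurable_snd
  -- What remains is the residual divided by `ε ≤ 1`, which dominates the residual itself.
  refine (hφ.sub h1).mono h3.aestronglyMeasurable (Eventually.of_forall fun o => ?_)
  simp only [aipw, Pi.sub_apply, add_sub_cancel_right, norm_div, Real.norm_eq_abs,
    abs_of_pos (hε o.2.1 o.2.2).1]
  rw [le_div_iff₀ (hε o.2.1 o.2.2).1]
  exact mul_le_of_le_one_right (abs_nonneg _) (hε o.2.1 o.2.2).2

end AIPW

/-! ### Root densities -/

section RootDensity

variable {𝓞 : Type*} [MeasurableSpace 𝓞] {μ : Measure 𝓞}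

theorem add_sq_le_two_mul (a b : ℝ) : (a + b) ^ 2 ≤ 2 * a ^ 2 + 2 * b ^ 2 := by
  nlinarith [sq_nonneg (a - b)]

theorem memLp_bdd_mul {t h : 𝓞 → ℝ} {B : ℝ} (ht : Measurable t) (hB : ∀ o, |t o| ≤ B)
    (hh : MemLp h 2 μ) : MemLp (fun o => t o * h o) 2 μ := by
  refine hh.of_le_mul (c := B) (ht.aestronglyMeasurable.mul hh.1) (Eventually.of_forall fun o => ?_)
  rw [norm_mul]
  exact mul_le_mul_of_nonneg_right (hB o) (norm_nonneg _)

theorem integrable_mul_of_memLp {f g : 𝓞 → ℝ} (hf : MemLp f 2 μ) (hg : MemLp g 2 μ) :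
    Integrable (fun o => f o * g o) μ :=
  hf.integrable_mul hg

theorem abs_integral_mul_le {f g : 𝓞 → ℝ} (hf : MemLp f 2 μ) (hg : MemLp g 2 μ) :
    |∫ o, f o * g o ∂μ| ≤ √(∫ o, f o ^ 2 ∂μ) * √(∫ o, g o ^ 2 ∂μ) := by
  have h := integral_mul_le_Lp_mul_Lq_of_nonneg (μ := μ) (Real.HolderConjugate.two_two)
    (f := fun o => |f o|) (g := fun o => |g o|) (Eventually.of_forall fun _ => abs_nonneg _)
    (Eventually.of_forall fun _ => abs_nonneg _)
    (by simpa using hf.norm) (by simpa using hg.norm)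
  simp only [Real.rpow_two, sq_abs] at h
  rw [Real.sqrt_eq_rpow, Real.sqrt_eq_rpow]
  refine le_trans ?_ h
  refine (abs_integral_le_integral_abs).trans (le_of_eq ?_)
  simp only [abs_mul]

/-- The measure with density `p`. -/
abbrev dens (μ : Measure 𝓞) (p : 𝓞 → ℝ) : Measure 𝓞 :=
  μ.withDensity fun o => ENNReal.ofReal (p o)

variable {p q : 𝓞 → ℝ}

theorem integral_dens (hp : Measurable p) (hp0 : ∀ o, 0 ≤ p o) (h : 𝓞 → ℝ) :
    ∫ o, h o ∂dens μ p = ∫ o, h o * p o ∂μ := by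
  rw [integral_withDensity_eq_integral_toReal_smul (by fun_prop) (by simp)]
  refine integral_congr_ae (Eventually.of_forall fun o => ?_)
  simp [ENNReal.toReal_ofReal (hp0 o), mul_comm]

theorem integrable_dens (hp : Measurable p) (hp0 : ∀ o, 0 ≤ p o) {h : 𝓞 → ℝ} :
    Integrable h (dens μ p) ↔ Integrable (fun o => h o * p o) μ := by
  rw [integrable_withDensity_iff (by fun_prop) (by simp)]
  simp only [ENNReal.toReal_ofReal (hp0 _)]

theorem integral_sq_dens (hp : Measurable p) (hp0 : ∀ o, 0 ≤ p o) (h : 𝓞 → ℝ) :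
    ∫ o, h o ^ 2 ∂dens μ p = ∫ o, (h o * √(p o)) ^ 2 ∂μ := by
  rw [integral_dens hp hp0]
  simp only [mul_pow, Real.sq_sqrt (hp0 _)]

theorem memLp_dens (hp : Measurable p) (hp0 : ∀ o, 0 ≤ p o) {h : 𝓞 → ℝ} (hm : Measurable h)
    (hh : MemLp h 2 (dens μ p)) : MemLp (fun o => h o * √(p o)) 2 μ := by
  rw [memLp_two_iff_integrable_sq (by fun_prop)]
  have := hh.integrable_sq
  rw [integrable_dens hp hp0] at this
  simpa only [mul_pow, Real.sq_sqrt (hp0 _)] using this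

theorem memLp_sqrt (hp : Measurable p) (hp0 : ∀ o, 0 ≤ p o) [IsFiniteMeasure (dens μ p)] :
    MemLp (fun o => √(p o)) 2 μ := by
  simpa using memLp_dens (μ := μ) hp hp0 (h := fun _ => 1) measurable_const (memLp_const _)

theorem memLp_mul_add_sqrt (hp : Measurable p) (hp0 : ∀ o, 0 ≤ p o) (hq : Measurable q)
    (hq0 : ∀ o, 0 ≤ q o) {h : 𝓞 → ℝ} (hm : Measurable h)
    (hhp : MemLp h 2 (dens μ p)) (hhq : MemLp h 2 (dens μ q)) :
    MemLp (fun o => h o * (√(q o) + √(p o))) 2 μ := by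
  simp only [mul_add]
  exact (memLp_dens hq hq0 hm hhq).add (memLp_dens hp hp0 hm hhp)

theorem integral_sq_mul_add_sqrt_le (hp : Measurable p) (hp0 : ∀ o, 0 ≤ p o) (hq : Measurable q)
    (hq0 : ∀ o, 0 ≤ q o) {h : 𝓞 → ℝ} (hm : Measurable h)
    (hhp : MemLp h 2 (dens μ p)) (hhq : MemLp h 2 (dens μ q)) :
    ∫ o, (h o * (√(q o) + √(p o))) ^ 2 ∂μ ≤
      2 * ∫ o, h o ^ 2 ∂dens μ q + 2 * ∫ o, h o ^ 2 ∂dens μ p := by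
  rw [integral_sq_dens hp hp0, integral_sq_dens hq hq0, ← integral_const_mul, ← integral_const_mul,
    ← integral_add ((memLp_dens hq hq0 hm hhq).integrable_sq.const_mul 2)
      ((memLp_dens hp hp0 hm hhp).integrable_sq.const_mul 2)]
  refine integral_mono (memLp_mul_add_sqrt hp hp0 hq hq0 hm hhp hhq).integrable_sq
    (((memLp_dens hq hq0 hm hhq).integrable_sq.const_mul 2).add
      ((memLp_dens hp hp0 hm hhp).integrable_sq.const_mul 2)) fun o => ?_
  simp only
  nlinarith [sq_nonneg (h o * √(q o) - h o * √(p o))]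

/-- Factor `q - p = (√q + √p)(√q - √p)`. In the Cauchy–Schwarz inequality the first factor is
controlled by second moments under both laws, and the second is what quadratic mean
differentiability describes. -/
theorem integral_dens_sub [IsFiniteMeasure (dens μ p)] [IsFiniteMeasure (dens μ q)]
    (hp : Measurable p) (hp0 : ∀ o, 0 ≤ p o) (hq : Measurable q)
    (hq0 : ∀ o, 0 ≤ q o) {h : 𝓞 → ℝ} (hhp : MemLp h 2 (dens μ p)) (hhq : MemLp h 2 (dens μ q)) :
    ∫ o, h o ∂dens μ q - ∫ o, h o ∂dens μ p =
      ∫ o, (h o * (√(q o) + √(p o))) * (√(q o) - √(p o)) ∂μ := by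
  have h1 := hhp.integrable (by norm_num)
  have h2 := hhq.integrable (by norm_num)
  rw [integrable_dens hp hp0] at h1
  rw [integrable_dens hq hq0] at h2
  rw [integral_dens hp hp0, integral_dens hq hq0, ← integral_sub h2 h1]
  refine integral_congr_ae (Eventually.of_forall fun o => ?_)
  simp only
  have e1 := Real.sq_sqrt (hp0 o)
  have e2 := Real.sq_sqrt (hq0 o)
  linear_combination -(h o) * e2 + h o * e1

end RootDensity

/-! ### Differentiability in quadratic mean -/

/-- Differentiability in quadratic mean at `η₀`, with score `s`. -/
structure IsQMD {𝓞 : Type*} [MeasurableSpace 𝓞] (P : Measure 𝓞) {d : ℕ}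
    (Q : (Fin d → ℝ) → Measure 𝓞) (η₀ : Fin d → ℝ) (s : 𝓞 → Fin d → ℝ) (μ : Measure 𝓞)
    (f : (Fin d → ℝ) → 𝓞 → ℝ) : Prop where
  at_center : P = dens μ (f η₀)
  isProb : ∀ᶠ η in 𝓝 η₀, IsProbabilityMeasure (Q η)
  score_measurable : Measurable s
  score_memLp : ∀ j, MemLp (fun o => s o j) 2 P
  measurable : ∀ η, Measurable (f η)
  nonneg : ∀ η o, 0 ≤ f η o
  eq_dens : ∀ᶠ η in 𝓝 η₀, Q η = dens μ (f η)
  isLittleO : (fun η => ∫ o, (√(f η o) - √(f η₀ o) - 1 / 2 * ((η - η₀) ⬝ᵥ s o) * √(f η₀ o)) ^ 2 ∂μ)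
      =o[𝓝 η₀] fun η => ‖η - η₀‖ ^ 2

namespace IsQMD

variable {𝓞 : Type*} [MeasurableSpace 𝓞] {P : Measure 𝓞} [IsProbabilityMeasure P] {d : ℕ}
  {Q : (Fin d → ℝ) → Measure 𝓞} {η₀ : Fin d → ℝ} {s : 𝓞 → Fin d → ℝ} {μ : Measure 𝓞}
  {f : (Fin d → ℝ) → 𝓞 → ℝ}

theorem abs_dotProduct_le (h x : Fin d → ℝ) : |h ⬝ᵥ x| ≤ ‖h‖ * ∑ j, |x j| := by
  rw [Finset.mul_sum]
  refine (Finset.abs_sum_le_sum_abs _ _).trans (Finset.sum_le_sum fun j _ => ?_)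
  rw [abs_mul]
  gcongr
  exact norm_le_pi_norm h j

/-- Remainder of the expansion of the root density. -/
abbrev rem (s : 𝓞 → Fin d → ℝ) (f : (Fin d → ℝ) → 𝓞 → ℝ) (η₀ η : Fin d → ℝ) (o : 𝓞) : ℝ :=
  √(f η o) - √(f η₀ o) - 1 / 2 * ((η - η₀) ⬝ᵥ s o) * √(f η₀ o)

/-- The sum of the absolute values of the scores. -/
abbrev absScore (s : 𝓞 → Fin d → ℝ) (o : 𝓞) : ℝ := ∑ j, |s o j|

variable (H : IsQMD P Q η₀ s μ f)
include H

theorem memLp_absScore : MemLp (absScore s) 2 P :=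
  memLp_finsetSum _ fun j _ => (H.score_memLp j).abs

theorem measurable_absScore : Measurable (absScore s) := by
  have := H.score_measurable
  unfold absScore
  fun_prop

theorem measurable_lin (h : Fin d → ℝ) : Measurable fun o => h ⬝ᵥ s o := by
  have := H.score_measurable
  simp only [dotProduct]
  fun_prop

theorem memLp_lin (h : Fin d → ℝ) : MemLp (fun o => h ⬝ᵥ s o) 2 P :=
  memLp_finsetSum _ fun j _ => (H.score_memLp j).const_mul _

theorem memLp_sqrt_center : MemLp (fun o => √(f η₀ o)) 2 μ := by
  have : IsFiniteMeasure (dens μ (f η₀)) := by rw [← H.at_center]; infer_instance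
  exact memLp_sqrt (H.measurable _) (H.nonneg _)

theorem memLp_mul_center {h : 𝓞 → ℝ} (hm : Measurable h) (hh : MemLp h 2 P) :
    MemLp (fun o => h o * √(f η₀ o)) 2 μ :=
  memLp_dens (H.measurable _) (H.nonneg _) hm (H.at_center ▸ hh)

theorem integral_sq_center (h : 𝓞 → ℝ) : ∫ o, (h o * √(f η₀ o)) ^ 2 ∂μ = ∫ o, h o ^ 2 ∂P := by
  rw [← integral_sq_dens (H.measurable _) (H.nonneg _), H.at_center]

theorem eventually_memLp_sqrt : ∀ᶠ η in 𝓝 η₀, MemLp (fun o => √(f η o)) 2 μ := by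
  filter_upwards [H.isProb, H.eq_dens] with η h1 h2
  have : IsFiniteMeasure (dens μ (f η)) := by rw [← h2]; infer_instance
  exact memLp_sqrt (H.measurable _) (H.nonneg _)

theorem eventually_memLp_rem : ∀ᶠ η in 𝓝 η₀, MemLp (rem s f η₀ η) 2 μ := by
  filter_upwards [H.eventually_memLp_sqrt] with η h1
  refine (h1.sub H.memLp_sqrt_center).sub ?_
  exact H.memLp_mul_center ((H.measurable_lin _).const_mul _) ((H.memLp_lin _).const_mul _)

/-- If `t` is bounded then `∫ t² (√f_η - √f_η₀)²` is controlled by the remainder and the score. -/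
theorem eventually_integral_sq_mul_sub_le (B : ℝ) :
    ∀ᶠ η in 𝓝 η₀, ∀ t : 𝓞 → ℝ, Measurable t → (∀ o, |t o| ≤ B) →
      MemLp (fun o => t o * (√(f η o) - √(f η₀ o))) 2 μ ∧
      ∫ o, (t o * (√(f η o) - √(f η₀ o))) ^ 2 ∂μ ≤
        2 * B ^ 2 * ∫ o, rem s f η₀ η o ^ 2 ∂μ +
          1 / 2 * ‖η - η₀‖ ^ 2 * ∫ o, (t o * absScore s o) ^ 2 ∂P := by
  filter_upwards [H.eventually_memLp_sqrt, H.eventually_memLp_rem] with η h1 h2 t ht hB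
  have hd : MemLp (fun o => t o * (√(f η o) - √(f η₀ o))) 2 μ :=
    memLp_bdd_mul ht hB (h1.sub H.memLp_sqrt_center)
  have hS : MemLp (fun o => t o * absScore s o) 2 P :=
    memLp_bdd_mul ht hB H.memLp_absScore
  have hSm : Measurable fun o => t o * absScore s o := ht.mul H.measurable_absScore
  have hS' := (H.memLp_mul_center hSm hS).integrable_sq
  refine ⟨hd, ?_⟩
  rw [← H.integral_sq_center, ← integral_const_mul, ← integral_const_mul,
    ← integral_add (h2.integrable_sq.const_mul _) (hS'.const_mul _)]
  refine integral_mono hd.integrable_sq ((h2.integrable_sq.const_mul _).add (hS'.const_mul _))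
    fun o => ?_
  -- The weight is replaced by its bound only against the remainder, which is already of smaller
  -- order. It stays inside the score term, where its smallness is needed later.
  have e0 : (t o * (√(f η o) - √(f η₀ o))) ^ 2 ≤ 2 * (t o * rem s f η₀ η o) ^ 2 +
      2 * (t o * (1 / 2 * ((η - η₀) ⬝ᵥ s o) * √(f η₀ o))) ^ 2 := by
    have e : t o * (√(f η o) - √(f η₀ o)) =
        t o * rem s f η₀ η o + t o * (1 / 2 * ((η - η₀) ⬝ᵥ s o) * √(f η₀ o)) := by
      simp only [rem]
      ring
    rw [e]
    exact add_sq_le_two_mul _ _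
  have e1 : (t o * rem s f η₀ η o) ^ 2 ≤ B ^ 2 * rem s f η₀ η o ^ 2 := by
    rw [mul_pow]
    gcongr ?_ * _
    exact sq_le_sq' (abs_le.1 (hB o)).1 (abs_le.1 (hB o)).2
  have e2 : ((η - η₀) ⬝ᵥ s o) ^ 2 ≤ (‖η - η₀‖ * absScore s o) ^ 2 := by
    rw [← sq_abs]
    gcongr
    exact abs_dotProduct_le _ _
  have e3 : 2 * (t o * (1 / 2 * ((η - η₀) ⬝ᵥ s o) * √(f η₀ o))) ^ 2 ≤
      1 / 2 * ‖η - η₀‖ ^ 2 * (t o * absScore s o * √(f η₀ o)) ^ 2 := by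
    have : 0 ≤ (t o * √(f η₀ o)) ^ 2 := sq_nonneg _
    nlinarith [mul_le_mul_of_nonneg_left e2 this]
  simp only
  linarith

/-- Hellinger continuity of the submodel: the bound for weighted increments with constant weight
one, whose two terms both tend to zero. -/
theorem tendsto_integral_sq_sub :
    Tendsto (fun η => ∫ o, (√(f η o) - √(f η₀ o)) ^ 2 ∂μ) (𝓝 η₀) (𝓝 0) := by
  have h0 : Tendsto (fun η => ‖η - η₀‖ ^ 2) (𝓝 η₀) (𝓝 0) := by
    have : Continuous fun η : Fin d → ℝ => ‖η - η₀‖ ^ 2 := by fun_prop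
    simpa using this.tendsto η₀
  have h1 : Tendsto (fun η => ∫ o, rem s f η₀ η o ^ 2 ∂μ) (𝓝 η₀) (𝓝 0) :=
    H.isLittleO.trans_tendsto h0
  have h2 : Tendsto (fun η => 2 * (1 : ℝ) ^ 2 * ∫ o, rem s f η₀ η o ^ 2 ∂μ +
      1 / 2 * ‖η - η₀‖ ^ 2 * ∫ o, (1 * absScore s o) ^ 2 ∂P) (𝓝 η₀) (𝓝 0) := by
    simpa only [mul_zero, zero_mul, add_zero] using (h1.const_mul (2 * (1 : ℝ) ^ 2)).add
      ((h0.const_mul (1 / 2)).mul_const (∫ o, (1 * absScore s o) ^ 2 ∂P))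
  refine tendsto_of_tendsto_of_tendsto_of_le_of_le' tendsto_const_nhds h2
    (Eventually.of_forall fun η => integral_nonneg fun o => sq_nonneg _) ?_
  filter_upwards [H.eventually_integral_sq_mul_sub_le 1] with η h
  simpa using (h (fun _ => 1) measurable_const (by simp)).2

-- Dominated convergence with majorant `S²`: since `F` is finite at each point, the indicator of
-- `|F| > T` is eventually zero there. Taking `S = |F|` gives the tail of the score, while a
-- separate `S` is needed when `F` is the function being averaged.
omit H in
theorem exists_integral_truncated_lt {F S : 𝓞 → ℝ} (hF : Measurable F) (hS : MemLp S 2 P)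
    {ε : ℝ} (hε : 0 < ε) :
    ∃ T : ℝ, 0 < T ∧ ∫ o, ({o | T < |F o|}.indicator 1 o * S o) ^ 2 ∂P < ε := by
  have h : Tendsto (fun n : ℕ => ∫ o, ({o | (n : ℝ) < |F o|}.indicator 1 o * S o) ^ 2 ∂P) atTop
      (𝓝 (∫ _, (0 : ℝ) ∂P)) := by
    refine tendsto_integral_of_dominated_convergence (fun o => S o ^ 2) (fun n => ?_)
      hS.integrable_sq (fun n => Eventually.of_forall fun o => ?_)
      (Eventually.of_forall fun o => ?_)
    · refine AEStronglyMeasurable.pow (AEStronglyMeasurable.mul ?_ hS.1) 2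
      exact (measurable_const.indicator (measurableSet_lt measurable_const
        (by fun_prop))).aestronglyMeasurable
    · by_cases ho : o ∈ {o | (n : ℝ) < |F o|} <;> simp [ho, sq_nonneg]
    · obtain ⟨N, hN⟩ := exists_nat_gt |F o|
      refine tendsto_const_nhds.congr' ?_
      filter_upwards [eventually_ge_atTop N] with n hn
      have : ¬ (n : ℝ) < |F o| := not_lt.2 (hN.le.trans (by exact_mod_cast hn))
      simp [this]
  simp only [integral_zero] at h
  obtain ⟨n, h1, h2⟩ := ((h.eventually_lt_const hε).and (eventually_gt_atTop 0)).exists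
  exact ⟨n, by exact_mod_cast h2, h1⟩

/-- The remainder caused by a bounded weight `t_η` that vanishes in `L¹` is of second order. -/
theorem isLittleO_integral_mul {r : 𝓞 → ℝ} {t : (Fin d → ℝ) → 𝓞 → ℝ} {B C : ℝ}
    (hrm : Measurable r) (hrL : ∀ᶠ η in 𝓝 η₀, MemLp r 2 (Q η) ∧ ∫ o, r o ^ 2 ∂Q η ≤ C)
    (hrP : MemLp r 2 P) (hrC : ∫ o, r o ^ 2 ∂P ≤ C)
    (htm : ∀ η, Measurable (t η)) (htB : ∀ η o, |t η o| ≤ B)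
    (ht : Tendsto (fun η => ∫ o, |t η o| ∂P) (𝓝 η₀) (𝓝 0))
    (h0 : ∀ η, ∫ o, r o * t η o ∂P = 0) :
    (fun η => ∫ o, r o * t η o ∂Q η) =o[𝓝 η₀] fun η => η - η₀ := by
  have hB : 0 ≤ B := by
    have : Nonempty 𝓞 := nonempty_of_isProbabilityMeasure P
    exact (abs_nonneg _).trans (htB η₀ (Classical.arbitrary 𝓞))
  have hC : 0 ≤ C := (integral_nonneg fun o => sq_nonneg _).trans hrC
  -- weights kill the score
  have h1 : Tendsto (fun η => ∫ o, (t η o * absScore s o) ^ 2 ∂P) (𝓝 η₀) (𝓝 0) := by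
    rw [Metric.tendsto_nhds]
    intro ε hε
    obtain ⟨T, hT, hT2⟩ := exists_integral_truncated_lt H.measurable_absScore H.memLp_absScore
      (ε := ε / (2 * (B ^ 2 + 1))) (by positivity)
    have h2 : ∀ᶠ η in 𝓝 η₀, ∫ o, |t η o| ∂P < ε / (2 * (T ^ 2 * B + 1)) :=
      ht.eventually_lt_const (by positivity)
    filter_upwards [h2] with η h3
    set I : 𝓞 → ℝ := {o | T < |absScore s o|}.indicator 1 with hI
    have hIm : Measurable I := measurable_const.indicator (measurableSet_lt measurable_const
        H.measurable_absScore.abs)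
    have hI1 : ∀ o, |I o| ≤ 1 := fun o => by
      by_cases ho : o ∈ {o | T < |absScore s o|} <;> simp [I, ho]
    have i1 : Integrable (fun o => (I o * absScore s o) ^ 2) P :=
      (memLp_bdd_mul hIm hI1 H.memLp_absScore).integrable_sq
    have i2 : Integrable (fun o => |t η o|) P :=
      (Integrable.of_bound (htm η).aestronglyMeasurable B
        (Eventually.of_forall fun o => htB η o)).abs
    -- Truncate the score at level `T`. Below it `t² S² ≤ T² B |t|`, which is small in `L¹`; above
    -- it `t² ≤ B²` and the tail of the squared score is small.
    have h4 : ∫ o, (t η o * absScore s o) ^ 2 ∂P ≤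
        T ^ 2 * B * ∫ o, |t η o| ∂P + B ^ 2 * ∫ o, (I o * absScore s o) ^ 2 ∂P := by
      rw [← integral_const_mul, ← integral_const_mul,
        ← integral_add (i2.const_mul _) (i1.const_mul _)]
      refine integral_mono (memLp_bdd_mul (htm η) (htB η) H.memLp_absScore).integrable_sq
        ((i2.const_mul _).add (i1.const_mul _)) fun o => ?_
      have e1 : t η o ^ 2 ≤ B * |t η o| := by
        rw [← sq_abs, sq]
        exact mul_le_mul_of_nonneg_right (htB η o) (abs_nonneg _)
      have e2 : t η o ^ 2 ≤ B ^ 2 := sq_le_sq' (abs_le.1 (htB η o)).1 (abs_le.1 (htB η o)).2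
      simp only [mul_pow]
      by_cases ho : T < |absScore s o|
      · have : I o = 1 := by simp [I, ho]
        rw [this]
        have : 0 ≤ T ^ 2 * B * |t η o| := by positivity
        nlinarith [mul_le_mul_of_nonneg_right e2 (sq_nonneg (absScore s o))]
      · have : I o = 0 := by simp [I, ho]
        rw [this]
        have e3 : absScore s o ^ 2 ≤ T ^ 2 := by
          rw [← sq_abs]
          exact pow_le_pow_left₀ (abs_nonneg _) (not_lt.1 ho) 2
        have := mul_le_mul e1 e3 (sq_nonneg _) (by positivity)
        linarith
    rw [Real.dist_eq, sub_zero, abs_of_nonneg (integral_nonneg fun o => sq_nonneg _)]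
    refine h4.trans_lt ?_
    have e1 : T ^ 2 * B * ∫ o, |t η o| ∂P ≤ ε / 2 := by
      have : T ^ 2 * B * ∫ o, |t η o| ∂P ≤ (T ^ 2 * B + 1) * (ε / (2 * (T ^ 2 * B + 1))) := by
        gcongr
        linarith
      refine this.trans (le_of_eq ?_)
      field_simp
    have e2 : B ^ 2 * ∫ o, (I o * absScore s o) ^ 2 ∂P < ε / 2 := by
      have : B ^ 2 * ∫ o, (I o * absScore s o) ^ 2 ∂P ≤
          B ^ 2 * (ε / (2 * (B ^ 2 + 1))) := by gcongr
      refine this.trans_lt ?_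
      rw [mul_div_assoc', div_lt_div_iff₀ (by positivity) (by positivity)]
      nlinarith
    linarith
  rw [Asymptotics.isLittleO_iff]
  intro ε hε
  -- The constant is such that `4 C δ ≤ ε²`. Here `4 C` will bound the squared norm of `r (√f_η +
  -- √f_η₀)`, and `δ ‖η - η₀‖²` that of the weighted increment.
  set δ : ℝ := ε ^ 2 / (4 * C + 1) with hδ
  have hδ0 : 0 < δ := by positivity
  have h2 := H.isLittleO.def (c := δ / (4 * (B ^ 2 + 1))) (by positivity)
  have h3 : ∀ᶠ η in 𝓝 η₀, ∫ o, (t η o * absScore s o) ^ 2 ∂P < δ :=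
    h1.eventually_lt_const hδ0
  filter_upwards [h2, h3, hrL, H.isProb, H.eq_dens, H.eventually_integral_sq_mul_sub_le B]
    with η e1 e2 e3 e4 e5 e6
  obtain ⟨e7, e8⟩ := e6 (t η) (htm η) (htB η)
  rw [e5] at e3 e4
  have hfin : IsFiniteMeasure (dens μ (f η₀)) := by rw [← H.at_center]; infer_instance
  rw [H.at_center] at hrP hrC
  have e9 : ∫ o, (t η o * (√(f η o) - √(f η₀ o))) ^ 2 ∂μ ≤ δ * ‖η - η₀‖ ^ 2 := by
    have i1 : ∫ o, rem s f η₀ η o ^ 2 ∂μ ≤ δ / (4 * (B ^ 2 + 1)) * ‖η - η₀‖ ^ 2 := by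
      have := (le_abs_self _).trans e1
      rwa [Real.norm_of_nonneg (sq_nonneg _)] at this
    have i2 : 2 * B ^ 2 * ∫ o, rem s f η₀ η o ^ 2 ∂μ ≤
        2 * B ^ 2 * (δ / (4 * (B ^ 2 + 1)) * ‖η - η₀‖ ^ 2) := by gcongr
    have i3 : 2 * B ^ 2 * (δ / (4 * (B ^ 2 + 1)) * ‖η - η₀‖ ^ 2) ≤ δ / 2 * ‖η - η₀‖ ^ 2 := by
      rw [← mul_assoc]
      gcongr ?_ * _
      rw [mul_div_assoc', div_le_div_iff₀ (by positivity) (by positivity)]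
      nlinarith
    have i4 : 1 / 2 * ‖η - η₀‖ ^ 2 * ∫ o, (t η o * absScore s o) ^ 2 ∂P ≤
        1 / 2 * ‖η - η₀‖ ^ 2 * δ := by gcongr
    linarith
  have hsub := integral_dens_sub (μ := μ) (H.measurable η₀) (H.nonneg η₀) (H.measurable η)
    (H.nonneg η) (h := fun o => r o * t η o)
    (by simpa only [mul_comm] using memLp_bdd_mul (htm η) (htB η) hrP)
    (by simpa only [mul_comm] using memLp_bdd_mul (htm η) (htB η) e3.1)
  rw [← H.at_center, h0 η, sub_zero] at hsub
  rw [e5, hsub, Real.norm_eq_abs]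
  have hcs := abs_integral_mul_le (memLp_mul_add_sqrt (H.measurable η₀) (H.nonneg η₀)
    (H.measurable η) (H.nonneg η) hrm hrP e3.1) e7
  have hle := integral_sq_mul_add_sqrt_le (H.measurable η₀) (H.nonneg η₀)
    (H.measurable η) (H.nonneg η) hrm hrP e3.1
  -- The weight is attached to the increment and not to the sum, so that Cauchy–Schwarz gains the
  -- extra `o(1)`.
  have hrw : ∫ o, r o * t η o * (√(f η o) + √(f η₀ o)) * (√(f η o) - √(f η₀ o)) ∂μ =
      ∫ o, r o * (√(f η o) + √(f η₀ o)) * (t η o * (√(f η o) - √(f η₀ o))) ∂μ :=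
    integral_congr_ae (Eventually.of_forall fun o => by simp only; ring)
  rw [hrw]
  refine hcs.trans ?_
  rw [← Real.sqrt_mul (integral_nonneg fun o => sq_nonneg _)]
  refine Real.sqrt_le_iff.2 ⟨by positivity, ?_⟩
  calc _ ≤ (4 * C) * (δ * ‖η - η₀‖ ^ 2) := by
        exact mul_le_mul (hle.trans (by linarith [e3.2])) e9 (integral_nonneg fun o => sq_nonneg _)
          (by positivity)
    _ ≤ (ε * ‖η - η₀‖) ^ 2 := by
        rw [mul_pow, ← mul_assoc]
        gcongr ?_ * _
        rw [hδ, mul_div_assoc', div_le_iff₀ (by positivity)]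
        nlinarith [sq_nonneg ε]

theorem apply_center : Q η₀ = P := by
  rw [H.eq_dens.self_of_nhds, H.at_center]

/-- Total variation is controlled by Hellinger distance: `b (√f_η + √f_η₀)` has `L²` norm at most
two. The quantifier over `b` comes after the one over `η`, so that test functions depending on `η`
are allowed. -/
theorem eventually_abs_integral_sub_le :
    ∀ᶠ η in 𝓝 η₀, ∀ b : 𝓞 → ℝ, Measurable b → (∀ o, |b o| ≤ 1) →
      |∫ o, b o ∂Q η - ∫ o, b o ∂P| ≤ 2 * √(∫ o, (√(f η o) - √(f η₀ o)) ^ 2 ∂μ) := by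
  filter_upwards [H.isProb, H.eq_dens, H.eventually_memLp_sqrt] with η h1 h2 h3 b hb hb1
  rw [h2] at h1
  have hfin : IsProbabilityMeasure (dens μ (f η₀)) := by rw [← H.at_center]; infer_instance
  have m1 : MemLp b 2 (dens μ (f η)) :=
    MemLp.of_bound hb.aestronglyMeasurable 1 (Eventually.of_forall hb1)
  have m2 : MemLp b 2 (dens μ (f η₀)) :=
    MemLp.of_bound hb.aestronglyMeasurable 1 (Eventually.of_forall hb1)
  have hb2 : ∀ (ν : Measure 𝓞) [IsProbabilityMeasure ν], MemLp b 2 ν → ∫ o, b o ^ 2 ∂ν ≤ 1 := by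
    intro ν _ hν
    calc ∫ o, b o ^ 2 ∂ν ≤ ∫ _, (1 : ℝ) ∂ν :=
          integral_mono hν.integrable_sq (integrable_const _) fun o => by
            simpa using (sq_le_one_iff_abs_le_one (b o)).2 (hb1 o)
      _ = 1 := by simp
  have hle := integral_sq_mul_add_sqrt_le (H.measurable η₀) (H.nonneg η₀)
    (H.measurable η) (H.nonneg η) hb m2 m1
  rw [h2, H.at_center, integral_dens_sub (H.measurable η₀) (H.nonneg η₀) (H.measurable η)
    (H.nonneg η) m2 m1]
  refine (abs_integral_mul_le (memLp_mul_add_sqrt (H.measurable η₀) (H.nonneg η₀)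
    (H.measurable η) (H.nonneg η) hb m2 m1) (h3.sub H.memLp_sqrt_center)).trans ?_
  refine mul_le_mul_of_nonneg_right (Real.sqrt_le_iff.2 ⟨by norm_num, ?_⟩) (Real.sqrt_nonneg _)
  linarith [hb2 _ m1, hb2 _ m2]

/-- A function whose second moment stays bounded is asymptotically uncorrelated with the increment
of the root density. -/
theorem tendsto_integral_mul_sub {F S : 𝓞 → ℝ} {C : ℝ} (hF : Measurable F)
    (hFL : ∀ᶠ η in 𝓝 η₀, MemLp F 2 (Q η) ∧ ∫ o, F o ^ 2 ∂Q η ≤ C) (hSm : Measurable S)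
    (hS : MemLp S 2 P) :
    Tendsto (fun η => ∫ o, F o * (√(f η o) - √(f η₀ o)) * (S o * √(f η₀ o)) ∂μ)
      (𝓝 η₀) (𝓝 0) := by
  have hc := hFL.self_of_nhds
  rw [H.apply_center] at hc
  have hC : 0 ≤ C := (integral_nonneg fun o => sq_nonneg _).trans hc.2
  rw [Metric.tendsto_nhds]
  intro ε hε
  -- Bounded second moments do not make `F (√f_η - √f_η₀)` small in `L²`; its squared norm is only
  -- at most `4 C`. On `|F| > T` the smallness must come from `S`, and `T` is chosen for that; on
  -- `|F| ≤ T` it comes from the increment.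
  obtain ⟨T, hT, hT2⟩ := exists_integral_truncated_lt (P := P) hF hS
    (ε := (ε / 2) ^ 2 / (4 * C + 1)) (by positivity)
  have hD : ∀ᶠ η in 𝓝 η₀, T * √(∫ o, (√(f η o) - √(f η₀ o)) ^ 2 ∂μ) * √(∫ o, S o ^ 2 ∂P) < ε / 2 := by
    have h1 := ((H.tendsto_integral_sq_sub.sqrt).const_mul T).mul_const √(∫ o, S o ^ 2 ∂P)
    simp only [Real.sqrt_zero, mul_zero, zero_mul] at h1
    exact h1.eventually_lt_const (by positivity)
  filter_upwards [hFL, H.isProb, H.eq_dens, H.eventually_memLp_sqrt, hD] with η e1 e2 e3 e4 e5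
  rw [e3] at e1 e2
  have hfin : IsProbabilityMeasure (dens μ (f η₀)) := by rw [← H.at_center]; infer_instance
  have hc' := hc
  rw [H.at_center] at hc'
  set I : 𝓞 → ℝ := {o | T < |F o|}.indicator 1 with hI
  have hIm : Measurable I := measurable_const.indicator (measurableSet_lt measurable_const hF.abs)
  have hI1 : ∀ o, |I o| ≤ 1 := fun o => by
    by_cases ho : o ∈ {o | T < |F o|} <;> simp [I, ho]
  have hFI : ∀ o, |F o * (1 - I o)| ≤ T := fun o => by
    by_cases ho : T < |F o|
    · have : I o = 1 := by simp [I, ho]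
      simp [this, hT.le]
    · have : I o = 0 := by simp [I, ho]
      simpa [this] using ho
  have m0 := e4.sub H.memLp_sqrt_center
  have m1 : MemLp (fun o => F o * (√(f η o) - √(f η₀ o))) 2 μ := by
    simp only [mul_sub]
    exact (memLp_dens (H.measurable η) (H.nonneg η) hF e1.1).sub
      (memLp_dens (H.measurable η₀) (H.nonneg η₀) hF hc'.1)
  have m2 : MemLp (fun o => I o * S o * √(f η₀ o)) 2 μ :=
    H.memLp_mul_center (hIm.mul hSm) (memLp_bdd_mul hIm hI1 hS)
  have m3 : MemLp (fun o => F o * (1 - I o) * (√(f η o) - √(f η₀ o))) 2 μ :=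
    memLp_bdd_mul (hF.mul (measurable_const.sub hIm)) hFI m0
  have m4 : MemLp (fun o => S o * √(f η₀ o)) 2 μ := H.memLp_mul_center hSm hS
  have hrw : ∫ o, F o * (√(f η o) - √(f η₀ o)) * (S o * √(f η₀ o)) ∂μ =
      ∫ o, F o * (√(f η o) - √(f η₀ o)) * (I o * S o * √(f η₀ o)) ∂μ +
        ∫ o, F o * (1 - I o) * (√(f η o) - √(f η₀ o)) * (S o * √(f η₀ o)) ∂μ := by
    rw [← integral_add (integrable_mul_of_memLp m1 m2) (integrable_mul_of_memLp m3 m4)]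
    refine integral_congr_ae (Eventually.of_forall fun o => ?_)
    simp only
    ring
  rw [Real.dist_eq, sub_zero, hrw]
  refine (abs_add_le _ _).trans_lt ?_
  have b1 : ∫ o, (F o * (√(f η o) - √(f η₀ o))) ^ 2 ∂μ ≤ 4 * C := by
    have hle := integral_sq_mul_add_sqrt_le (H.measurable η₀) (H.nonneg η₀)
      (H.measurable η) (H.nonneg η) hF hc'.1 e1.1
    have hmono : ∫ o, (F o * (√(f η o) - √(f η₀ o))) ^ 2 ∂μ ≤
        ∫ o, (F o * (√(f η o) + √(f η₀ o))) ^ 2 ∂μ := by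
      refine integral_mono m1.integrable_sq (memLp_mul_add_sqrt (H.measurable η₀) (H.nonneg η₀)
        (H.measurable η) (H.nonneg η) hF hc'.1 e1.1).integrable_sq fun o => ?_
      simp only [mul_pow]
      gcongr ?_ * ?_
      nlinarith [mul_nonneg (Real.sqrt_nonneg (f η o)) (Real.sqrt_nonneg (f η₀ o))]
    linarith [e1.2, hc'.2]
  have b2 : |∫ o, F o * (√(f η o) - √(f η₀ o)) * (I o * S o * √(f η₀ o)) ∂μ| ≤ ε / 2 := by
    refine (abs_integral_mul_le m1 m2).trans ?_
    rw [H.integral_sq_center (fun o => I o * S o), ← Real.sqrt_mul (integral_nonneg fun o => sq_nonneg _)]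
    refine Real.sqrt_le_iff.2 ⟨by positivity, ?_⟩
    refine (mul_le_mul b1 hT2.le (integral_nonneg fun o => sq_nonneg _) (by positivity)).trans ?_
    rw [mul_div_assoc', div_le_iff₀ (by positivity)]
    nlinarith [sq_nonneg (ε / 2)]
  have b3 : |∫ o, F o * (1 - I o) * (√(f η o) - √(f η₀ o)) * (S o * √(f η₀ o)) ∂μ| < ε / 2 := by
    refine lt_of_le_of_lt ?_ e5
    refine (abs_integral_mul_le m3 m4).trans ?_
    rw [H.integral_sq_center S]
    refine mul_le_mul_of_nonneg_right ?_ (Real.sqrt_nonneg _)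
    rw [← Real.sqrt_sq hT.le, ← Real.sqrt_mul (sq_nonneg T), ← integral_const_mul]
    refine Real.sqrt_le_sqrt (integral_mono m3.integrable_sq (m0.integrable_sq.const_mul _)
      fun o => ?_)
    simp only
    rw [mul_pow]
    gcongr ?_ * _
    exact sq_le_sq' (abs_le.1 (hFI o)).1 (abs_le.1 (hFI o)).2
  linarith

/-- The mean of a function whose second moment stays bounded is differentiable; its gradient is
the covariance with the score. -/
theorem hasFDerivAt_integral {F : 𝓞 → ℝ} {C : ℝ} (hF : Measurable F)
    (hFL : ∀ᶠ η in 𝓝 η₀, MemLp F 2 (Q η) ∧ ∫ o, F o ^ 2 ∂Q η ≤ C) :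
    HasFDerivAt (fun η => ∫ o, F o ∂Q η)
      (∑ j, (∫ o, F o * s o j ∂P) • ContinuousLinearMap.proj (R := ℝ) (φ := fun _ : Fin d => ℝ) j)
      η₀ := by
  have hc := hFL.self_of_nhds
  rw [H.apply_center] at hc
  have hC : 0 ≤ C := (integral_nonneg fun o => sq_nonneg _).trans hc.2
  have hs : ∀ j, Measurable fun o => s o j := fun j => (measurable_pi_apply j).comp H.score_measurable
  rw [hasFDerivAt_iff_isLittleO]
  -- Insert the expansion of the root density into `(√f_η + √f_η₀)(√f_η - √f_η₀)`. Writing `√f_η +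
  -- √f_η₀ = 2 √f_η₀ + (√f_η - √f_η₀)` in the linear term isolates the covariance with the score;
  -- what is left is a remainder term and an increment multiplied by the score.
  have key : ∀ᶠ η in 𝓝 η₀,
      (∫ o, F o * (√(f η o) + √(f η₀ o)) * rem s f η₀ η o ∂μ) +
        ∑ j, (η - η₀) j *
          (1 / 2 * ∫ o, F o * (√(f η o) - √(f η₀ o)) * (s o j * √(f η₀ o)) ∂μ) =
      (∫ o, F o ∂Q η) - (∫ o, F o ∂Q η₀) - (∑ j, (∫ o, F o * s o j ∂P) •
        ContinuousLinearMap.proj (R := ℝ) (φ := fun _ : Fin d => ℝ) j) (η - η₀) := by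
    filter_upwards [hFL, H.isProb, H.eq_dens, H.eventually_memLp_sqrt, H.eventually_memLp_rem]
      with η e1 e2 e3 e4 e5
    rw [e3] at e1 e2
    have hfin : IsProbabilityMeasure (dens μ (f η₀)) := by rw [← H.at_center]; infer_instance
    have hc' := hc
    rw [H.at_center] at hc'
    have m1 : MemLp (fun o => F o * (√(f η o) - √(f η₀ o))) 2 μ := by
      simp only [mul_sub]
      exact (memLp_dens (H.measurable η) (H.nonneg η) hF e1.1).sub
        (memLp_dens (H.measurable η₀) (H.nonneg η₀) hF hc'.1)
    have m2 := memLp_mul_add_sqrt (H.measurable η₀) (H.nonneg η₀) (H.measurable η)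
      (H.nonneg η) hF hc'.1 e1.1
    have m3 : ∀ j, MemLp (fun o => s o j * √(f η₀ o)) 2 μ := fun j =>
      H.memLp_mul_center (hs j) (H.score_memLp j)
    have m4 : MemLp (fun o => F o * √(f η₀ o)) 2 μ := H.memLp_mul_center hF hc.1
    have hP : ∀ j, ∫ o, F o * s o j ∂P = ∫ o, F o * √(f η₀ o) * (s o j * √(f η₀ o)) ∂μ := by
      intro j
      rw [H.at_center, integral_dens (H.measurable η₀) (H.nonneg η₀)]
      refine integral_congr_ae (Eventually.of_forall fun o => ?_)
      simp only
      linear_combination -(F o * s o j) * Real.sq_sqrt (H.nonneg η₀ o)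
    rw [e3, H.apply_center]
    simp only [_root_.sum_apply, _root_.smul_apply,
      ContinuousLinearMap.proj_apply, smul_eq_mul]
    conv_rhs => rw [H.at_center, integral_dens_sub (H.measurable η₀) (H.nonneg η₀) (H.measurable η)
      (H.nonneg η) hc'.1 e1.1, ← H.at_center]
    rw [eq_sub_iff_add_eq, add_assoc, ← Finset.sum_add_distrib]
    simp_rw [hP, ← integral_const_mul]
    have i1 : ∀ j, Integrable (fun o => (η - η₀) j * (1 / 2 * (F o * (√(f η o) - √(f η₀ o)) *
        (s o j * √(f η₀ o))))) μ := fun j => ((m1.integrable_mul (m3 j)).const_mul _).const_mul _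
    have i2 : ∀ j, Integrable (fun o => F o * √(f η₀ o) * (s o j * √(f η₀ o)) * (η - η₀) j) μ :=
      fun j => (m4.integrable_mul (m3 j)).mul_const _
    simp_rw [← integral_mul_const]
    have i3 : ∀ j, (∫ o, (η - η₀) j * (1 / 2 * (F o * (√(f η o) - √(f η₀ o)) *
        (s o j * √(f η₀ o)))) ∂μ) + ∫ o, F o * √(f η₀ o) * (s o j * √(f η₀ o)) * (η - η₀) j ∂μ =
        ∫ o, ((η - η₀) j * (1 / 2 * (F o * (√(f η o) - √(f η₀ o)) * (s o j * √(f η₀ o)))) +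
          F o * √(f η₀ o) * (s o j * √(f η₀ o)) * (η - η₀) j) ∂μ :=
      fun j => (integral_add (i1 j) (i2 j)).symm
    simp_rw [i3]
    have i4 : ∀ j, Integrable (fun o =>
        (η - η₀) j * (1 / 2 * (F o * (√(f η o) - √(f η₀ o)) * (s o j * √(f η₀ o)))) +
          F o * √(f η₀ o) * (s o j * √(f η₀ o)) * (η - η₀) j) μ := fun j => (i1 j).add (i2 j)
    rw [← integral_finsetSum _ fun j _ => i4 j,
      ← integral_add (integrable_mul_of_memLp m2 e5) (integrable_finsetSum _ fun j _ => i4 j)]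
    refine integral_congr_ae (Eventually.of_forall fun o => ?_)
    simp only [rem, dotProduct]
    have : ∀ j, (η - η₀) j * (1 / 2 * (F o * (√(f η o) - √(f η₀ o)) * (s o j * √(f η₀ o)))) +
          F o * √(f η₀ o) * (s o j * √(f η₀ o)) * (η - η₀) j =
        (1 / 2 * F o * (√(f η o) + √(f η₀ o)) * √(f η₀ o)) * ((η - η₀) j * s o j) := fun j => by ring
    simp_rw [this]
    rw [← Finset.mul_sum]
    ring
  refine Asymptotics.IsLittleO.congr' ?_ key (EventuallyEq.refl _ _)
  refine Asymptotics.IsLittleO.add ?_ ?_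
  · rw [Asymptotics.isLittleO_iff]
    intro ε hε
    have h2 := H.isLittleO.def (c := ε ^ 2 / (4 * C + 1)) (by positivity)
    filter_upwards [h2, hFL, H.eq_dens, H.isProb, H.eventually_memLp_rem] with η e1 e2 e3 e4 e5
    rw [e3] at e2 e4
    have hc' := hc
    rw [H.at_center] at hc'
    have hle := integral_sq_mul_add_sqrt_le (H.measurable η₀) (H.nonneg η₀)
      (H.measurable η) (H.nonneg η) hF hc'.1 e2.1
    refine (abs_integral_mul_le (memLp_mul_add_sqrt (H.measurable η₀) (H.nonneg η₀)
      (H.measurable η) (H.nonneg η) hF hc'.1 e2.1) e5).trans ?_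
    rw [← Real.sqrt_mul (integral_nonneg fun o => sq_nonneg _)]
    refine Real.sqrt_le_iff.2 ⟨by positivity, ?_⟩
    have i1 : ∫ o, rem s f η₀ η o ^ 2 ∂μ ≤ ε ^ 2 / (4 * C + 1) * ‖η - η₀‖ ^ 2 := by
      have := (le_abs_self _).trans e1
      rwa [Real.norm_of_nonneg (sq_nonneg _)] at this
    refine (mul_le_mul (hle.trans (b := _) (c := 4 * C) (by linarith [e2.2, hc'.2])) i1
      (integral_nonneg fun o => sq_nonneg _) (by positivity)).trans ?_
    rw [mul_pow, ← mul_assoc]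
    gcongr ?_ * _
    rw [mul_div_assoc', div_le_iff₀ (by positivity)]
    nlinarith [sq_nonneg ε]
  · refine Asymptotics.IsLittleO.fun_sum fun j _ => ?_
    have h1 : (fun η : Fin d → ℝ => (η - η₀) j) =O[𝓝 η₀] fun η => η - η₀ :=
      Asymptotics.IsBigO.of_bound 1 (Eventually.of_forall fun η => by
        simpa using norm_le_pi_norm (η - η₀) j)
    have h2 := (H.tendsto_integral_mul_sub hF hFL (hs j) (H.score_memLp j)).const_mul (1 / 2)
    rw [mul_zero] at h2
    have h3 := h1.norm_right.mul_isLittleO ((Asymptotics.isLittleO_one_iff ℝ).2 h2)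
    simp only [mul_one] at h3
    exact h3.of_norm_right

end IsQMD

/-! ### Laws on a disjoint union -/

section SigmaLaw

variable {K : ℕ} {α : Fin K → Type*} [∀ k, MeasurableSpace (α k)]

theorem measurable_of_sigmaMk {β : Type*} [MeasurableSpace β] {f : (Σ k, α k) → β}
    (hf : ∀ k, Measurable fun z => f ⟨k, z⟩) : Measurable f := fun _ hs =>
  MeasurableSpace.measurableSet_iInf.2 fun k => hf k hs

theorem measurableEmbedding_sigmaMk (k : Fin K) :
    MeasurableEmbedding (Sigma.mk k : α k → Σ k, α k) where
  injective := sigma_mk_injective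
  measurable := fun _ hs => MeasurableSpace.measurableSet_iInf.1 hs k
  measurableSet_image' := fun _ hs => measurableSet_image_sigmaMk k hs

theorem measurable_sigma_fst : Measurable (Sigma.fst : (Σ k, α k) → Fin K) :=
  measurable_of_sigmaMk fun _ => measurable_const

variable (Q : Measure (Σ k, α k)) [IsFiniteMeasure Q]

/-- Multiplying back undoes the normalisation, also for a type of probability zero: the restriction
to that type is then the zero measure. Hence no positivity is needed in the decomposition over
types. -/
theorem smul_typeLaw (k : Fin K) :
    Q (Sigma.fst ⁻¹' {k}) • typeLaw Q k = Q.comap (Sigma.mk k) := by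
  rw [typeLaw, smul_smul]
  by_cases h : Q (Sigma.fst ⁻¹' {k}) = 0
  · have h0 : Q.comap (Sigma.mk k) = 0 := by
      rw [← Measure.measure_univ_eq_zero, (measurableEmbedding_sigmaMk k).comap_apply,
        Set.image_univ, Set.range_sigmaMk, h]
    simp [h0]
  · rw [ENNReal.mul_inv_cancel h (measure_ne_top _ _), one_smul]

theorem map_typeLaw (k : Fin K) :
    Q (Sigma.fst ⁻¹' {k}) • (typeLaw Q k).map (Sigma.mk k) = Q.restrict (Sigma.fst ⁻¹' {k}) := by
  rw [← Measure.map_smul, smul_typeLaw, (measurableEmbedding_sigmaMk k).map_comap,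
    Set.range_sigmaMk]

theorem eq_sum_typeLaw : Q = ∑ k, Q (Sigma.fst ⁻¹' {k}) • (typeLaw Q k).map (Sigma.mk k) := by
  ext s hs
  simp_rw [map_typeLaw]
  rw [Measure.finsetSum_apply]
  simp_rw [Measure.restrict_apply hs]
  rw [← measure_biUnion_finset]
  · congr 1
    ext o
    simp
  · intro i _ j _ hij
    refine Set.disjoint_left.2 fun o ho ho' => hij ?_
    exact ho.2.symm.trans ho'.2
  · exact fun k _ => hs.inter (measurable_sigma_fst (measurableSet_singleton k))

theorem typeProb_mul_integral (k : Fin K) (f : (Σ k, α k) → ℝ) :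
    typeProb Q k * ∫ z, f ⟨k, z⟩ ∂typeLaw Q k = ∫ o in Sigma.fst ⁻¹' {k}, f o ∂Q := by
  rw [← map_typeLaw, integral_smul_measure, (measurableEmbedding_sigmaMk k).integral_map]
  rfl

theorem integral_sigma {f : (Σ k, α k) → ℝ} (hf : Integrable f Q) :
    ∫ o, f o ∂Q = ∑ k, typeProb Q k * ∫ z, f ⟨k, z⟩ ∂typeLaw Q k := by
  simp_rw [typeProb_mul_integral]
  conv_lhs => rw [eq_sum_typeLaw Q]
  simp_rw [map_typeLaw]
  rw [integral_finsetSum_measure fun k _ => hf.integrableOn]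

theorem MemLp.typeLaw {f : (Σ k, α k) → ℝ} {p : ℝ≥0∞} (h : MemLp f p Q) (k : Fin K) :
    MemLp (fun z => f ⟨k, z⟩) p (typeLaw Q k) := by
  have h2 : MemLp f p (Q.restrict (Sigma.fst ⁻¹' {k})) := h.restrict _
  by_cases h1 : Q (Sigma.fst ⁻¹' {k}) = 0
  · have h0 : PartialInterference.typeLaw Q k = 0 := by
      rw [← Measure.measure_univ_eq_zero, typeLaw_apply Q k MeasurableSet.univ, Set.image_univ,
        Set.range_sigmaMk, h1, mul_zero]
    rw [h0]
    exact ⟨aestronglyMeasurable_zero_measure _, by simp⟩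
  · rw [← map_typeLaw] at h2
    have h3 := h2.smul_measure (c := (Q (Sigma.fst ⁻¹' {k}))⁻¹) (by simp [h1])
    rw [smul_smul, ENNReal.inv_mul_cancel h1 (measure_ne_top _ _), one_smul,
      (measurableEmbedding_sigmaMk k).memLp_map_measure_iff] at h3
    exact h3

theorem Integrable.typeLaw {f : (Σ k, α k) → ℝ} (h : Integrable f Q) (k : Fin K) :
    Integrable (fun z => f ⟨k, z⟩) (typeLaw Q k) :=
  memLp_one_iff_integrable.1 (MemLp.typeLaw Q (memLp_one_iff_integrable.2 h) k)

theorem integrable_sigma {f : (Σ k, α k) → ℝ}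
    (h : ∀ k, Integrable (fun z => f ⟨k, z⟩) (typeLaw Q k)) : Integrable f Q := by
  rw [eq_sum_typeLaw Q]
  refine integrable_finsetSum_measure.2 fun k _ => ?_
  refine Integrable.smul_measure ?_ (measure_ne_top _ _)
  rw [(measurableEmbedding_sigmaMk k).integrable_map_iff]
  exact h k

theorem memLp_two_sigma {f : (Σ k, α k) → ℝ} (hf : Measurable f)
    (h : ∀ k, MemLp (fun z => f ⟨k, z⟩) 2 (typeLaw Q k)) : MemLp f 2 Q :=
  (memLp_two_iff_integrable_sq hf.aestronglyMeasurable).2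
    (integrable_sigma Q fun k => (h k).integrable_sq)

theorem ae_sigma {p : (Σ k, α k) → Prop} (h : ∀ k, ∀ᵐ z ∂typeLaw Q k, p ⟨k, z⟩) : ∀ᵐ o ∂Q, p o := by
  rw [ae_iff]
  have h2 : ∀ k, Q.restrict (Sigma.fst ⁻¹' {k}) {o | ¬ p o} = 0 := by
    intro k
    rw [← map_typeLaw, Measure.smul_apply, (measurableEmbedding_sigmaMk k).map_apply]
    have := ae_iff.1 (h k)
    simp only [smul_eq_mul, mul_eq_zero]
    exact Or.inr this
  have h3 := eq_sum_typeLaw Q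
  simp_rw [map_typeLaw] at h3
  rw [h3, Measure.finsetSum_apply]
  exact Finset.sum_eq_zero fun k _ => h2 k

theorem ae_typeLaw {p : (Σ k, α k) → Prop} (h : ∀ᵐ o ∂Q, p o) (k : Fin K) :
    ∀ᵐ z ∂typeLaw Q k, p ⟨k, z⟩ := by
  have h1 : ∀ᵐ z ∂Q.comap (Sigma.mk k), p ⟨k, z⟩ := by
    rw [ae_iff, (measurableEmbedding_sigmaMk k).comap_apply]
    refine measure_mono_null ?_ (ae_iff.1 h)
    rintro _ ⟨z, hz, rfl⟩
    exact hz
  exact Measure.ae_smul_measure h1 _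

theorem isProbabilityMeasure_typeLaw {k : Fin K} (h : 0 < typeProb Q k) :
    IsProbabilityMeasure (typeLaw Q k) := by
  have h1 : Q (Sigma.fst ⁻¹' {k}) ≠ 0 := fun h0 => by
    simp [typeProb, Measure.real, h0] at h
  refine ⟨?_⟩
  rw [typeLaw_apply Q k MeasurableSet.univ, Set.image_univ, Set.range_sigmaMk,
    ENNReal.inv_mul_cancel h1 (measure_ne_top _ _)]

end SigmaLaw

/-! ### Identification -/

section Observe

variable {K : ℕ} {M : Fin K → ℕ} {X : Fin K → Type*} [∀ k, MeasurableSpace (X k)]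

theorem measurable_observe : Measurable (observe : Full M X → Obs M X) :=
  measurable_of_sigmaMk fun k => (measurableEmbedding_sigmaMk k).measurable.comp measurable_snd

theorem typeProb_map_observe (F : Measure (Full M X)) (k : Fin K) :
    typeProb (F.map observe) k = typeProb F k := by
  rw [typeProb, typeProb, Measure.real, Measure.real, Measure.map_apply measurable_observe
    (measurable_sigma_fst (measurableSet_singleton k))]
  rfl

theorem typeLaw_map_observe (F : Measure (Full M X)) (k : Fin K) :
    typeLaw (F.map observe) k = (typeLaw F k).map Prod.snd := by
  ext s hs
  rw [typeLaw_apply _ _ hs, Measure.map_apply measurable_snd hs,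
    typeLaw_apply _ _ (measurable_snd hs), Measure.map_apply measurable_observe
    (measurable_sigma_fst (measurableSet_singleton k)), Measure.map_apply measurable_observe
    (measurableSet_image_sigmaMk k hs)]
  congr 2
  ext ⟨j, z⟩
  simp only [observe, Set.mem_preimage, Set.mem_image, Sigma.mk.injEq]
  constructor
  · rintro ⟨y, hy, rfl, h⟩
    rw [heq_eq_eq] at h
    exact ⟨z, by simpa [h] using hy, rfl, HEq.rfl⟩
  · rintro ⟨y, hy, rfl, h⟩
    rw [heq_eq_eq] at h
    exact ⟨z.2, by simpa [h] using hy, rfl, HEq.rfl⟩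

end Observe

section Identification

variable {m : ℕ} {α γ : Type*} [MeasurableSpace α] [MeasurableSingletonClass α] [Fintype α]
  [Nonempty α] [MeasurableSpace γ] [StandardBorelSpace γ]

/-- Under consistency, ignorability and overlap, the law of `(X, Y(a))` is given by the conditional
law of `Y` given `A = a` and `X`. -/
theorem map_potentialOutcome {Λ : Measure ((α → Fin m → ℝ) × (Fin m → ℝ) × α × γ)}
    [IsFiniteMeasure Λ] (hcons : ∀ᵐ z ∂Λ, z.2.1 = z.1 z.2.2.1) (a : α)
    (hX : Measurable fun z : (α → Fin m → ℝ) × (Fin m → ℝ) × α × γ => z.2.2.2)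
    (hind : CondIndepFun (MeasurableSpace.comap
        (fun z : (α → Fin m → ℝ) × (Fin m → ℝ) × α × γ => z.2.2.2) inferInstance)
      hX.comap_le (fun z => z.1 a) (fun z => z.2.2.1) Λ)
    {ε : γ → ℝ} (hεm : Measurable ε) (hε0 : ∀ x, 0 < ε x)
    (hε : ∀ᵐ x ∂covMarginal (Λ.map Prod.snd), (trtKernel (Λ.map Prod.snd) x).real {a} = ε x) :
    Λ.map (fun z => (z.2.2.2, z.1 a)) = covMarginal (Λ.map Prod.snd) ⊗ₘ
      (respKernel (Λ.map Prod.snd)).comap (fun x => (a, x)) measurable_prodMk_left := by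
  classical
  set ν := Λ.map Prod.snd with hν
  have hρ : covMarginal ν = Λ.map fun z => z.2.2.2 := by
    rw [covMarginal, hν, Measure.map_map (by fun_prop) (by fun_prop)]
    rfl
  have htrt : trtKernel ν =ᵐ[covMarginal ν] condDistrib
      (fun z : (α → Fin m → ℝ) × (Fin m → ℝ) × α × γ => z.2.2.1) (fun z => z.2.2.2) Λ := by
    rw [hρ]
    exact condDistrib_map (f := Prod.snd) (ν := Λ) (X := fun o : (Fin m → ℝ) × α × γ => o.2.2)
      (Y := fun o => o.2.1) (by fun_prop) (by fun_prop) (by fun_prop)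
  have hlaw := (condIndepFun_iff_map_prod_eq_prod_condDistrib_prod_condDistrib
    (by fun_prop) (by fun_prop) hX).1 hind
  rw [← Measure.compProd_eq_comp_prod, ← hρ] at hlaw
  refine Measure.ext_of_lintegral _ fun h hh => ?_
  have hwm : Measurable fun x => ENNReal.ofReal (ε x)⁻¹ := by fun_prop
  have hXY : Λ.map (fun z => (z.2.2.2, z.1 a)) = covMarginal ν ⊗ₘ condDistrib
      (fun z : (α → Fin m → ℝ) × (Fin m → ℝ) × α × γ => z.1 a) (fun z => z.2.2.2) Λ := by
    rw [hρ, compProd_map_condDistrib (by fun_prop)]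
  have hpos : ∀ᵐ x ∂covMarginal ν, condDistrib
      (fun z : (α → Fin m → ℝ) × (Fin m → ℝ) × α × γ => z.2.2.1) (fun z => z.2.2.2) Λ x {a} =
        ENNReal.ofReal (ε x) := by
    filter_upwards [htrt, hε] with x h1 h2
    rw [← h1, ← h2, Measure.real, ENNReal.ofReal_toReal (measure_ne_top _ _)]
  -- Inserting `1(A=a)/ε(X)` does not change the integral: by ignorability treatment and `Y(a)` are
  -- a product given `X`, and the indicator integrates to `ε(X)`.
  have h1 : ∫⁻ q, h q ∂Λ.map (fun z => (z.2.2.2, z.1 a)) =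
      ∫⁻ z, ({a} : Set α).indicator 1 z.2.2.1 * ENNReal.ofReal (ε z.2.2.2)⁻¹ *
        h (z.2.2.2, z.1 a) ∂Λ := by
    have e1 : ∫⁻ z, ({a} : Set α).indicator 1 z.2.2.1 * ENNReal.ofReal (ε z.2.2.2)⁻¹ *
        h (z.2.2.2, z.1 a) ∂Λ = ∫⁻ q, ({a} : Set α).indicator 1 q.2.2 *
          ENNReal.ofReal (ε q.1)⁻¹ * h (q.1, q.2.1) ∂Λ.map fun z =>
            (z.2.2.2, z.1 a, z.2.2.1) := by
      rw [lintegral_map (by fun_prop) (by fun_prop)]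
    rw [e1, hlaw, hXY, Measure.lintegral_compProd hh, Measure.lintegral_compProd (by fun_prop)]
    refine lintegral_congr_ae ?_
    filter_upwards [hpos] with x hx
    rw [Kernel.prod_apply]
    have e2 : ∀ q : (Fin m → ℝ) × α, ({a} : Set α).indicator 1 q.2 * ENNReal.ofReal (ε x)⁻¹ *
        h (x, q.1) = ENNReal.ofReal (ε x)⁻¹ * (h (x, q.1) * ({a} : Set α).indicator 1 q.2) :=
      fun q => by ring
    simp_rw [e2]
    rw [lintegral_const_mul _ (by fun_prop), lintegral_prod_mul (f := fun y => h (x, y))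
      (g := ({a} : Set α).indicator 1) (by fun_prop) (by fun_prop),
      lintegral_indicator_one (measurableSet_singleton a), hx, mul_comm (∫⁻ _, _ ∂_), ← mul_assoc,
      ← ENNReal.ofReal_mul (inv_nonneg.2 (hε0 x).le), inv_mul_cancel₀ (hε0 x).ne']
    simp
  -- Consistency is used only where the indicator is nonzero, and there it makes the integrand a
  -- function of the observed data.
  have h2 : ∫⁻ z, ({a} : Set α).indicator 1 z.2.2.1 * ENNReal.ofReal (ε z.2.2.2)⁻¹ *
        h (z.2.2.2, z.1 a) ∂Λ = ∫⁻ o, ({a} : Set α).indicator 1 o.2.1 *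
          ENNReal.ofReal (ε o.2.2)⁻¹ * h (o.2.2, o.1) ∂ν := by
    rw [hν, lintegral_map (by fun_prop) (by fun_prop)]
    refine lintegral_congr_ae ?_
    filter_upwards [hcons] with z hz
    by_cases hza : z.2.2.1 = a
    · rw [hz, hza]
    · simp [Set.indicator, hza]
  -- In the observed law only the arm `a` survives, and its conditional probability cancels the
  -- inverse weight.
  rw [h1, h2, lintegral_disintegrate (by fun_prop), Measure.lintegral_compProd hh]
  refine lintegral_congr_ae ?_
  filter_upwards [hε] with x hx
  rw [Finset.sum_eq_single a]
  · simp only [Set.mem_singleton_iff, Set.indicator_of_mem, Pi.one_apply, one_mul]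
    rw [lintegral_const_mul _ (by fun_prop), ← mul_assoc,
      ← ENNReal.ofReal_toReal (measure_ne_top (trtKernel ν x) {a})]
    change ENNReal.ofReal ((trtKernel ν x).real {a}) * _ * _ = _
    rw [hx, ← ENNReal.ofReal_mul (hε0 x).le, mul_inv_cancel₀ (hε0 x).ne']
    simp
    rfl
  · intro b _ hb
    simp [Set.indicator, hb]
  · simp

/-- The mean of a weighted potential outcome is the mean of the weighted outcome regression. -/
theorem integral_potentialOutcome {Λ : Measure ((α → Fin m → ℝ) × (Fin m → ℝ) × α × γ)}
    [IsFiniteMeasure Λ] (hcons : ∀ᵐ z ∂Λ, z.2.1 = z.1 z.2.2.1) (a : α)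
    (hX : Measurable fun z : (α → Fin m → ℝ) × (Fin m → ℝ) × α × γ => z.2.2.2)
    (hind : CondIndepFun (MeasurableSpace.comap
        (fun z : (α → Fin m → ℝ) × (Fin m → ℝ) × α × γ => z.2.2.2) inferInstance)
      hX.comap_le (fun z => z.1 a) (fun z => z.2.2.1) Λ)
    {ε : γ → ℝ} (hεm : Measurable ε) (hε0 : ∀ x, 0 < ε x)
    (hε : ∀ᵐ x ∂covMarginal (Λ.map Prod.snd), (trtKernel (Λ.map Prod.snd) x).real {a} = ε x)
    (hint : ∀ᵐ x ∂covMarginal (Λ.map Prod.snd), ∀ j,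
      Integrable (fun y : Fin m → ℝ => y j) (respKernel (Λ.map Prod.snd) (a, x)))
    {w : γ → Fin m → ℝ} (hw : Measurable w) (hwY : Integrable (fun z => w z.2.2.2 ⬝ᵥ z.1 a) Λ) :
    Integrable (fun x => w x ⬝ᵥ respMean (Λ.map Prod.snd) a x) (covMarginal (Λ.map Prod.snd)) ∧
      ∫ z, w z.2.2.2 ⬝ᵥ z.1 a ∂Λ =
        ∫ x, w x ⬝ᵥ respMean (Λ.map Prod.snd) a x ∂covMarginal (Λ.map Prod.snd) := by
  have hlaw := map_potentialOutcome hcons a hX hind hεm hε0 hε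
  set ν := Λ.map Prod.snd
  have hm : Measurable fun q : γ × (Fin m → ℝ) => w q.1 ⬝ᵥ q.2 :=
    measurable_dotProduct (hw.comp measurable_fst) measurable_snd
  have h1 : Integrable (fun q : γ × (Fin m → ℝ) => w q.1 ⬝ᵥ q.2)
      (Λ.map fun z => (z.2.2.2, z.1 a)) := by
    rw [integrable_map_measure hm.aestronglyMeasurable (by fun_prop)]
    exact hwY
  have h2 : ∫ z, w z.2.2.2 ⬝ᵥ z.1 a ∂Λ =
      ∫ q : γ × (Fin m → ℝ), w q.1 ⬝ᵥ q.2 ∂(Λ.map fun z => (z.2.2.2, z.1 a)) := by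
    rw [integral_map (by fun_prop) hm.aestronglyMeasurable]
  rw [hlaw] at h1
  have h3 : (fun x => ∫ y, w x ⬝ᵥ y ∂(respKernel ν).comap (fun x => (a, x))
      measurable_prodMk_left x) =ᵐ[covMarginal ν] fun x => w x ⬝ᵥ respMean ν a x := by
    filter_upwards [hint] with x hx
    have := (integral_dotProduct_sub hx (w x) 0).2
    simp only [sub_zero] at this
    rw [Kernel.comap_apply, this]
    rfl
  refine ⟨h1.integral_compProd.congr h3, ?_⟩
  rw [h2, hlaw, Measure.integral_compProd h1]
  exact integral_congr_ae h3

end Identification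

/-! ### Functions of the observed data and their means -/

section ObsFun

variable {K : ℕ} {M : Fin K → ℕ} {X : Fin K → Type*} [∀ k, MeasurableSpace (X k)]

theorem measurable_obs_prop {h : PropFun M X} (hh : ∀ k a, Measurable (h k a)) :
    Measurable fun o : Obs M X => h o.1 o.2.2.1 o.2.2.2 :=
  measurable_of_sigmaMk fun k => (measurable_uncurry_of_finite (hh k)).comp measurable_snd

theorem measurable_obs_sum {h : PropFun M X} (hh : ∀ k a, Measurable (h k a)) :
    Measurable fun o : Obs M X => ∑ a, h o.1 a o.2.2.2 :=
  measurable_of_sigmaMk fun k => by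
    change Measurable fun z : ClusterObs M X k => ∑ a, h k a z.2.2
    exact Finset.measurable_sum _ fun a _ => (hh k a).comp (measurable_snd.comp measurable_snd)

theorem measurable_weightedResidual {w g : RegFun M X} (hw : ∀ k a, Measurable (w k a))
    (hg : ∀ k a, Measurable (g k a)) : Measurable (weightedResidual w g) :=
  measurable_of_sigmaMk fun k => measurable_residual (hw k) (hg k)

theorem measurable_weightedRegression {w g : RegFun M X} (hw : ∀ k a, Measurable (w k a))
    (hg : ∀ k a, Measurable (g k a)) : Measurable (weightedRegression w g) :=
  measurable_obs_sum fun k a => measurable_dotProduct (hw k a) (hg k a)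

theorem measurable_outcomeReg (Q : Measure (Obs M X)) (k : Fin K) (a : Treat (M k)) :
    Measurable (outcomeReg Q k a) := by
  refine measurable_pi_lambda _ fun j => ?_
  exact ((stronglyMeasurable_integral_resp (ν := typeLaw Q k)
    (f := fun o : ClusterObs M X k => o.1 j) (by fun_prop)).measurable).comp measurable_prodMk_left

theorem measurable_propensity (Q : Measure (Obs M X)) (k : Fin K) (a : Treat (M k)) :
    Measurable (propensity Q k a) :=
  measurable_trtKernel_real (ν := typeLaw Q k) a

theorem propensity_nonneg (Q : Measure (Obs M X)) (k : Fin K) (a : Treat (M k)) (x : X k) :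
    0 ≤ propensity Q k a x := measureReal_nonneg

theorem sum_propensity (Q : Measure (Obs M X)) (k : Fin K) (x : X k) :
    ∑ a, propensity Q k a x = 1 := sum_trtKernel_real (ν := typeLaw Q k) x

instance (Q : Measure (Obs M X)) (k : Fin K) (a : Treat (M k)) (x : X k) :
    IsProbabilityMeasure (outcomeLaw Q k a x) :=
  inferInstanceAs (IsProbabilityMeasure (respKernel (typeLaw Q k) (a, x)))

theorem MomentsExist.integrable_resp {Q : Measure (Obs M X)} (h : MomentsExist Q) (k : Fin K)
    (a : Treat (M k)) : ∀ᵐ x ∂covMarginal (typeLaw Q k), ∀ j,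
      Integrable (fun y : Outcome (M k) => y j) (respKernel (typeLaw Q k) (a, x)) := by
  filter_upwards [h.memLp k a] with x hx j
  exact (hx j).integrable (by norm_num)

/-- Averaging over the treatment given the covariates. -/
theorem integral_obs_prop (Q : Measure (Obs M X)) [IsFiniteMeasure Q] {h : PropFun M X} {B : ℝ}
    (hh : ∀ k a, Measurable (h k a)) (hB : ∀ k a x, |h k a x| ≤ B) :
    ∫ o, h o.1 o.2.2.1 o.2.2.2 ∂Q = ∫ o, ∑ a, h o.1 a o.2.2.2 * propensity Q o.1 a o.2.2.2 ∂Q := by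
  have i1 : Integrable (fun o : Obs M X => h o.1 o.2.2.1 o.2.2.2) Q :=
    Integrable.of_bound (measurable_obs_prop hh).aestronglyMeasurable B
      (Eventually.of_forall fun o => hB _ _ _)
  have i2 : Integrable (fun o : Obs M X => ∑ a, h o.1 a o.2.2.2 * propensity Q o.1 a o.2.2.2) Q := by
    refine Integrable.of_bound (measurable_obs_sum fun k a =>
      (hh k a).mul (measurable_propensity Q k a)).aestronglyMeasurable B
      (Eventually.of_forall fun o => ?_)
    calc _ ≤ ∑ a, B * propensity Q o.1 a o.2.2.2 := by
          refine (norm_sum_le _ _).trans (Finset.sum_le_sum fun a _ => ?_)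
          rw [norm_mul, Real.norm_of_nonneg (propensity_nonneg _ _ _ _)]
          exact mul_le_mul_of_nonneg_right (hB _ _ _) (propensity_nonneg _ _ _ _)
      _ = B := by rw [← Finset.mul_sum, sum_propensity, mul_one]
  rw [integral_sigma Q i1, integral_sigma Q i2]
  refine Finset.sum_congr rfl fun k _ => ?_
  congr 1
  set ν := typeLaw Q k
  have i3 : Integrable (fun p : Treat (M k) × X k => h k p.1 p.2) (trtCovLaw ν) :=
    Integrable.of_bound (measurable_uncurry_of_finite (hh k)).aestronglyMeasurable B
      (Eventually.of_forall fun p => hB _ _ _)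
  have e1 : ∫ z : ClusterObs M X k, h k z.2.1 z.2.2 ∂ν =
      ∫ p : Treat (M k) × X k, h k p.1 p.2 ∂trtCovLaw ν := by
    rw [integral_map (by fun_prop) i3.1]
  rw [e1, integral_trt i3, integral_map (by fun_prop)]
  · refine integral_congr_ae (Eventually.of_forall fun z => ?_)
    exact Finset.sum_congr rfl fun a _ => mul_comm _ _
  · exact (Finset.measurable_sum _ fun a _ => (measurable_trtKernel_real a).mul
      (hh k a)).aestronglyMeasurable

/-- The weighted residual is orthogonal to functions of `(A, X, L)`. -/
theorem integral_weightedResidual_mul (P : Measure (Obs M X)) [IsFiniteMeasure P]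
    (hP : MomentsExist P) {w : RegFun M X} {h : PropFun M X}
    (hi : Integrable (fun o => weightedResidual w (outcomeReg P) o * h o.1 o.2.2.1 o.2.2.2) P) :
    ∫ o, weightedResidual w (outcomeReg P) o * h o.1 o.2.2.1 o.2.2.2 ∂P = 0 := by
  rw [integral_sigma P hi]
  refine Finset.sum_eq_zero fun k _ => ?_
  have hk := Integrable.typeLaw P hi k
  rw [integral_resp hk, integral_eq_zero_of_ae, mul_zero]
  refine ae_trtCovLaw_of_ae fun a => ?_
  filter_upwards [hP.integrable_resp k a] with x hx
  have h1 := integral_dotProduct_sub hx (w k a x) (outcomeReg P k a x)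
  simp only [weightedResidual]
  rw [integral_mul_const, h1.2]
  have : (fun j => ∫ y, y j ∂respKernel (typeLaw P k) (a, x)) = outcomeReg P k a x := rfl
  rw [this]
  simp

/-- Indicator of the cluster type `k`. -/
def ind (k : Fin K) (o : Obs M X) : ℝ := if o.1 = k then 1 else 0

theorem measurable_ind (k : Fin K) : Measurable (ind k : Obs M X → ℝ) :=
  measurable_of_sigmaMk fun j => measurable_const (a := if j = k then (1 : ℝ) else 0)

theorem abs_ind_le (k : Fin K) (o : Obs M X) : |ind k o| ≤ 1 := by
  unfold ind
  split_ifs <;> simp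

theorem integral_ind_mul (Q : Measure (Obs M X)) (k : Fin K) (f : Obs M X → ℝ) :
    ∫ o, ind k o * f o ∂Q = ∫ o in Sigma.fst ⁻¹' {k}, f o ∂Q := by
  rw [← integral_indicator (measurable_sigma_fst (measurableSet_singleton k))]
  refine integral_congr_ae (Eventually.of_forall fun o => ?_)
  by_cases h : o.1 = k <;> simp [ind, Set.indicator, h]

theorem integral_ind (Q : Measure (Obs M X)) (k : Fin K) : ∫ o, ind k o ∂Q = typeProb Q k := by
  have := integral_ind_mul Q k fun _ => 1
  simp only [mul_one] at this
  rw [this]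
  simp [typeProb]

end ObsFun

/-! ### The efficient influence function -/

section Influence

variable {K : ℕ} {M : Fin K → ℕ} {X : Fin K → Type*} [∀ k, MeasurableSpace (X k)]

/-- The AIPW function with outcome regression `g` and propensity score `e`. -/
def aipwObs (w g : RegFun M X) (e : PropFun M X) (o : Obs M X) : ℝ :=
  weightedResidual w g o / e o.1 o.2.2.1 o.2.2.2 + weightedRegression w g o

theorem measurable_aipwObs {w g : RegFun M X} {e : PropFun M X} (hw : ∀ k a, Measurable (w k a))
    (hg : ∀ k a, Measurable (g k a)) (he : ∀ k a, Measurable (e k a)) :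
    Measurable (aipwObs w g e) :=
  ((measurable_weightedResidual hw hg).div (measurable_obs_prop he)).add
    (measurable_weightedRegression hw hg)

/-- `θₖ = ∑ₐ E{wₖ(a, X)ᵀ g(a, X, k) | L = k}`. -/
def typeMean (w : RegFun M X) (Q : Measure (Obs M X)) (k : Fin K) : ℝ :=
  ∑ a, ∫ x, w k a x ⬝ᵥ outcomeReg Q k a x ∂covLaw Q k

/-- Derivative of `v` at `pr(L = k)`. -/
def weightDeriv (v : Fin K → ℝ → ℝ) (Q : Measure (Obs M X)) (k : Fin K) : ℝ :=
  derivWithin (v k) (Set.Ioc 0 1) (typeProb Q k)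

/-- The efficient influence function. -/
def effInfluence (w : RegFun M X) (v : Fin K → ℝ → ℝ) (e : PropFun M X) (P : Measure (Obs M X))
    (o : Obs M X) : ℝ :=
  ∑ k, (v k (typeProb P k) / typeProb P k *
      (ind k o * aipwObs w (outcomeReg P) e o - typeMean w P k * ind k o) +
    weightDeriv v P k * typeMean w P k * (ind k o - typeProb P k))

/-- Conditions on the observed-data law that are used for the efficiency bounds. -/
structure LawConditions (P : Measure (Obs M X)) (w : RegFun M X) (e : PropFun M X) (c : ℝ) :
    Prop where
  typeProb_pos : ∀ k, 0 < typeProb P k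
  prop_measurable : ∀ k a, Measurable (e k a)
  prop_eq : PropEq P (propensity P) e
  c_pos : 0 < c
  overlap : ∀ k a x, c < e k a x ∧ e k a x < 1 - c
  moments : MomentsExist P
  weight_measurable : ∀ k a, Measurable (w k a)
  weight_integrable : ∀ k a, Integrable (fun x => w k a x ⬝ᵥ outcomeReg P k a x) (covLaw P k)

/-- The AIPW function is unbiased when it uses the propensity score of `Q` itself, whatever `g` is,
so `g` can be frozen while the law varies. Truncation at `c` keeps the inverse weights bounded
everywhere and changes nothing almost everywhere, by overlap. -/
theorem typeProb_mul_typeMean {w : RegFun M X} {c : ℝ} {Q : Measure (Obs M X)}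
    (hc : 0 < c) (hQ : Q ∈ modelNP w c) {g : RegFun M X}
    (hr : MemLp (weightedResidual w g) 2 Q) (hm : MemLp (weightedRegression w g) 2 Q)
    (k : Fin K) :
    typeProb Q k * typeMean w Q k =
      ∫ o, ind k o * aipwObs w g (fun k a x => max (propensity Q k a x) c) o ∂Q := by
  obtain ⟨hprob, hover, hmom, hwint⟩ := hQ
  set ε : PropFun M X := fun k a x => max (propensity Q k a x) c with hε
  have hεm : Measurable fun o : Obs M X => ε o.1 o.2.2.1 o.2.2.2 :=
    measurable_obs_prop fun k a => (measurable_propensity Q k a).max measurable_const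
  have hφ : Integrable (aipwObs w g ε) Q := by
    refine Integrable.add ?_ (hm.integrable (by norm_num))
    simp only [div_eq_inv_mul]
    refine (memLp_bdd_mul (B := c⁻¹) hεm.inv (fun o => ?_) hr).integrable (by norm_num)
    have h1 : c ≤ ε o.1 o.2.2.1 o.2.2.2 := le_max_right _ _
    rw [Pi.inv_apply, abs_of_nonneg (inv_nonneg.2 (hc.le.trans h1))]
    exact inv_anti₀ hc h1
  rw [integral_ind_mul, ← typeProb_mul_integral]
  congr 1
  have hφk : Integrable (aipw (w k) (g k) (ε k)) (typeLaw Q k) := Integrable.typeLaw Q hφ k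
  have h1 := integral_aipw_of_propensity (hmom.integrable_resp k) (ε := ε k) (fun a => ?_) hφk
  · refine Eq.trans ?_ h1.symm
    rw [integral_finsetSum _ fun a _ => ?_]
    · rfl
    · exact hwint k a
  · filter_upwards [hover k a] with x hx
    have : ε k a x = propensity Q k a x := max_eq_left hx.1.le
    rw [this]
    exact ⟨rfl, (hc.trans hx.1).ne'⟩

theorem memLp_of_lintegral_le {𝓞 : Type*} [MeasurableSpace 𝓞] {Q : Measure 𝓞} {h : 𝓞 → ℝ}
    (hm : Measurable h) {C : ℝ≥0} (hC : ∫⁻ o, ‖h o‖ₑ ^ 2 ∂Q ≤ C) :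
    MemLp h 2 Q ∧ ∫ o, h o ^ 2 ∂Q ≤ C := by
  have h1 : ∀ o, ‖h o‖ₑ ^ 2 = ENNReal.ofReal (h o ^ 2) := fun o => by
    rw [← sq_abs, ENNReal.ofReal_pow (abs_nonneg _), Real.enorm_eq_ofReal_abs]
  simp_rw [h1] at hC
  have h2 : Integrable (fun o => h o ^ 2) Q := by
    refine ⟨(hm.pow_const 2).aestronglyMeasurable, ?_⟩
    rw [hasFiniteIntegral_iff_ofReal (Eventually.of_forall fun o => sq_nonneg _)]
    exact hC.trans_lt ENNReal.coe_lt_top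
  refine ⟨(memLp_two_iff_integrable_sq hm.aestronglyMeasurable).2 h2, ?_⟩
  rw [integral_eq_lintegral_of_nonneg_ae (Eventually.of_forall fun o => sq_nonneg _) h2.1]
  exact ENNReal.toReal_le_coe_of_le_coe hC

variable {P : Measure (Obs M X)} [IsProbabilityMeasure P] {w : RegFun M X} {e : PropFun M X}
  {c : ℝ} {v : Fin K → ℝ → ℝ}

theorem LawConditions.mem_modelNPKnown (hP : LawConditions P w e c) : P ∈ modelNPKnown w c e := by
  refine ⟨⟨inferInstance, fun k a => ?_, hP.moments, hP.weight_integrable⟩, hP.prop_eq⟩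
  filter_upwards [hP.prop_eq k a] with x hx
  rw [hx]
  exact hP.overlap k a x

variable {d : ℕ} {Q : (Fin d → ℝ) → Measure (Obs M X)} {η₀ : Fin d → ℝ} {s : Obs M X → Fin d → ℝ}

/-- A regular parametric submodel of the nonparametric model. -/
theorem IsRegularSubmodel.isQMD
    (hQ : IsRegularSubmodel (modelNP w c) (momentFunctions w P) P Q η₀ s) :
    ∃ μ f, IsQMD P Q η₀ s μ f := by
  obtain ⟨μ, f, -, h1, h2, h3, h4⟩ := hQ.qmd
  refine ⟨μ, f, ⟨?_, ?_, hQ.score_measurable, hQ.score_memLp, h1, h2, h3, h4⟩⟩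
  · rw [← hQ.at_center, h3.self_of_nhds]
  · exact hQ.mem_model.mono fun η h => h.1

/-- Difference of inverse propensity scores on type `k`. -/
def invPropDiff (Q : Measure (Obs M X)) (e : PropFun M X) (c : ℝ) (k : Fin K) : PropFun M X :=
  fun j a x => if j = k then (max (propensity Q j a x) c)⁻¹ - (e j a x)⁻¹ else 0

theorem measurable_invPropDiff (hP : LawConditions P w e c) (Q : Measure (Obs M X)) (k j : Fin K)
    (a : Treat (M j)) : Measurable (invPropDiff Q e c k j a) := by
  unfold invPropDiff
  split_ifs
  · exact ((measurable_propensity Q j a).max measurable_const).inv.sub (hP.prop_measurable j a).inv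
  · exact measurable_const

/-- Both denominators are at least `c`, so both inverses lie in `(0, c⁻¹]` and their difference is
at most `c⁻²` times that of the denominators. Truncation at `c` does not increase the distance to
`e`, which exceeds `c`. -/
theorem abs_invPropDiff_le (hP : LawConditions P w e c) (Q : Measure (Obs M X)) (k j : Fin K)
    (a : Treat (M j)) (x : X j) :
    |invPropDiff Q e c k j a x| ≤ c⁻¹ ∧
      |invPropDiff Q e c k j a x| ≤ (c ^ 2)⁻¹ * |propensity Q j a x - e j a x| := by
  have hc := hP.c_pos
  have he := (hP.overlap j a x).1
  have hm : c ≤ max (propensity Q j a x) c := le_max_right _ _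
  have hm0 := hc.trans_le hm
  have he0 := hc.trans he
  unfold invPropDiff
  split_ifs
  · constructor
    · have h1 := inv_anti₀ hc hm
      have h2 := inv_anti₀ hc he.le
      have h3 := inv_pos.2 hm0
      have h4 := inv_pos.2 he0
      rw [abs_le]
      constructor <;> linarith
    · rw [inv_sub_inv hm0.ne' he0.ne', abs_div, abs_of_pos (mul_pos hm0 he0), div_eq_inv_mul]
      have h1 : |e j a x - max (propensity Q j a x) c| ≤ |propensity Q j a x - e j a x| := by
        rw [abs_sub_comm]
        rcases le_total c (propensity Q j a x) with h | h
        · rw [max_eq_left h]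
        · rw [max_eq_right h, abs_of_neg (by linarith), abs_of_neg (by linarith)]
          linarith
      refine mul_le_mul (inv_anti₀ (by positivity) ?_) h1 (abs_nonneg _) (by positivity)
      rw [sq]
      exact mul_le_mul hm he.le hc.le hm0.le
  · simp only [abs_zero]
    exact ⟨(inv_pos.2 hc).le, by positivity⟩

theorem sign_mul_self_eq_abs (x : ℝ) : Real.sign x * x = |x| := by
  rcases lt_trichotomy x 0 with h | rfl | h
  · rw [Real.sign_of_neg h, abs_of_neg h, neg_one_mul]
  · simp
  · rw [Real.sign_of_pos h, abs_of_pos h, one_mul]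

/-- The propensity score of a submodel is continuous in mean. -/
theorem tendsto_integral_abs_invPropDiff (hP : LawConditions P w e c)
    {μ : Measure (Obs M X)} {f : (Fin d → ℝ) → Obs M X → ℝ} (H : IsQMD P Q η₀ s μ f) (k : Fin K) :
    Tendsto (fun η => ∫ o, |invPropDiff (Q η) e c k o.1 o.2.2.1 o.2.2.2| ∂P) (𝓝 η₀) (𝓝 0) := by
  have hlim : Tendsto (fun η => (c ^ 2)⁻¹ * (4 * √(∫ o, (√(f η o) - √(f η₀ o)) ^ 2 ∂μ)))
      (𝓝 η₀) (𝓝 0) := by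
    simpa using (H.tendsto_integral_sq_sub.sqrt.const_mul 4).const_mul (c ^ 2)⁻¹
  refine tendsto_of_tendsto_of_tendsto_of_le_of_le' tendsto_const_nhds hlim
    (Eventually.of_forall fun η => integral_nonneg fun o => abs_nonneg _) ?_
  filter_upwards [H.eventually_abs_integral_sub_le, H.isProb] with η hη hprob
  -- This test function turns `σ (e_η - e)` into `|e_η - e|`. Two comparisons of means under `Q η`
  -- and `P` are then made, one for `σ(A, X)` and one for `∑ₐ σ e_η`. These have the same mean under
  -- `Q η`, so their `P`-means differ by at most twice the total variation bound, hence the factor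
  -- 4.
  set σ : PropFun M X := fun k a x => Real.sign (propensity (Q η) k a x - e k a x) with hσ
  have hsm : Measurable Real.sign := by
    unfold Real.sign
    exact Measurable.ite measurableSet_Iio measurable_const
      (Measurable.ite measurableSet_Ioi measurable_const measurable_const)
  have hσm : ∀ k a, Measurable (σ k a) := fun k a =>
    hsm.comp ((measurable_propensity _ k a).sub (hP.prop_measurable k a))
  have hσ1 : ∀ k a x, |σ k a x| ≤ 1 := fun k a x => by
    rcases Real.sign_apply_eq (propensity (Q η) k a x - e k a x) with h | h | h <;> simp [hσ, h]
  have h1m := measurable_obs_prop hσm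
  have h2m := measurable_obs_sum (h := fun k a x => σ k a x * propensity (Q η) k a x)
    fun k a => (hσm k a).mul (measurable_propensity (Q η) k a)
  have h3m := measurable_obs_sum (h := fun k a x => σ k a x * propensity P k a x)
    fun k a => (hσm k a).mul (measurable_propensity P k a)
  have hb : ∀ (R : Measure (Obs M X)) (o : Obs M X),
      |∑ a, σ o.1 a o.2.2.2 * propensity R o.1 a o.2.2.2| ≤ 1 := fun R o => by
    calc _ ≤ ∑ a, propensity R o.1 a o.2.2.2 := by
          refine (Finset.abs_sum_le_sum_abs _ _).trans (Finset.sum_le_sum fun a _ => ?_)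
          rw [abs_mul, abs_of_nonneg (propensity_nonneg _ _ _ _)]
          exact mul_le_of_le_one_left (propensity_nonneg _ _ _ _) (hσ1 _ _ _)
      _ = 1 := sum_propensity _ _ _
  have d1 := hη _ h1m fun o => hσ1 _ _ _
  have d2 := hη _ h2m (hb (Q η))
  rw [integral_obs_prop (Q η) hσm hσ1, integral_obs_prop P hσm hσ1] at d1
  have i2 : Integrable (fun o : Obs M X => ∑ a, σ o.1 a o.2.2.2 * propensity (Q η) o.1 a o.2.2.2) P :=
    Integrable.of_bound h2m.aestronglyMeasurable 1 (Eventually.of_forall (hb _))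
  have i3 : Integrable (fun o : Obs M X => ∑ a, σ o.1 a o.2.2.2 * propensity P o.1 a o.2.2.2) P :=
    Integrable.of_bound h3m.aestronglyMeasurable 1 (Eventually.of_forall (hb _))
  have h3 : ∫ o, |invPropDiff (Q η) e c k o.1 o.2.2.1 o.2.2.2| ∂P ≤
      (c ^ 2)⁻¹ * (∫ o : Obs M X, ∑ a, σ o.1 a o.2.2.2 * propensity (Q η) o.1 a o.2.2.2 ∂P -
        ∫ o : Obs M X, ∑ a, σ o.1 a o.2.2.2 * propensity P o.1 a o.2.2.2 ∂P) := by
    rw [← integral_sub i2 i3, ← integral_const_mul]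
    refine integral_mono_ae ?_ ((i2.sub i3).const_mul _) ?_
    · exact (Integrable.of_bound (measurable_obs_prop
        (measurable_invPropDiff hP (Q η) k)).aestronglyMeasurable c⁻¹
        (Eventually.of_forall fun o => (abs_invPropDiff_le hP _ _ _ _ _).1)).abs
    · have hae : ∀ᵐ o ∂P, ∀ a, propensity P o.1 a o.2.2.2 = e o.1 a o.2.2.2 := by
        refine ae_sigma P fun k => ?_
        change ∀ᵐ z : ClusterObs M X k ∂typeLaw P k, ∀ a, propensity P k a z.2.2 = e k a z.2.2
        refine ae_all_iff.2 fun a => ?_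
        exact ae_of_ae_map (f := fun o : ClusterObs M X k => o.2.2) (by fun_prop) (hP.prop_eq k a)
      filter_upwards [hae] with o ho
      refine (abs_invPropDiff_le hP (Q η) k _ _ _).2.trans ?_
      refine mul_le_mul_of_nonneg_left ?_ (by positivity)
      rw [← Finset.sum_sub_distrib]
      have h4 : ∀ a, σ o.1 a o.2.2.2 * propensity (Q η) o.1 a o.2.2.2 -
          σ o.1 a o.2.2.2 * propensity P o.1 a o.2.2.2 =
          |propensity (Q η) o.1 a o.2.2.2 - e o.1 a o.2.2.2| := fun a => by
        rw [ho a, ← mul_sub, hσ, sign_mul_self_eq_abs]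
      simp_rw [h4]
      exact Finset.single_le_sum (f := fun a => |propensity (Q η) o.1 a o.2.2.2 - e o.1 a o.2.2.2|)
        (fun a _ => abs_nonneg _) (Finset.mem_univ _)
  refine h3.trans (mul_le_mul_of_nonneg_left ?_ (by have := hP.c_pos; positivity))
  have := abs_le.1 d1
  have := abs_le.1 d2
  linarith

end Influence

/-! ### Pathwise differentiability -/

section Pathwise

/-- Differentiate the total mass: it is constantly one near the centre, and its derivative is the
mean of the score. -/
theorem IsQMD.integral_score {𝓞 : Type*} [MeasurableSpace 𝓞] {P : Measure 𝓞}
    [IsProbabilityMeasure P] {d : ℕ} {Q : (Fin d → ℝ) → Measure 𝓞} {η₀ : Fin d → ℝ}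
    {s : 𝓞 → Fin d → ℝ} {μ : Measure 𝓞} {f : (Fin d → ℝ) → 𝓞 → ℝ} (H : IsQMD P Q η₀ s μ f)
    (j : Fin d) : ∫ o, s o j ∂P = 0 := by
  have h1 := H.hasFDerivAt_integral (F := fun _ => 1) (C := 1) measurable_const
    (H.isProb.mono fun η h => ⟨memLp_const _, by simp⟩)
  have h2 : HasFDerivAt (fun η => ∫ _, (1 : ℝ) ∂Q η) (0 : (Fin d → ℝ) →L[ℝ] ℝ) η₀ := by
    refine (hasFDerivAt_const (1 : ℝ) η₀).congr_of_eventuallyEq ?_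
    filter_upwards [H.isProb] with η h
    simp
  have h3 := congrArg (fun L : (Fin d → ℝ) →L[ℝ] ℝ => L (Pi.single j 1)) (h1.unique h2)
  simpa [Pi.single_apply, Finset.sum_apply] using h3

/-- The Cramér–Rao bound of a submodel is at most the variance of the influence function. -/
theorem cramerRao_le {𝓞 : Type*} [MeasurableSpace 𝓞] {P : Measure 𝓞} {d : ℕ}
    {s : 𝓞 → Fin d → ℝ} (hs : ∀ j, MemLp (fun o => s o j) 2 P) {D : 𝓞 → ℝ} (hD : MemLp D 2 P)
    (hI : IsUnit (information P s).det) {g : Fin d → ℝ} (hg : ∀ j, g j = ∫ o, D o * s o j ∂P) :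
    g ⬝ᵥ ((information P s)⁻¹ *ᵥ g) ≤ ∫ o, D o ^ 2 ∂P := by
  set b := (information P s)⁻¹ *ᵥ g with hb
  have hIb : information P s *ᵥ b = g := by
    rw [hb, Matrix.mulVec_mulVec, Matrix.mul_nonsing_inv _ hI, Matrix.one_mulVec]
  have hbs : MemLp (fun o => b ⬝ᵥ s o) 2 P := memLp_finsetSum _ fun j _ => (hs j).const_mul _
  have h1 : ∫ o, D o * (b ⬝ᵥ s o) ∂P = g ⬝ᵥ b := by
    simp only [dotProduct, Finset.mul_sum]
    rw [integral_finsetSum]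
    · refine Finset.sum_congr rfl fun j _ => ?_
      rw [hg j, ← integral_mul_const]
      exact integral_congr_ae (Eventually.of_forall fun o => by simp only; ring)
    · exact fun j _ => integrable_mul_of_memLp hD ((hs j).const_mul _)
  have h2 : ∫ o, (b ⬝ᵥ s o) ^ 2 ∂P = g ⬝ᵥ b := by
    have e1 : ∀ o, (b ⬝ᵥ s o) ^ 2 = ∑ i, ∑ j, b i * b j * (s o i * s o j) := fun o => by
      simp only [dotProduct, sq, Finset.sum_mul_sum]
      exact Finset.sum_congr rfl fun i _ => Finset.sum_congr rfl fun j _ => by ring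
    simp_rw [e1]
    have i1 : ∀ i j, Integrable (fun o => b i * b j * (s o i * s o j)) P := fun i j =>
      (integrable_mul_of_memLp (hs i) (hs j)).const_mul _
    rw [integral_finsetSum _ fun i _ => integrable_finsetSum _ fun j _ => i1 i j]
    conv_rhs => rw [← hIb, dotProduct_comm]
    simp only [dotProduct, Matrix.mulVec, Finset.mul_sum]
    refine Finset.sum_congr rfl fun i _ => ?_
    rw [integral_finsetSum _ fun j _ => i1 i j]
    refine Finset.sum_congr rfl fun j _ => ?_
    rw [integral_const_mul]
    simp only [information, Matrix.of_apply]
    ring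
  -- Here `b ⬝ᵥ s` is the projection of `D` on the span of the scores; its inner product with `D`
  -- and its squared norm both equal the Cramér–Rao bound.
  have h3 : 0 ≤ ∫ o, (D o - b ⬝ᵥ s o) ^ 2 ∂P := integral_nonneg fun o => sq_nonneg _
  have h4 : ∫ o, (D o - b ⬝ᵥ s o) ^ 2 ∂P =
      ∫ o, D o ^ 2 ∂P - 2 * ∫ o, D o * (b ⬝ᵥ s o) ∂P + ∫ o, (b ⬝ᵥ s o) ^ 2 ∂P := by
    have i1 := hD.integrable_sq
    have i2 := (integrable_mul_of_memLp hD hbs).const_mul 2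
    have i3 := hbs.integrable_sq
    have i4 : Integrable (fun o => D o ^ 2 - 2 * (D o * (b ⬝ᵥ s o))) P := i1.sub i2
    rw [← integral_const_mul, ← integral_sub i1 i2, ← integral_add i4 i3]
    exact integral_congr_ae (Eventually.of_forall fun o => by simp only; ring)
  rw [h4, h1, h2] at h3
  linarith

variable {K : ℕ} {M : Fin K → ℕ} {X : Fin K → Type*} [∀ k, MeasurableSpace (X k)]
  {P : Measure (Obs M X)} [IsProbabilityMeasure P] {w : RegFun M X} {e : PropFun M X}
  {c : ℝ} {v : Fin K → ℝ → ℝ}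
  {d : ℕ} {Q : (Fin d → ℝ) → Measure (Obs M X)} {η₀ : Fin d → ℝ} {s : Obs M X → Fin d → ℝ}

theorem LawConditions.aipwObs_bound (hP : LawConditions P w e c) (g : RegFun M X) (o : Obs M X) :
    aipwObs w g e o ^ 2 ≤ 2 * (c ^ 2)⁻¹ * weightedResidual w g o ^ 2 +
      2 * weightedRegression w g o ^ 2 := by
  refine (add_sq_le_two_mul _ _).trans ?_
  have hc := hP.c_pos
  rw [div_pow, div_eq_inv_mul, ← mul_assoc]
  gcongr
  exact (hP.overlap _ _ _).1.le

theorem LawConditions.memLp_ind_mul_aipwObs (hP : LawConditions P w e c)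
    {Q : Measure (Obs M X)} {g : RegFun M X} (hg : ∀ k a, Measurable (g k a))
    (hr : MemLp (weightedResidual w g) 2 Q) (hm : MemLp (weightedRegression w g) 2 Q)
    (k : Fin K) :
    MemLp (fun o => ind k o * aipwObs w g e o) 2 Q ∧
      ∫ o, (ind k o * aipwObs w g e o) ^ 2 ∂Q ≤
        2 * (c ^ 2)⁻¹ * ∫ o, weightedResidual w g o ^ 2 ∂Q +
          2 * ∫ o, weightedRegression w g o ^ 2 ∂Q := by
  have hmeas := measurable_aipwObs hP.weight_measurable hg hP.prop_measurable
  have i1 := hr.integrable_sq.const_mul (2 * (c ^ 2)⁻¹)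
  have i2 := hm.integrable_sq.const_mul 2
  have hle : ∀ o, (ind k o * aipwObs w g e o) ^ 2 ≤ 2 * (c ^ 2)⁻¹ * weightedResidual w g o ^ 2 +
      2 * weightedRegression w g o ^ 2 := fun o => by
    refine le_trans ?_ (hP.aipwObs_bound g o)
    rw [mul_pow]
    exact mul_le_of_le_one_left (sq_nonneg _) ((sq_le_one_iff_abs_le_one _).2 (abs_ind_le k o))
  have hi : Integrable (fun o => (ind k o * aipwObs w g e o) ^ 2) Q :=
    (i1.add i2).mono' (((measurable_ind k).mul hmeas).pow_const 2).aestronglyMeasurable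
      (Eventually.of_forall fun o => by
        rw [Real.norm_of_nonneg (sq_nonneg _)]
        exact hle o)
  refine ⟨(memLp_two_iff_integrable_sq ((measurable_ind k).mul hmeas).aestronglyMeasurable).2 hi, ?_⟩
  rw [← integral_const_mul, ← integral_const_mul, ← integral_add i1 i2]
  exact integral_mono hi (i1.add i2) hle

theorem LawConditions.memLp_effInfluence (hP : LawConditions P w e c)
    (hr : MemLp (weightedResidual w (outcomeReg P)) 2 P)
    (hm : MemLp (weightedRegression w (outcomeReg P)) 2 P) :
    MemLp (effInfluence w v e P) 2 P := by
  have hi : ∀ k, MemLp (ind k : Obs M X → ℝ) 2 P := fun k =>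
    MemLp.of_bound (measurable_ind k).aestronglyMeasurable 1 (Eventually.of_forall (abs_ind_le k))
  refine memLp_finsetSum _ fun k _ => ?_
  have h1 := (hP.memLp_ind_mul_aipwObs (measurable_outcomeReg P) hr hm k).1
  exact ((h1.sub ((hi k).const_mul _)).const_mul _).add
    (((hi k).sub (memLp_const _)).const_mul _)

theorem hasFDerivAt_typeProb {μ : Measure (Obs M X)} {f : (Fin d → ℝ) → Obs M X → ℝ}
    (H : IsQMD P Q η₀ s μ f) (k : Fin K) :
    HasFDerivAt (fun η => typeProb (Q η) k) (∑ j, (∫ o, ind k o * s o j ∂P) •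
      ContinuousLinearMap.proj (R := ℝ) (φ := fun _ : Fin d => ℝ) j) η₀ := by
  simp_rw [← integral_ind]
  refine H.hasFDerivAt_integral (C := 1) (measurable_ind k) ?_
  filter_upwards [H.isProb] with η h
  have h1 : MemLp (ind k : Obs M X → ℝ) 2 (Q η) :=
    MemLp.of_bound (measurable_ind k).aestronglyMeasurable 1 (Eventually.of_forall (abs_ind_le k))
  refine ⟨h1, ?_⟩
  calc ∫ o, ind k o ^ 2 ∂Q η ≤ ∫ _, (1 : ℝ) ∂Q η :=
        integral_mono h1.integrable_sq (integrable_const _) fun o =>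
          (sq_le_one_iff_abs_le_one _).2 (abs_ind_le k o)
    _ = 1 := by simp

/-- Derivative of `pr(L = k) θₖ` along a regular submodel. -/
theorem LawConditions.hasFDerivAt_typeProb_mul_typeMean (hP : LawConditions P w e c)
    (hQ : IsRegularSubmodel (modelNP w c) (momentFunctions w P) P Q η₀ s)
    {μ : Measure (Obs M X)} {f : (Fin d → ℝ) → Obs M X → ℝ} (H : IsQMD P Q η₀ s μ f) (k : Fin K) :
    HasFDerivAt (fun η => typeProb (Q η) k * typeMean w (Q η) k)
      (∑ j, (∫ o, ind k o * aipwObs w (outcomeReg P) e o * s o j ∂P) •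
        ContinuousLinearMap.proj (R := ℝ) (φ := fun _ : Fin d => ℝ) j) η₀ := by
  set g := outcomeReg P with hg
  have hgm : ∀ k a, Measurable (g k a) := measurable_outcomeReg P
  have hrm := measurable_weightedResidual hP.weight_measurable hgm
  have hmm := measurable_weightedRegression hP.weight_measurable hgm
  obtain ⟨C₁, hC₁⟩ := hQ.moments_bounded _ (Or.inl rfl)
  obtain ⟨C₂, hC₂⟩ := hQ.moments_bounded _ (Or.inr rfl)
  have hr : ∀ᶠ η in 𝓝 η₀, MemLp (weightedResidual w g) 2 (Q η) ∧
      ∫ o, weightedResidual w g o ^ 2 ∂Q η ≤ C₁ := hC₁.mono fun η h => memLp_of_lintegral_le hrm h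
  have hm : ∀ᶠ η in 𝓝 η₀, MemLp (weightedRegression w g) 2 (Q η) ∧
      ∫ o, weightedRegression w g o ^ 2 ∂Q η ≤ C₂ := hC₂.mono fun η h => memLp_of_lintegral_le hmm h
  have hrP := hr.self_of_nhds
  rw [hQ.at_center] at hrP
  have hF : ∀ᶠ η in 𝓝 η₀, MemLp (fun o => ind k o * aipwObs w g e o) 2 (Q η) ∧
      ∫ o, (ind k o * aipwObs w g e o) ^ 2 ∂Q η ≤ 2 * (c ^ 2)⁻¹ * C₁ + 2 * C₂ := by
    filter_upwards [hr, hm] with η h1 h2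
    obtain ⟨h3, h4⟩ := hP.memLp_ind_mul_aipwObs hgm h1.1 h2.1 k
    refine ⟨h3, h4.trans ?_⟩
    have := hP.c_pos
    gcongr
    · exact h1.2
    · exact h2.2
  have d1 := H.hasFDerivAt_integral (F := fun o => ind k o * aipwObs w g e o)
    ((measurable_ind k).mul
    (measurable_aipwObs hP.weight_measurable hgm hP.prop_measurable)) hF
  have htm : ∀ η, Measurable fun o : Obs M X => invPropDiff (Q η) e c k o.1 o.2.2.1 o.2.2.2 :=
    fun η => measurable_obs_prop (measurable_invPropDiff hP (Q η) k)
  have htB : ∀ η (o : Obs M X), |invPropDiff (Q η) e c k o.1 o.2.2.1 o.2.2.2| ≤ c⁻¹ :=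
    fun η o => (abs_invPropDiff_le hP _ _ _ _ _).1
  have h0 : ∀ η, ∫ o, weightedResidual w g o * invPropDiff (Q η) e c k o.1 o.2.2.1 o.2.2.2 ∂P = 0 :=
    fun η => integral_weightedResidual_mul P hP.moments
      ((by simpa only [mul_comm] using (memLp_bdd_mul (htm η) (htB η) hrP.1) : MemLp _ 2 P).integrable
        (by norm_num))
  -- The correction for using the true propensity score in place of that of `Q η` has derivative
  -- zero. This is why an unknown propensity score leaves the gradient unchanged.
  have d2 : HasFDerivAt (fun η => ∫ o, weightedResidual w g o *
      invPropDiff (Q η) e c k o.1 o.2.2.1 o.2.2.2 ∂Q η) (0 : (Fin d → ℝ) →L[ℝ] ℝ) η₀ := by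
    rw [hasFDerivAt_iff_isLittleO]
    simp only [hQ.at_center]
    have := h0 η₀
    simp only [hQ.at_center] at this
    simp only [this, sub_zero, _root_.zero_apply]
    exact H.isLittleO_integral_mul hrm hr hrP.1 hrP.2 htm htB
      (tendsto_integral_abs_invPropDiff hP H k) h0
  have d3 := d1.fun_add d2
  rw [add_zero] at d3
  refine d3.congr_of_eventuallyEq ?_
  filter_upwards [hr, hm, hF, hQ.mem_model] with η h1 h2 h3 h4
  have hprob := h4.1
  rw [typeProb_mul_typeMean hP.c_pos h4 h1.1 h2.1, ← integral_add]
  · refine integral_congr_ae (Eventually.of_forall fun o => ?_)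
    obtain ⟨j, o⟩ := o
    by_cases hj : j = k
    · simp only [ind, aipwObs, invPropDiff, hj, if_true]
      ring
    · simp [ind, invPropDiff, hj]
  · exact h3.1.integrable (by norm_num)
  · exact (by simpa only [mul_comm] using (memLp_bdd_mul (htm η) (htB η) h1.1) :
      MemLp _ 2 (Q η)).integrable (by norm_num)

/-- The estimand is differentiable along regular submodels of the nonparametric model, and its
gradient is the covariance of the score with the efficient influence function. -/
theorem LawConditions.hasFDerivAt_estimand (hP : LawConditions P w e c)
    (hv : ∀ k, ContDiffOn ℝ 1 (v k) (Set.Ioc 0 1))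
    (hQ : IsRegularSubmodel (modelNP w c) (momentFunctions w P) P Q η₀ s) :
    HasFDerivAt (fun η => estimand w v (Q η)) (∑ j, (∫ o, effInfluence w v e P o * s o j ∂P) •
      ContinuousLinearMap.proj (R := ℝ) (φ := fun _ : Fin d => ℝ) j) η₀ := by
  obtain ⟨μ, f, H⟩ := hQ.isQMD
  have hp := fun k => hasFDerivAt_typeProb H k
  have hN := fun k => hP.hasFDerivAt_typeProb_mul_typeMean hQ H k
  have hp0 : ∀ k, typeProb (Q η₀) k = typeProb P k := fun k => by rw [hQ.at_center]
  have hpos : ∀ k, ∀ᶠ η in 𝓝 η₀, 0 < typeProb (Q η) k := fun k =>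
    (hp k).continuousAt.eventually_const_lt (by simpa only [hp0] using hP.typeProb_pos k)
  have hIoc : ∀ k, {η | typeProb (Q η) k ∈ Set.Ioc (0 : ℝ) 1} ∈ 𝓝 η₀ := fun k => by
    filter_upwards [hpos k, H.isProb] with η h1 h2
    exact ⟨h1, measureReal_le_one⟩
  have hvd : ∀ k, HasFDerivAt (fun η => v k (typeProb (Q η) k))
      (weightDeriv v P k • ∑ j, (∫ o, ind k o * s o j ∂P) •
        ContinuousLinearMap.proj (R := ℝ) (φ := fun _ : Fin d => ℝ) j) η₀ := fun k => by
    have hmem : typeProb P k ∈ Set.Ioc (0 : ℝ) 1 := ⟨hP.typeProb_pos k, measureReal_le_one⟩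
    -- The derivative within `(0, 1]` suffices because the type probabilities stay in that interval
    -- near `η₀`; at `pr(L = k) = 1` nothing is known about `v k` to the right.
    have h1 : HasDerivWithinAt (v k) (weightDeriv v P k) (Set.Ioc 0 1) (typeProb (Q η₀) k) := by
      rw [hp0]
      exact (((hv k).differentiableOn (by norm_num)) _ hmem).hasDerivWithinAt
    have h2 := h1.comp_hasFDerivWithinAt η₀ ((hp k).hasFDerivWithinAt
      (s := {η | typeProb (Q η) k ∈ Set.Ioc (0 : ℝ) 1})) (fun η h => h)
    exact h2.hasFDerivAt (hIoc k)
  have hinv : ∀ k, HasFDerivAt (fun η => (typeProb (Q η) k)⁻¹)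
      (-(typeProb P k ^ 2)⁻¹ • ∑ j, (∫ o, ind k o * s o j ∂P) •
        ContinuousLinearMap.proj (R := ℝ) (φ := fun _ : Fin d => ℝ) j) η₀ := fun k => by
    have h1 := hasDerivAt_inv (𝕜 := ℝ) (x := typeProb (Q η₀) k)
      (by rw [hp0]; exact (hP.typeProb_pos k).ne')
    have h2 := h1.comp_hasFDerivAt η₀ (hp k)
    rw [hp0] at h2
    exact h2
  have htot := HasFDerivAt.fun_sum fun k (_ : k ∈ Finset.univ) =>
    (hvd k).fun_mul ((hN k).fun_mul (hinv k))
  -- The derivative is known for `pr(L = k) θₖ` and not for `θₖ`, so the latter is written as a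
  -- quotient.
  have hfun : (fun η => estimand w v (Q η)) =ᶠ[𝓝 η₀] fun η => ∑ k, v k (typeProb (Q η) k) *
      (typeProb (Q η) k * typeMean w (Q η) k * (typeProb (Q η) k)⁻¹) := by
    filter_upwards [eventually_all.2 hpos] with η h
    refine Finset.sum_congr rfl fun k _ => ?_
    rw [mul_comm (typeProb (Q η) k), mul_inv_cancel_right₀ (h k).ne']
    rfl
  refine (htot.congr_of_eventuallyEq hfun).congr_fderiv ?_
  have hrm := measurable_weightedResidual hP.weight_measurable (measurable_outcomeReg P)
  have hmm := measurable_weightedRegression hP.weight_measurable (measurable_outcomeReg P)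
  obtain ⟨C₁, hC₁⟩ := hQ.moments_bounded _ (Or.inl rfl)
  obtain ⟨C₂, hC₂⟩ := hQ.moments_bounded _ (Or.inr rfl)
  have hr := hC₁.self_of_nhds
  have hm := hC₂.self_of_nhds
  rw [hQ.at_center] at hr hm
  have hrL := (memLp_of_lintegral_le hrm hr).1
  have hmL := (memLp_of_lintegral_le hmm hm).1
  have hiL : ∀ k, MemLp (ind k : Obs M X → ℝ) 2 P := fun k =>
    MemLp.of_bound (measurable_ind k).aestronglyMeasurable 1 (Eventually.of_forall (abs_ind_le k))
  have hD : ∀ j, ∫ o, effInfluence w v e P o * s o j ∂P =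
      ∑ k, (v k (typeProb P k) / typeProb P k *
        ((∫ o, ind k o * aipwObs w (outcomeReg P) e o * s o j ∂P) -
          typeMean w P k * ∫ o, ind k o * s o j ∂P) +
        weightDeriv v P k * typeMean w P k * ∫ o, ind k o * s o j ∂P) := by
    intro j
    have i1 : ∀ k, Integrable (fun o => ind k o * aipwObs w (outcomeReg P) e o * s o j) P :=
      fun k => integrable_mul_of_memLp (hP.memLp_ind_mul_aipwObs (measurable_outcomeReg P) hrL hmL k).1
        (H.score_memLp j)
    have i2 : ∀ k, Integrable (fun o => ind k o * s o j) P := fun k =>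
      integrable_mul_of_memLp (hiL k) (H.score_memLp j)
    have i3 : Integrable (fun o => s o j) P := (H.score_memLp j).integrable (by norm_num)
    have e1 : ∀ o, effInfluence w v e P o * s o j = ∑ k, (v k (typeProb P k) / typeProb P k *
        (ind k o * aipwObs w (outcomeReg P) e o * s o j - typeMean w P k * (ind k o * s o j)) +
        weightDeriv v P k * typeMean w P k * (ind k o * s o j - typeProb P k * s o j)) := by
      intro o
      rw [effInfluence, Finset.sum_mul]
      exact Finset.sum_congr rfl fun k _ => by ring
    simp_rw [e1]
    have j1 : ∀ k, Integrable (fun o => v k (typeProb P k) / typeProb P k *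
        (ind k o * aipwObs w (outcomeReg P) e o * s o j - typeMean w P k * (ind k o * s o j))) P :=
      fun k => ((i1 k).sub ((i2 k).const_mul (typeMean w P k))).const_mul _
    have j2 : ∀ k, Integrable (fun o => weightDeriv v P k * typeMean w P k *
        (ind k o * s o j - typeProb P k * s o j)) P :=
      fun k => ((i2 k).sub (i3.const_mul (typeProb P k))).const_mul _
    -- The centring of the type indicators contributes nothing, since scores have mean zero.
    rw [integral_finsetSum _ fun k _ => by exact (j1 k).add (j2 k)]
    refine Finset.sum_congr rfl fun k _ => ?_
    rw [integral_add (j1 k) (j2 k), integral_const_mul, integral_const_mul,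
      integral_sub (i1 k) ((i2 k).const_mul _), integral_sub (i2 k) (i3.const_mul _),
      integral_const_mul, integral_const_mul, H.integral_score, mul_zero, sub_zero]
  refine ContinuousLinearMap.ext fun h => ?_
  simp only [hD, _root_.sum_apply, _root_.smul_apply, _root_.add_apply,
    ContinuousLinearMap.proj_apply, smul_eq_mul, hQ.at_center]
  simp only [Finset.sum_mul]
  rw [Finset.sum_comm]
  refine Finset.sum_congr rfl fun k _ => ?_
  have e2 : ∀ j, (v k (typeProb P k) / typeProb P k *
        ((∫ o, ind k o * aipwObs w (outcomeReg P) e o * s o j ∂P) -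
          typeMean w P k * ∫ o, ind k o * s o j ∂P) +
        weightDeriv v P k * typeMean w P k * ∫ o, ind k o * s o j ∂P) * h j =
      v k (typeProb P k) / typeProb P k *
        ((∫ o, ind k o * aipwObs w (outcomeReg P) e o * s o j ∂P) * h j) +
      (weightDeriv v P k * typeMean w P k - v k (typeProb P k) / typeProb P k * typeMean w P k) *
        ((∫ o, ind k o * s o j ∂P) * h j) := fun j => by ring
  simp_rw [e2]
  rw [Finset.sum_add_distrib, ← Finset.mul_sum, ← Finset.mul_sum]
  have := (hP.typeProb_pos k).ne'
  field_simp
  ring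

end Pathwise

/-! ### Tilted laws -/

section Tilt

variable {β α γ : Type*} [MeasurableSpace β] [StandardBorelSpace β] [Nonempty β]
  [MeasurableSpace α] [MeasurableSingletonClass α] [Fintype α] [Nonempty α] [MeasurableSpace γ]
  {ν : Measure (β × α × γ)} [IsFiniteMeasure ν]

/-- Density of a tilt: `u` has conditional mean zero given treatment and covariates, and `z`
depends on the covariates. -/
structure IsTilt (ν : Measure (β × α × γ)) [IsFiniteMeasure ν] (u : β × α × γ → ℝ) (z : γ → ℝ) :
    Prop where
  measurable_u : Measurable u
  measurable_z : Measurable z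
  abs_u_le : ∀ o, |u o| ≤ 1 / 4
  abs_z_le : ∀ x, |z x| ≤ 1 / 4
  integral_u : ∀ p, ∫ y, u (y, p) ∂respKernel ν p = 0

/-- The tilted law, up to a constant. -/
def tilted (ν : Measure (β × α × γ)) (u : β × α × γ → ℝ) (z : γ → ℝ) (C : ℝ≥0∞) :
    Measure (β × α × γ) := C • ν.withDensity fun o => ENNReal.ofReal (1 + u o + z o.2.2)

variable {u : β × α × γ → ℝ} {z : γ → ℝ} {C : ℝ≥0∞}

theorem lintegral_tilted (h : IsTilt ν u z) {f : β × α × γ → ℝ≥0∞} (hf : Measurable f) :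
    ∫⁻ o, f o ∂tilted ν u z C =
      C * ∫⁻ p, ∫⁻ y, f (y, p) * ENNReal.ofReal (1 + u (y, p) + z p.2) ∂respKernel ν p
        ∂trtCovLaw ν := by
  have := h.measurable_u
  have := h.measurable_z
  rw [tilted, lintegral_smul_measure, smul_eq_mul, lintegral_withDensity_eq_lintegral_mul _
    (by fun_prop) hf, lintegral_resp (by fun_prop)]
  congr 1
  refine lintegral_congr fun p => lintegral_congr fun y => ?_
  rw [Pi.mul_apply, mul_comm]

/-- Since `u` is conditionally centred, it disappears on integrating out the response, and only `1 +
z` acts on treatment and covariates. The bounds `1/4` keep the density positive, so it may be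
integrated as a real function. -/
theorem lintegral_tilt_resp (h : IsTilt ν u z) (p : α × γ) :
    ∫⁻ y, ENNReal.ofReal (1 + u (y, p) + z p.2) ∂respKernel ν p = ENNReal.ofReal (1 + z p.2) := by
  have hu := h.measurable_u
  have i1 : Integrable (fun y => u (y, p)) (respKernel ν p) :=
    Integrable.of_bound (hu.comp measurable_prodMk_right).aestronglyMeasurable (1 / 4)
      (Eventually.of_forall fun y => h.abs_u_le _)
  have i2 : Integrable (fun y => 1 + u (y, p)) (respKernel ν p) := (integrable_const _).add i1
  rw [← ofReal_integral_eq_lintegral_ofReal]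
  · congr 1
    rw [integral_add i2 (integrable_const _), integral_add (integrable_const _) i1, h.integral_u]
    simp
  · exact i2.add (integrable_const _)
  · refine Eventually.of_forall fun y => ?_
    have h1 := abs_le.1 (h.abs_u_le (y, p))
    have h2 := abs_le.1 (h.abs_z_le p.2)
    simp only [Pi.zero_apply]
    linarith

theorem isFiniteMeasure_tilted (h : IsTilt ν u z) (hC : C ≠ ∞) :
    IsFiniteMeasure (tilted ν u z C) := by
  refine ⟨?_⟩
  rw [← lintegral_one, lintegral_tilted h measurable_const]
  simp only [one_mul]
  simp_rw [lintegral_tilt_resp h]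
  refine ENNReal.mul_lt_top hC.lt_top ?_
  calc _ ≤ ∫⁻ _, ENNReal.ofReal 2 ∂trtCovLaw ν := lintegral_mono fun p =>
        ENNReal.ofReal_le_ofReal (by have := abs_le.1 (h.abs_z_le p.2); linarith)
    _ < ∞ := by
        rw [lintegral_const]
        exact ENNReal.mul_lt_top ENNReal.ofReal_lt_top (measure_lt_top _ _)

theorem lintegral_trtCovLaw_tilted (h : IsTilt ν u z) {f : α × γ → ℝ≥0∞} (hf : Measurable f) :
    ∫⁻ p, f p ∂trtCovLaw (tilted ν u z C) =
      C * ∫⁻ p, f p * ENNReal.ofReal (1 + z p.2) ∂trtCovLaw ν := by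
  have hu := h.measurable_u
  rw [lintegral_map hf (by fun_prop), lintegral_tilted h (by fun_prop)]
  congr 1
  refine lintegral_congr fun p => ?_
  simp only
  rw [lintegral_const_mul _ (by fun_prop), lintegral_tilt_resp h]

theorem lintegral_covMarginal_tilted (h : IsTilt ν u z) {f : γ → ℝ≥0∞} (hf : Measurable f) :
    ∫⁻ x, f x ∂covMarginal (tilted ν u z C) =
      C * ∫⁻ x, f x * ENNReal.ofReal (1 + z x) ∂covMarginal ν := by
  have hz := h.measurable_z
  have h1 := lintegral_trtCovLaw_tilted (C := C) h (f := fun p => f p.2) (by fun_prop)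
  rw [lintegral_map (by fun_prop) (by fun_prop), lintegral_map (by fun_prop) (by fun_prop)] at h1
  rw [lintegral_map hf (by fun_prop), lintegral_map (by fun_prop) (by fun_prop), h1]

theorem covMarginal_tilted_le (h : IsTilt ν u z) :
    covMarginal (tilted ν u z C) ≤ (C * 2) • covMarginal ν := by
  refine Measure.le_iff.2 fun s hs => ?_
  rw [← lintegral_indicator_one hs, lintegral_covMarginal_tilted h (by fun_prop), Measure.smul_apply,
    smul_eq_mul, mul_assoc]
  gcongr
  rw [← lintegral_indicator_one hs, ← lintegral_const_mul _ (by fun_prop)]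
  refine lintegral_mono fun x => ?_
  rw [mul_comm]
  gcongr
  rw [← ENNReal.ofReal_ofNat]
  exact ENNReal.ofReal_le_ofReal (by have := abs_le.1 (h.abs_z_le x); linarith)

theorem covMarginal_tilted_absolutelyContinuous (h : IsTilt ν u z) :
    covMarginal (tilted ν u z C) ≪ covMarginal ν :=
  (Measure.absolutelyContinuous_of_le (covMarginal_tilted_le h)).trans
    (Measure.AbsolutelyContinuous.smul_left Measure.AbsolutelyContinuous.rfl _)

/-- The marginal density factor `1 + z` depends on the covariates alone and cancels on conditioning
on them. This keeps tilted laws inside the model with known propensity score. -/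
theorem trtKernel_tilted (h : IsTilt ν u z) [IsFiniteMeasure (tilted ν u z C)] :
    trtKernel (tilted ν u z C) =ᵐ[covMarginal (tilted ν u z C)] trtKernel ν := by
  have hz := h.measurable_z
  refine condDistrib_ae_eq_of_measure_eq_compProd_of_measurable (by fun_prop) (by fun_prop) ?_
  refine Measure.ext_of_lintegral _ fun f hf => ?_
  rw [Measure.lintegral_compProd hf]
  have e1 : ∫⁻ q, f q ∂(tilted ν u z C).map (fun o => (o.2.2, o.2.1)) =
      ∫⁻ p, f p.swap ∂trtCovLaw (tilted ν u z C) := by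
    rw [lintegral_map hf (by fun_prop), lintegral_map (by fun_prop) (by fun_prop)]
    rfl
  rw [e1, lintegral_trtCovLaw_tilted h (by fun_prop), lintegral_trtCovLaw (by fun_prop)]
  refine Eq.trans ?_ (lintegral_covMarginal_tilted h hf.lintegral_kernel_prod_right').symm
  congr 1
  refine lintegral_congr fun x => ?_
  rw [lintegral_fintype, Finset.sum_mul]
  exact Finset.sum_congr rfl fun a _ => by simp only [Prod.swap]; ring

/-- Conditional density of the response in the tilted law. -/
def tiltRespDensity (u : β × α × γ → ℝ) (z : γ → ℝ) (p : α × γ) (y : β) : ℝ≥0∞ :=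
  ENNReal.ofReal ((1 + u (y, p) + z p.2) / (1 + z p.2))

theorem measurable_tiltRespDensity (h : IsTilt ν u z) :
    Measurable (Function.uncurry (tiltRespDensity u z)) := by
  have hu := h.measurable_u
  have hz := h.measurable_z
  unfold tiltRespDensity Function.uncurry
  fun_prop

theorem tiltRespDensity_le (h : IsTilt ν u z) (p : α × γ) (y : β) :
    tiltRespDensity u z p y ≤ 2 := by
  have h1 := abs_le.1 (h.abs_u_le (y, p))
  have h2 := abs_le.1 (h.abs_z_le p.2)
  rw [tiltRespDensity, ← ENNReal.ofReal_ofNat]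
  refine ENNReal.ofReal_le_ofReal ?_
  rw [div_le_iff₀ (by linarith)]
  linarith

/-- Bayes' rule: the conditional density is `1 + u + z` divided by its integral `1 + z` over the
response. -/
theorem respKernel_tilted (h : IsTilt ν u z) [IsFiniteMeasure (tilted ν u z C)] :
    respKernel (tilted ν u z C) =ᵐ[trtCovLaw (tilted ν u z C)]
      (respKernel ν).withDensity (tiltRespDensity u z) := by
  have hu := h.measurable_u
  have hz := h.measurable_z
  have hm := measurable_tiltRespDensity h
  have : IsFiniteKernel ((respKernel ν).withDensity (tiltRespDensity u z)) :=
    Kernel.isFiniteKernel_withDensity_of_bounded _ (B := 2) (by simp) (tiltRespDensity_le h)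
  refine condDistrib_ae_eq_of_measure_eq_compProd_of_measurable (by fun_prop) (by fun_prop) ?_
  refine Measure.ext_of_lintegral _ fun f hf => ?_
  rw [Measure.lintegral_compProd hf, lintegral_map hf (by fun_prop), lintegral_tilted h (by fun_prop)]
  refine Eq.trans ?_ (lintegral_trtCovLaw_tilted h hf.lintegral_kernel_prod_right').symm
  congr 1
  refine lintegral_congr fun p => ?_
  have hmp : Measurable (tiltRespDensity u z p) := hm.comp measurable_prodMk_left
  rw [Kernel.withDensity_apply _ hm, lintegral_withDensity_eq_lintegral_mul _ hmp (by fun_prop),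
    ← lintegral_mul_const _ (by fun_prop)]
  refine lintegral_congr fun y => ?_
  have h2 := abs_le.1 (h.abs_z_le p.2)
  simp only [Pi.mul_apply, tiltRespDensity]
  rw [mul_comm (ENNReal.ofReal _) (f _), mul_assoc, ← ENNReal.ofReal_mul' (by linarith),
    div_mul_cancel₀ _ (by linarith)]

/-- The conditional density is at most 2. Passing from the joint law of treatment and covariates to
each arm uses positivity, which survives the tilt because the propensity score does. -/
theorem respKernel_tilted_le (h : IsTilt ν u z) [IsFiniteMeasure (tilted ν u z C)]
    (hpos : ∀ a, ∀ᵐ x ∂covMarginal ν, 0 < (trtKernel ν x).real {a}) (a : α) :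
    ∀ᵐ x ∂covMarginal (tilted ν u z C),
      respKernel (tilted ν u z C) (a, x) ≤ (2 : ℝ≥0∞) • respKernel ν (a, x) := by
  refine ae_of_ae_trtCovLaw (S := fun p => respKernel (tilted ν u z C) p ≤
    (2 : ℝ≥0∞) • respKernel ν p) ?_ ?_ a
  · filter_upwards [respKernel_tilted h] with p hp
    rw [hp, Kernel.withDensity_apply _ (measurable_tiltRespDensity h), ← withDensity_const]
    exact withDensity_mono (Eventually.of_forall (tiltRespDensity_le h p))
  · intro b
    filter_upwards [trtKernel_tilted h,
      (covMarginal_tilted_absolutelyContinuous h).ae_le (hpos b)] with x h1 h2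
    rw [h1]
    exact h2

end Tilt

/-! ### Moments under a dominated conditional law -/

section Dominated

variable {𝓞 : Type*} [MeasurableSpace 𝓞] {κ κ' : Measure 𝓞} [IsProbabilityMeasure κ]
  [IsProbabilityMeasure κ']

theorem MemLp.of_le_two_smul {f : 𝓞 → ℝ} {p : ℝ≥0∞} (hle : κ' ≤ (2 : ℝ≥0∞) • κ)
    (h : MemLp f p κ) : MemLp f p κ' :=
  h.of_measure_le_smul (by simp) hle

theorem integral_sq_le_two_mul (hle : κ' ≤ (2 : ℝ≥0∞) • κ) {f : 𝓞 → ℝ}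
    (h : MemLp f 2 κ) : ∫ y, f y ^ 2 ∂κ' ≤ 2 * ∫ y, f y ^ 2 ∂κ := by
  have h1 := integral_mono_measure hle (Eventually.of_forall fun y => sq_nonneg (f y))
    (h.integrable_sq.smul_measure (by simp))
  rw [integral_smul_measure] at h1
  simpa using h1

/-- Use `|f| ≤ 1 + f²` and domination. The bound is linear in the second moment under `κ`, so it can
be integrated over the covariates when only conditional second moments are known to be integrable.
-/
theorem abs_integral_le_one_add (hle : κ' ≤ (2 : ℝ≥0∞) • κ) {f : 𝓞 → ℝ}
    (h : MemLp f 2 κ) : |∫ y, f y ∂κ'| ≤ 1 + 2 * ∫ y, f y ^ 2 ∂κ := by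
  have h' := MemLp.of_le_two_smul hle h
  refine (abs_integral_le_integral_abs).trans ?_
  calc ∫ y, |f y| ∂κ' ≤ ∫ y, (1 + f y ^ 2) ∂κ' := by
        refine integral_mono (h'.integrable (by norm_num)).abs
          ((integrable_const _).add h'.integrable_sq) fun y => ?_
        simp only
        nlinarith [sq_abs (f y), sq_nonneg (|f y| - 1)]
    _ = 1 + ∫ y, f y ^ 2 ∂κ' := by
        rw [integral_add (integrable_const _) h'.integrable_sq]
        simp
    _ ≤ _ := by linarith [integral_sq_le_two_mul hle h]

/-- Expanding about the mean `t`, the right side exceeds the left by `(t - b)²`. It serves both for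
variances under a tilt and to see that centring an approximant does not move it away from a centred
target. -/
theorem integral_sub_mean_sq_le {f : 𝓞 → ℝ} (h : MemLp f 2 κ') (b : ℝ) :
    ∫ y, (f y - ∫ y, f y ∂κ') ^ 2 ∂κ' ≤ ∫ y, (f y - b) ^ 2 ∂κ' := by
  set t := ∫ y, f y ∂κ'
  have h1 := h.integrable (by norm_num)
  have i1 : Integrable (fun y => (f y - b) ^ 2) κ' := (h.sub (memLp_const b)).integrable_sq
  have i2 : Integrable (fun y => 2 * (t - b) * (f y - b)) κ' :=
    (h1.sub (integrable_const b)).const_mul _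
  have e1 : ∀ y, (f y - t) ^ 2 = (f y - b) ^ 2 - 2 * (t - b) * (f y - b) + (t - b) ^ 2 :=
    fun y => by ring
  have i3 : Integrable (fun y => (f y - b) ^ 2 - 2 * (t - b) * (f y - b)) κ' := i1.sub i2
  simp_rw [e1]
  rw [integral_add i3 (integrable_const _), integral_sub i1 i2, integral_const_mul,
    integral_sub h1 (integrable_const _)]
  simp only [integral_const, probReal_univ, smul_eq_mul, one_mul]
  change _ - 2 * (t - b) * (t - b) + _ ≤ _
  nlinarith [sq_nonneg (t - b)]

/-- Bound the product by half the sum of squares, replace the means under `κ'` by those under `κ`,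
and use domination; its factor 2 cancels the half. -/
theorem abs_cov_le {m : ℕ} {κ κ' : Measure (Fin m → ℝ)} [IsProbabilityMeasure κ]
    [IsProbabilityMeasure κ'] (hle : κ' ≤ (2 : ℝ≥0∞) • κ) (h : ∀ j, MemLp (fun y : Fin m → ℝ => y j) 2 κ)
    (i j : Fin m) :
    |∫ y, (y i - ∫ y, y i ∂κ') * (y j - ∫ y, y j ∂κ') ∂κ'| ≤
      ∫ y, (y i - ∫ y, y i ∂κ) * (y i - ∫ y, y i ∂κ) ∂κ +
        ∫ y, (y j - ∫ y, y j ∂κ) * (y j - ∫ y, y j ∂κ) ∂κ := by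
  have h' := fun j => MemLp.of_le_two_smul hle (h j)
  have hm : ∀ j, MemLp (fun y : Fin m → ℝ => y j - ∫ y, y j ∂κ') 2 κ' := fun j =>
    (h' j).sub (memLp_const _)
  have hm' : ∀ j, MemLp (fun y : Fin m → ℝ => y j - ∫ y, y j ∂κ) 2 κ := fun j =>
    (h j).sub (memLp_const _)
  have hv : ∀ j, ∫ y, (y j - ∫ y, y j ∂κ') ^ 2 ∂κ' ≤ 2 * ∫ y, (y j - ∫ y, y j ∂κ) ^ 2 ∂κ :=
    fun j => (integral_sub_mean_sq_le (h' j) _).trans (integral_sq_le_two_mul hle (hm' j))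
  simp only [← sq]
  refine (abs_integral_le_integral_abs).trans ?_
  calc _ ≤ ∫ y, (1 / 2 * (y i - ∫ y, y i ∂κ') ^ 2 + 1 / 2 * (y j - ∫ y, y j ∂κ') ^ 2) ∂κ' := by
        refine integral_mono (integrable_mul_of_memLp (hm i) (hm j)).abs
          (((hm i).integrable_sq.const_mul _).add ((hm j).integrable_sq.const_mul _)) fun y => ?_
        simp only
        rw [abs_le]
        constructor <;>
        nlinarith [sq_nonneg ((y i - ∫ y, y i ∂κ') - (y j - ∫ y, y j ∂κ')),
          sq_nonneg ((y i - ∫ y, y i ∂κ') + (y j - ∫ y, y j ∂κ'))]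
    _ = 1 / 2 * ∫ y, (y i - ∫ y, y i ∂κ') ^ 2 ∂κ' + 1 / 2 * ∫ y, (y j - ∫ y, y j ∂κ') ^ 2 ∂κ' := by
        rw [integral_add ((hm i).integrable_sq.const_mul _) ((hm j).integrable_sq.const_mul _),
          integral_const_mul, integral_const_mul]
    _ ≤ _ := by linarith [hv i, hv j]

end Dominated

/-! ### Tilts of the observed-data law -/

section TypeTilt

variable {α γ : Type*} [MeasurableSpace α] [MeasurableSingletonClass α] [Fintype α] [Nonempty α]
  [MeasurableSpace γ] {m : ℕ} {ν : Measure ((Fin m → ℝ) × α × γ)} [IsFiniteMeasure ν]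
  {u : (Fin m → ℝ) × α × γ → ℝ} {z : γ → ℝ} {C : ℝ≥0∞} [IsFiniteMeasure (tilted ν u z C)]

theorem integrable_covMarginal_tilted (h : IsTilt ν u z) (hC : C ≠ ∞) {f : γ → ℝ}
    (hf : Integrable f (covMarginal ν)) : Integrable f (covMarginal (tilted ν u z C)) :=
  (hf.smul_measure (ENNReal.mul_ne_top hC (by simp))).mono_measure (covMarginal_tilted_le h)

theorem stronglyMeasurable_respMean_apply (ν : Measure ((Fin m → ℝ) × α × γ)) [IsFiniteMeasure ν]
    (j : Fin m) : StronglyMeasurable fun p : α × γ => respMean ν p.1 p.2 j :=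
  stronglyMeasurable_integral_resp (f := fun o : (Fin m → ℝ) × α × γ => o.1 j) (by fun_prop)

theorem measurable_respMean (ν : Measure ((Fin m → ℝ) × α × γ)) [IsFiniteMeasure ν] (a : α) :
    Measurable (respMean ν a) :=
  measurable_pi_lambda _ fun j =>
    (stronglyMeasurable_respMean_apply ν j).measurable.comp measurable_prodMk_left

/-- The tilted weighted regression differs from the original one by the tilted conditional mean of
the weighted residual, which is at most one plus twice its original conditional second moment. -/
theorem integrable_weighted_respMean_tilted (h : IsTilt ν u z) (hC : C ≠ ∞)
    {ν' : Measure ((Fin m → ℝ) × α × γ)} [IsFiniteMeasure ν'] (hν' : ν' = tilted ν u z C)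
    (hpos : ∀ a, ∀ᵐ x ∂covMarginal ν, 0 < (trtKernel ν x).real {a}) {a : α}
    (hL : ∀ᵐ x ∂covMarginal ν, ∀ j, MemLp (fun y : Fin m → ℝ => y j) 2 (respKernel ν (a, x)))
    {w : γ → Fin m → ℝ} (hw : Measurable w)
    (hwg : Integrable (fun x => w x ⬝ᵥ respMean ν a x) (covMarginal ν))
    (hv : Integrable (fun x => ∫ y, (w x ⬝ᵥ (y - respMean ν a x)) ^ 2 ∂respKernel ν (a, x))
      (covMarginal ν)) :
    Integrable (fun x => w x ⬝ᵥ respMean ν' a x) (covMarginal ν') := by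
  subst hν'
  have hac := (covMarginal_tilted_absolutelyContinuous (C := C) h).ae_le
  have h1 := integrable_covMarginal_tilted (C := C) h hC hwg
  have h2 := ((integrable_const (1 : ℝ)).add (hv.const_mul 2))
  have h3 := h1.norm.add (integrable_covMarginal_tilted (C := C) h hC h2)
  refine h3.mono' (measurable_dotProduct hw (measurable_respMean _ a)).aestronglyMeasurable ?_
  filter_upwards [respKernel_tilted_le (C := C) h hpos a, hac hL] with x hle hx
  have hx' : ∀ j, MemLp (fun y : Fin m → ℝ => y j) 2 (respKernel (tilted ν u z C) (a, x)) :=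
    fun j => MemLp.of_le_two_smul hle (hx j)
  have e1 := (integral_dotProduct_sub (fun j => (hx' j).integrable (by norm_num)) (w x)
    (respMean ν a x)).2
  have hr : MemLp (fun y => w x ⬝ᵥ (y - respMean ν a x)) 2 (respKernel ν (a, x)) :=
    memLp_finsetSum _ fun j _ => ((hx j).sub (memLp_const _)).const_mul _
  have h4 := abs_integral_le_one_add hle hr
  rw [e1] at h4
  have e2 : w x ⬝ᵥ respMean (tilted ν u z C) a x = w x ⬝ᵥ respMean ν a x +
      w x ⬝ᵥ ((fun j => ∫ y, y j ∂respKernel (tilted ν u z C) (a, x)) - respMean ν a x) := by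
    rw [dotProduct_sub]
    change _ = _ + (w x ⬝ᵥ respMean (tilted ν u z C) a x - _)
    ring
  rw [e2]
  refine (norm_add_le _ _).trans ?_
  exact add_le_add le_rfl h4

end TypeTilt

/-! ### Conditioning a reweighted law on the cluster type -/

section ObsTilt

variable {K : ℕ} {α : Fin K → Type*} [∀ k, MeasurableSpace (α k)]

/-- Conditioning restricts the density to the type and changes the normalisation; the constant is
the ratio of the old type probability to the new one. -/
theorem typeLaw_withDensity (P : Measure (Σ k, α k)) [IsFiniteMeasure P] (φ : (Σ k, α k) → ℝ≥0∞)
    (k : Fin K) :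
    typeLaw (P.withDensity φ) k =
      ((P.withDensity φ (Sigma.fst ⁻¹' {k}))⁻¹ * P (Sigma.fst ⁻¹' {k})) •
        (typeLaw P k).withDensity fun y => φ ⟨k, y⟩ := by
  have e := measurableEmbedding_sigmaMk (α := α) k
  rw [mul_smul, ← withDensity_smul_measure, smul_typeLaw, typeLaw]
  congr 1
  ext s hs
  rw [e.comap_apply, withDensity_apply _ (measurableSet_image_sigmaMk k hs),
    withDensity_apply _ hs]
  have h1 : P.restrict (Sigma.mk k '' s) = ((P.comap (Sigma.mk k)).restrict s).map (Sigma.mk k) := by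
    rw [e.restrict_comap, e.map_comap, Measure.restrict_restrict e.measurableSet_range]
    congr 1
    rw [Set.inter_eq_self_of_subset_right (Set.image_subset_range _ _)]
  rw [h1, e.lintegral_map]

end ObsTilt

/-! ### Bounded scores and the model with known propensity score -/

section TiltedLaw

variable {K : ℕ} {M : Fin K → ℕ} {X : Fin K → Type*} [∀ k, MeasurableSpace (X k)]
  {P : Measure (Obs M X)} [IsProbabilityMeasure P] {w : RegFun M X} {e : PropFun M X} {c : ℝ}

/-- `sY(O) + sX(X, L)` is a bounded score of the model with known propensity score: `sY` has
conditional mean zero given treatment and covariates, and `sX` has mean zero. -/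
structure IsBoundedScore (P : Measure (Obs M X)) (sY : Obs M X → ℝ) (sX : ∀ k, X k → ℝ)
    (B : ℝ) : Prop where
  measurable_sY : Measurable sY
  measurable_sX : ∀ k, Measurable (sX k)
  bound_sY : ∀ o, |sY o| ≤ B
  bound_sX : ∀ k x, |sX k x| ≤ B
  integral_sY : ∀ k p, ∫ y, sY ⟨k, y, p⟩ ∂respKernel (typeLaw P k) p = 0
  integral_sX : ∫ o, sX o.1 o.2.2.2 ∂P = 0

/-- The score `sY(O) + sX(X, L)`. -/
def boundedScore (sY : Obs M X → ℝ) (sX : ∀ k, X k → ℝ) (o : Obs M X) : ℝ :=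
  sY o + sX o.1 o.2.2.2

variable {sY : Obs M X → ℝ} {sX : ∀ k, X k → ℝ} {B : ℝ}

theorem IsBoundedScore.measurable_sX_obs (h : IsBoundedScore P sY sX B) :
    Measurable fun o : Obs M X => sX o.1 o.2.2.2 :=
  measurable_of_sigmaMk fun k => (h.measurable_sX k).comp (measurable_snd.comp measurable_snd)

theorem IsBoundedScore.measurable (h : IsBoundedScore P sY sX B) :
    Measurable (boundedScore sY sX) :=
  h.measurable_sY.add h.measurable_sX_obs

theorem IsBoundedScore.abs_le (h : IsBoundedScore P sY sX B) (o : Obs M X) :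
    |boundedScore sY sX o| ≤ 2 * B := by
  have := abs_add_le (sY o) (sX o.1 o.2.2.2)
  have := h.bound_sY o
  have := h.bound_sX o.1 o.2.2.2
  unfold boundedScore
  linarith

theorem IsBoundedScore.integrable_sY (h : IsBoundedScore P sY sX B) : Integrable sY P :=
  Integrable.of_bound h.measurable_sY.aestronglyMeasurable B (Eventually.of_forall h.bound_sY)

theorem IsBoundedScore.integral_sY_eq_zero (h : IsBoundedScore P sY sX B) : ∫ o, sY o ∂P = 0 := by
  rw [integral_sigma P h.integrable_sY]
  refine Finset.sum_eq_zero fun k _ => ?_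
  rw [integral_resp (Integrable.typeLaw P h.integrable_sY k)]
  simp [h.integral_sY k]

theorem IsBoundedScore.integral_eq_zero (h : IsBoundedScore P sY sX B) :
    ∫ o, boundedScore sY sX o ∂P = 0 := by
  have i2 : Integrable (fun o : Obs M X => sX o.1 o.2.2.2) P :=
    Integrable.of_bound h.measurable_sX_obs.aestronglyMeasurable B
      (Eventually.of_forall fun o => h.bound_sX _ _)
  unfold boundedScore
  rw [integral_add h.integrable_sY i2, h.integral_sY_eq_zero, h.integral_sX, add_zero]

/-- The law with density `1 + t s` with respect to `P`, for small `t`. -/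
def tiltDensity (sY : Obs M X → ℝ) (sX : ∀ k, X k → ℝ) (t : ℝ) (o : Obs M X) : ℝ :=
  max (1 + t * boundedScore sY sX o) 0

theorem IsBoundedScore.abs_mul_le (h : IsBoundedScore P sY sX B) {t : ℝ} (ht : |t| * B ≤ 1 / 4)
    (o : Obs M X) : |t * boundedScore sY sX o| ≤ 1 / 2 := by
  rw [abs_mul]
  calc |t| * |boundedScore sY sX o| ≤ |t| * (2 * B) := by gcongr; exact h.abs_le o
    _ ≤ 1 / 2 := by linarith

theorem IsBoundedScore.tiltDensity_eq (h : IsBoundedScore P sY sX B) {t : ℝ}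
    (ht : |t| * B ≤ 1 / 4) (o : Obs M X) :
    tiltDensity sY sX t o = 1 + t * boundedScore sY sX o := by
  have := (_root_.abs_le.1 (h.abs_mul_le ht o)).1
  exact max_eq_left (by linarith)

theorem IsBoundedScore.measurable_tiltDensity (h : IsBoundedScore P sY sX B) (t : ℝ) :
    Measurable (tiltDensity sY sX t) :=
  ((h.measurable.const_mul t).const_add 1).max measurable_const

theorem IsBoundedScore.isProbabilityMeasure (h : IsBoundedScore P sY sX B) {t : ℝ}
    (ht : |t| * B ≤ 1 / 4) :
    IsProbabilityMeasure (dens P (tiltDensity sY sX t)) := by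
  refine ⟨?_⟩
  have i1 : Integrable (boundedScore sY sX) P := Integrable.of_bound
    h.measurable.aestronglyMeasurable (2 * B) (Eventually.of_forall h.abs_le)
  rw [withDensity_apply _ MeasurableSet.univ, Measure.restrict_univ,
    ← ofReal_integral_eq_lintegral_ofReal]
  · simp_rw [h.tiltDensity_eq ht]
    rw [integral_add (integrable_const _) (i1.const_mul t), integral_const_mul, h.integral_eq_zero]
    simp
  · have : Integrable (fun o => 1 + t * boundedScore sY sX o) P :=
      (integrable_const _).add (i1.const_mul t)
    exact this.congr (Eventually.of_forall fun o => (h.tiltDensity_eq ht o).symm)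
  · exact Eventually.of_forall fun o => le_max_right _ _

theorem IsBoundedScore.isTilt (h : IsBoundedScore P sY sX B) {t : ℝ} (ht : |t| * B ≤ 1 / 4)
    (k : Fin K) :
    IsTilt (typeLaw P k) (fun y => t * sY ⟨k, y⟩) (fun x => t * sX k x) where
  measurable_u := (h.measurable_sY.comp (measurableEmbedding_sigmaMk k).measurable).const_mul t
  measurable_z := (h.measurable_sX k).const_mul t
  abs_u_le o := by
    rw [abs_mul]
    exact (mul_le_mul_of_nonneg_left (h.bound_sY _) (abs_nonneg _)).trans ht
  abs_z_le x := by
    rw [abs_mul]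
    exact (mul_le_mul_of_nonneg_left (h.bound_sX _ _) (abs_nonneg _)).trans ht
  integral_u p := by
    rw [integral_const_mul, h.integral_sY, mul_zero]

/-- Given the type, a tilt is again a tilt up to normalisation. The constant is finite because the
density is positive everywhere, so a type of positive probability keeps positive probability. -/
theorem IsBoundedScore.typeLaw_eq (h : IsBoundedScore P sY sX B) {t : ℝ} (ht : |t| * B ≤ 1 / 4)
    {k : Fin K} (hk : 0 < typeProb P k) : ∃ C : ℝ≥0∞, C ≠ ∞ ∧
      typeLaw (dens P (tiltDensity sY sX t)) k =
        tilted (typeLaw P k) (fun y => t * sY ⟨k, y⟩) (fun x => t * sX k x) C := by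
  refine ⟨(dens P (tiltDensity sY sX t) (Sigma.fst ⁻¹' {k}))⁻¹ * P (Sigma.fst ⁻¹' {k}), ?_, ?_⟩
  rotate_left
  · rw [typeLaw_withDensity, tilted]
    congr 2
    funext y
    rw [h.tiltDensity_eq ht, boundedScore]
    congr 1
    ring
  · refine ENNReal.mul_ne_top (ENNReal.inv_ne_top.2 fun h0 => ?_) (measure_ne_top _ _)
    rw [withDensity_apply_eq_zero' (h.measurable_tiltDensity t).ennreal_ofReal.aemeasurable] at h0
    have : {o | ENNReal.ofReal (tiltDensity sY sX t o) ≠ 0} = Set.univ := by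
      refine Set.eq_univ_of_forall fun o => ?_
      have := (_root_.abs_le.1 (h.abs_mul_le ht o)).1
      simp only [Set.mem_ofPred_eq, ne_eq, ENNReal.ofReal_eq_zero, not_le, h.tiltDensity_eq ht]
      linarith
    rw [this, Set.univ_inter] at h0
    simp [typeProb, Measure.real, h0] at hk

/-- The mean squared residual averages the conditional second moments of the arms with the
propensity scores as weights. These are at least `c`, so each arm is separately integrable. -/
theorem integrable_residual_sq (hP : LawConditions P w e c)
    (hr : MemLp (weightedResidual w (outcomeReg P)) 2 P) (k : Fin K) (a : Treat (M k)) :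
    Integrable (fun x => ∫ y, (w k a x ⬝ᵥ (y - outcomeReg P k a x)) ^ 2 ∂outcomeLaw P k a x)
      (covLaw P k) := by
  have h1 := integrable_trt (integrable_integral_resp (MemLp.typeLaw P hr k).integrable_sq) a
  have hm : Measurable fun x =>
      ∫ y, (w k a x ⬝ᵥ (y - outcomeReg P k a x)) ^ 2 ∂outcomeLaw P k a x := by
    have := (stronglyMeasurable_integral_resp (ν := typeLaw P k)
      (f := fun o => weightedResidual w (outcomeReg P) ⟨k, o⟩ ^ 2)
      (((measurable_weightedResidual hP.weight_measurable (measurable_outcomeReg P)).comp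
        (measurableEmbedding_sigmaMk k).measurable).pow_const 2)).measurable
    exact this.comp measurable_prodMk_left
  refine (h1.const_mul c⁻¹).mono' hm.aestronglyMeasurable ?_
  filter_upwards [hP.prop_eq k a] with x hx
  have hc := hP.c_pos
  have h0 : 0 ≤ ∫ y, (w k a x ⬝ᵥ (y - outcomeReg P k a x)) ^ 2 ∂outcomeLaw P k a x :=
    integral_nonneg fun y => sq_nonneg _
  rw [Real.norm_of_nonneg h0, ← mul_assoc]
  refine le_mul_of_one_le_left h0 ?_
  change 1 ≤ c⁻¹ * propensity P k a x
  rw [hx, ← div_eq_inv_mul, le_div_iff₀ hc, one_mul]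
  exact (hP.overlap k a x).1.le

theorem LawConditions.propensity_pos (hP : LawConditions P w e c) (k : Fin K) (a : Treat (M k)) :
    ∀ᵐ x ∂covLaw P k, 0 < propensity P k a x := by
  filter_upwards [hP.prop_eq k a] with x hx
  rw [hx]
  exact hP.c_pos.trans (hP.overlap k a x).1

/-- Tilted laws belong to the model with known propensity score. -/
theorem IsBoundedScore.mem_modelNPKnown (h : IsBoundedScore P sY sX B)
    (hP : LawConditions P w e c) (hr : MemLp (weightedResidual w (outcomeReg P)) 2 P) {t : ℝ}
    (ht : |t| * B ≤ 1 / 4) : dens P (tiltDensity sY sX t) ∈ modelNPKnown w c e := by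
  have hprob := h.isProbabilityMeasure ht
  set Q := dens P (tiltDensity sY sX t) with hQ
  have hfin : ∀ k, IsFiniteMeasure (covLaw Q k) := fun k =>
    inferInstanceAs (IsFiniteMeasure (covMarginal (typeLaw Q k)))
  have hac : ∀ k, covLaw Q k ≪ covLaw P k := fun k => by
    obtain ⟨C, -, hC⟩ := h.typeLaw_eq ht (hP.typeProb_pos k)
    have := covMarginal_tilted_absolutelyContinuous (C := C) (h.isTilt ht k)
    rwa [← hC] at this
  have hint : ∀ k (f : X k → ℝ), Integrable f (covLaw P k) → Integrable f (covLaw Q k) :=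
    fun k f hf => by
    obtain ⟨C, hC1, hC⟩ := h.typeLaw_eq ht (hP.typeProb_pos k)
    have := isFiniteMeasure_tilted (h.isTilt ht k) hC1
    have := integrable_covMarginal_tilted (h.isTilt ht k) hC1 hf
    rwa [← hC] at this
  have hpr : PropEq Q (propensity Q) e := fun k a => by
    obtain ⟨C, hC1, hC⟩ := h.typeLaw_eq ht (hP.typeProb_pos k)
    have := isFiniteMeasure_tilted (h.isTilt ht k) hC1
    have h1 := trtKernel_tilted (C := C) (h.isTilt ht k)
    simp only [← hC] at h1
    filter_upwards [h1, (hac k).ae_le (hP.prop_eq k a)] with x hx1 hx2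
    rw [← hx2]
    change (trtKernel (typeLaw Q k) x).real {a} = (trtKernel (typeLaw P k) x).real {a}
    rw [hx1]
  have hle : ∀ k a, ∀ᵐ x ∂covLaw Q k,
      outcomeLaw Q k a x ≤ (2 : ℝ≥0∞) • outcomeLaw P k a x := fun k a => by
    obtain ⟨C, hC1, hC⟩ := h.typeLaw_eq ht (hP.typeProb_pos k)
    have := isFiniteMeasure_tilted (h.isTilt ht k) hC1
    have h1 := respKernel_tilted_le (C := C) (h.isTilt ht k) (hP.propensity_pos k) a
    simp only [← hC] at h1
    exact h1
  refine ⟨⟨hprob, fun k a => ?_, ⟨fun k a => ?_, fun k a j => ?_, fun k a i j => ?_⟩,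
    fun k a => ?_⟩, hpr⟩
  · filter_upwards [hpr k a] with x hx
    rw [hx]
    exact hP.overlap k a x
  · filter_upwards [hle k a, (hac k).ae_le (hP.moments.memLp k a)] with x h1 h2 j
    exact MemLp.of_le_two_smul h1 (h2 j)
  -- The regression moves by the tilted mean of `Y_j - g_j`, which is at most one plus twice the
  -- original conditional variance.
  · have h2 := (hint k _ (hP.moments.reg k a j)).norm.add
      ((integrable_const (1 : ℝ)).add ((hint k _ (hP.moments.cov k a j j)).const_mul 2))
    refine h2.mono' ((measurable_pi_apply j).comp
      (measurable_outcomeReg Q k a)).aestronglyMeasurable ?_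
    filter_upwards [hle k a, (hac k).ae_le (hP.moments.memLp k a)] with x h3 h4
    have hx' : MemLp (fun y : Outcome (M k) => y j) 2 (outcomeLaw Q k a x) :=
      MemLp.of_le_two_smul h3 (h4 j)
    have h5 := abs_integral_le_one_add h3 ((h4 j).sub (memLp_const (outcomeReg P k a x j)))
    have e1 : ∫ y : Outcome (M k), (y j - outcomeReg P k a x j) ∂outcomeLaw Q k a x =
        outcomeReg Q k a x j - outcomeReg P k a x j := by
      rw [integral_sub (hx'.integrable (by norm_num)) (integrable_const _)]
      simp [outcomeReg]
    have e2 : ∫ y : Outcome (M k), (y j - outcomeReg P k a x j) ^ 2 ∂outcomeLaw P k a x =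
        outcomeCov P k a x j j := by
      simp only [outcomeCov, Matrix.of_apply, sq]
    simp only [Pi.sub_apply] at h5
    rw [e1, e2] at h5
    have := norm_add_le (outcomeReg P k a x j) (outcomeReg Q k a x j - outcomeReg P k a x j)
    rw [add_sub_cancel] at this
    exact this.trans (add_le_add le_rfl h5)
  · have h2 := (hint k _ (hP.moments.cov k a i i)).add (hint k _ (hP.moments.cov k a j j))
    have hm : Measurable fun x => outcomeCov Q k a x i j := by
      have hg := fun j => (stronglyMeasurable_respMean_apply (typeLaw Q k) j).measurable
      have := (stronglyMeasurable_integral_resp (ν := typeLaw Q k)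
        (f := fun o : ClusterObs M X k => (o.1 i - respMean (typeLaw Q k) o.2.1 o.2.2 i) *
          (o.1 j - respMean (typeLaw Q k) o.2.1 o.2.2 j))
        ((((measurable_pi_apply i).comp measurable_fst).sub ((hg i).comp measurable_snd)).mul
          (((measurable_pi_apply j).comp measurable_fst).sub
            ((hg j).comp measurable_snd)))).measurable
      exact this.comp measurable_prodMk_left
    refine h2.mono' hm.aestronglyMeasurable ?_
    filter_upwards [hle k a, (hac k).ae_le (hP.moments.memLp k a)] with x h3 h4
    exact abs_cov_le h3 h4 i j
  · obtain ⟨C, hC1, hC⟩ := h.typeLaw_eq ht (hP.typeProb_pos k)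
    have := isFiniteMeasure_tilted (h.isTilt ht k) hC1
    exact integrable_weighted_respMean_tilted (C := C) (h.isTilt ht k) hC1 hC
      (hP.propensity_pos k) (hP.moments.memLp k a) (hP.weight_measurable k a)
      (hP.weight_integrable k a) (integrable_residual_sq hP hr k a)

end TiltedLaw

/-! ### Regular submodels with bounded scores -/

/-- Simple functions are bounded and dense in `L²`. -/
theorem exists_bounded_approx {𝓞 : Type*} [MeasurableSpace 𝓞] {μ : Measure 𝓞} {f : 𝓞 → ℝ}
    (hf : MemLp f 2 μ) {δ : ℝ} (hδ : 0 < δ) : ∃ (g : 𝓞 → ℝ) (B : ℝ), Measurable g ∧ 0 ≤ B ∧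
      (∀ o, |g o| ≤ B) ∧ MemLp g 2 μ ∧ ∫ o, (f o - g o) ^ 2 ∂μ < δ := by
  obtain ⟨g, hg, hgL⟩ := hf.exists_simpleFunc_eLpNorm_sub_lt (by norm_num)
    (ε := ENNReal.ofReal √δ) (by simpa using hδ)
  obtain ⟨B, hB⟩ := g.exists_forall_norm_le
  refine ⟨g, max B 0, g.measurable, le_max_right _ _,
    fun o => (hB o).trans (le_max_left _ _), hgL, ?_⟩
  have h := hf.sub hgL
  rw [h.eLpNorm_eq_integral_rpow_norm (by norm_num) (by norm_num),
    ENNReal.ofReal_lt_ofReal_iff (Real.sqrt_pos.2 hδ)] at hg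
  simp only [ENNReal.toReal_ofNat, Real.rpow_two, Pi.sub_apply, Real.norm_eq_abs, sq_abs] at hg
  rw [← one_div, ← Real.sqrt_eq_rpow] at hg
  exact (Real.sqrt_lt_sqrt_iff (integral_nonneg fun o => sq_nonneg _)).1 hg

/-- With `y = √(1 + x)` the error is `-(y - 1)²/2`, while `x = (y - 1)(y + 1)` and `y + 1 ≥ 1`. -/
theorem abs_sqrt_one_add_sub_le (x : ℝ) (hx : -1 ≤ x) : |√(1 + x) - 1 - 1 / 2 * x| ≤ x ^ 2 / 2 := by
  set y := √(1 + x) with hy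
  have h0 : 0 ≤ y := Real.sqrt_nonneg _
  have h1 : x = y ^ 2 - 1 := by rw [hy, Real.sq_sqrt (by linarith)]; ring
  have h2 : y - 1 - 1 / 2 * x = -((y - 1) ^ 2 / 2) := by rw [h1]; ring
  rw [h2, abs_neg, abs_of_nonneg (by positivity)]
  have h3 : x ^ 2 = (y - 1) ^ 2 * (y + 1) ^ 2 := by rw [h1]; ring
  rw [h3]
  have : (y - 1) ^ 2 ≤ (y - 1) ^ 2 * (y + 1) ^ 2 := le_mul_of_one_le_right (sq_nonneg _) (by nlinarith)
  linarith

section Submodel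

variable {K : ℕ} {M : Fin K → ℕ} {X : Fin K → Type*} [∀ k, MeasurableSpace (X k)]
  {P : Measure (Obs M X)} [IsProbabilityMeasure P] {w : RegFun M X} {e : PropFun M X} {c : ℝ}
  {sY : Obs M X → ℝ} {sX : ∀ k, X k → ℝ} {B : ℝ}

theorem IsBoundedScore.memLp (h : IsBoundedScore P sY sX B) : MemLp (boundedScore sY sX) 2 P :=
  MemLp.of_bound h.measurable.aestronglyMeasurable (2 * B) (Eventually.of_forall h.abs_le)

/-- For a bounded score the remainder of the root density is at most `2 B² ‖η‖²` uniformly in the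
observation, so its mean square is of order `‖η‖⁴`. -/
theorem IsBoundedScore.qmd (h : IsBoundedScore P sY sX B) :
    (fun η : Fin 1 → ℝ => ∫ o, (√(tiltDensity sY sX (η 0) o) - √(tiltDensity sY sX 0 o) -
      1 / 2 * (η 0 * boundedScore sY sX o) * √(tiltDensity sY sX 0 o)) ^ 2 ∂P)
      =o[𝓝 0] fun η => ‖η‖ ^ 2 := by
  have hsmall : ∀ᶠ η : Fin 1 → ℝ in 𝓝 0, |η 0| * B ≤ 1 / 4 := by
    have : Tendsto (fun η : Fin 1 → ℝ => |η 0| * B) (𝓝 0) (𝓝 (|(0 : Fin 1 → ℝ) 0| * B)) :=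
      (Continuous.tendsto (by fun_prop) _)
    simp only [Pi.zero_apply, abs_zero, zero_mul] at this
    exact this.eventually (ge_mem_nhds (by norm_num))
  have hO : (fun η : Fin 1 → ℝ => ∫ o, (√(tiltDensity sY sX (η 0) o) - √(tiltDensity sY sX 0 o) -
      1 / 2 * (η 0 * boundedScore sY sX o) * √(tiltDensity sY sX 0 o)) ^ 2 ∂P)
      =O[𝓝 0] fun η => ‖η‖ ^ 4 := by
    refine Asymptotics.IsBigO.of_bound (((2 * B) ^ 2 / 2) ^ 2) ?_
    filter_upwards [hsmall] with η hη
    have hle : ∀ o, (√(tiltDensity sY sX (η 0) o) - √(tiltDensity sY sX 0 o) -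
        1 / 2 * (η 0 * boundedScore sY sX o) * √(tiltDensity sY sX 0 o)) ^ 2 ≤
        ((2 * B) ^ 2 / 2) ^ 2 * ‖η‖ ^ 4 := fun o => by
      rw [h.tiltDensity_eq hη, h.tiltDensity_eq (t := 0) (by simp)]
      simp only [zero_mul, add_zero, Real.sqrt_one, mul_one]
      have h1 := abs_sqrt_one_add_sub_le (η 0 * boundedScore sY sX o)
        (by linarith [(_root_.abs_le.1 (h.abs_mul_le hη o)).1])
      rw [← sq_abs]
      have h2 : (η 0 * boundedScore sY sX o) ^ 2 ≤ (2 * B) ^ 2 * ‖η‖ ^ 2 := by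
        rw [← sq_abs, abs_mul, mul_comm, mul_pow]
        gcongr
        · exact h.abs_le o
        · exact norm_le_pi_norm η 0
      calc _ ≤ ((η 0 * boundedScore sY sX o) ^ 2 / 2) ^ 2 := by gcongr
        _ ≤ ((2 * B) ^ 2 * ‖η‖ ^ 2 / 2) ^ 2 := by gcongr
        _ = _ := by ring
    rw [Real.norm_of_nonneg (integral_nonneg fun o => sq_nonneg _),
      Real.norm_of_nonneg (by positivity)]
    calc _ ≤ ∫ _, ((2 * B) ^ 2 / 2) ^ 2 * ‖η‖ ^ 4 ∂P := by
          refine integral_mono_of_nonneg (Eventually.of_forall fun o => sq_nonneg _)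
            (integrable_const _) (Eventually.of_forall hle)
      _ = _ := by simp
  refine hO.trans_isLittleO ?_
  have h1 : (fun η : Fin 1 → ℝ => ‖η‖ ^ 2 * ‖η‖ ^ 2) =o[𝓝 0] fun η => 1 * ‖η‖ ^ 2 := by
    refine Asymptotics.IsLittleO.mul_isBigO ?_ (Asymptotics.isBigO_refl _ _)
    rw [Asymptotics.isLittleO_one_iff]
    have : Tendsto (fun η : Fin 1 → ℝ => ‖η‖ ^ 2) (𝓝 0) (𝓝 (‖(0 : Fin 1 → ℝ)‖ ^ 2)) :=
      Continuous.tendsto (by fun_prop) _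
    simpa using this
  refine (h1.congr_left fun η => ?_).congr_right fun η => ?_ <;> ring

/-- The constant is pinned to twice the second moment under `μ`, independently of the density, so
that one bound serves all parameters near the centre. -/
theorem lintegral_sq_dens_le {𝓞 : Type*} [MeasurableSpace 𝓞] {μ : Measure 𝓞} {p : 𝓞 → ℝ}
    (hp : ∀ o, p o ≤ 2) {h : 𝓞 → ℝ} (hh : MemLp h 2 μ) : ∃ C : ℝ≥0, (C : ℝ≥0∞) =
      2 * ∫⁻ o, ‖h o‖ₑ ^ 2 ∂μ ∧ ∫⁻ o, ‖h o‖ₑ ^ 2 ∂dens μ p ≤ C := by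
  have h1 : 2 * ∫⁻ o, ‖h o‖ₑ ^ 2 ∂μ ≠ ∞ := by
    refine ENNReal.mul_ne_top (by simp) ?_
    have h2 := hh.integrable_sq.2
    have h3 : ∀ o, ‖h o‖ₑ ^ 2 = ‖h o ^ 2‖ₑ := fun o => by rw [enorm_pow]
    simp_rw [h3]
    exact h2.ne
  refine ⟨(2 * ∫⁻ o, ‖h o‖ₑ ^ 2 ∂μ).toNNReal, ENNReal.coe_toNNReal h1, ?_⟩
  rw [ENNReal.coe_toNNReal h1]
  have h4 : dens μ p ≤ (2 : ℝ≥0∞) • μ := by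
    rw [← withDensity_const]
    refine withDensity_mono (Eventually.of_forall fun o => ?_)
    rw [← ENNReal.ofReal_ofNat]
    exact ENNReal.ofReal_le_ofReal (hp o)
  calc _ ≤ ∫⁻ o, ‖h o‖ₑ ^ 2 ∂((2 : ℝ≥0∞) • μ) := lintegral_mono' h4 le_rfl
    _ = _ := by rw [lintegral_smul_measure, smul_eq_mul]

/-- Bounded scores are scores of regular submodels. -/
theorem IsBoundedScore.isRegularSubmodel (h : IsBoundedScore P sY sX B)
    (hP : LawConditions P w e c) (hr : MemLp (weightedResidual w (outcomeReg P)) 2 P)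
    (hm : MemLp (weightedRegression w (outcomeReg P)) 2 P) {𝓜 : Set (Measure (Obs M X))}
    (h𝓜 : modelNPKnown w c e ⊆ 𝓜) (hs : ∫ o, boundedScore sY sX o ^ 2 ∂P ≠ 0) :
    IsRegularSubmodel 𝓜 (momentFunctions w P) P
      (fun η : Fin 1 → ℝ => dens P (tiltDensity sY sX (η 0))) 0
      (fun o _ => boundedScore sY sX o) := by
  have hsmall : ∀ᶠ η : Fin 1 → ℝ in 𝓝 0, |η 0| * B ≤ 1 / 4 := by
    have : Tendsto (fun η : Fin 1 → ℝ => |η 0| * B) (𝓝 0) (𝓝 (|(0 : Fin 1 → ℝ) 0| * B)) :=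
      (Continuous.tendsto (by fun_prop) _)
    simp only [Pi.zero_apply, abs_zero, zero_mul] at this
    exact this.eventually (ge_mem_nhds (by norm_num))
  refine ⟨?_, ?_, ?_, fun _ => h.memLp, ?_, ?_, ?_⟩
  · have : (fun o => ENNReal.ofReal (tiltDensity sY sX 0 o)) = 1 := by
      funext o
      simp [tiltDensity]
    change P.withDensity (fun o => ENNReal.ofReal (tiltDensity sY sX 0 o)) = P
    rw [this, withDensity_one]
  · filter_upwards [hsmall] with η hη
    exact h𝓜 (h.mem_modelNPKnown hP hr hη)
  · exact measurable_pi_lambda _ fun _ => h.measurable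
  · refine ⟨P, fun η => tiltDensity sY sX (η 0), inferInstance,
      fun η => h.measurable_tiltDensity _, fun η o => le_max_right _ _,
      Eventually.of_forall fun η => rfl, ?_⟩
    simpa [dotProduct] using h.qmd
  · rw [Matrix.det_fin_one, isUnit_iff_ne_zero]
    simpa [information, sq] using hs
  · have key : ∀ f : Obs M X → ℝ, MemLp f 2 P → ∃ C : ℝ≥0, ∀ᶠ η : Fin 1 → ℝ in 𝓝 0,
        ∫⁻ o, ‖f o‖ₑ ^ 2 ∂dens P (tiltDensity sY sX (η 0)) ≤ C := fun f hf => by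
      have h1 : ∀ η : Fin 1 → ℝ, |η 0| * B ≤ 1 / 4 → ∀ o, tiltDensity sY sX (η 0) o ≤ 2 :=
        fun η hη o => by
          rw [h.tiltDensity_eq hη]
          linarith [(_root_.abs_le.1 (h.abs_mul_le hη o)).2]
      -- The density zero only serves to name the common constant before `η` is chosen.
      obtain ⟨C, hC, -⟩ := lintegral_sq_dens_le (p := fun _ => 0) (fun _ => by norm_num) hf
      refine ⟨C, ?_⟩
      filter_upwards [hsmall] with η hη
      obtain ⟨C', hC', h2⟩ := lintegral_sq_dens_le (h1 η hη) hf
      rwa [hC', ← hC] at h2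
    intro f hf
    rcases hf with rfl | rfl
    · exact key _ hr
    · exact key _ hm

/-- The trivial submodel. -/
theorem isRegularSubmodel_const (hr : MemLp (weightedResidual w (outcomeReg P)) 2 P)
    (hm : MemLp (weightedRegression w (outcomeReg P)) 2 P) {𝓜 : Set (Measure (Obs M X))}
    (h𝓜 : P ∈ 𝓜) :
    IsRegularSubmodel 𝓜 (momentFunctions w P) P (fun _ : Fin 0 → ℝ => P) 0
      (fun _ j => j.elim0) := by
  refine ⟨rfl, Eventually.of_forall fun _ => h𝓜, measurable_pi_lambda _ fun j => j.elim0,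
    fun j => j.elim0, ?_, by simp, ?_⟩
  · refine ⟨P, fun _ _ => 1, inferInstance, fun _ => measurable_const, fun _ _ => by norm_num,
      Eventually.of_forall fun _ => ?_, ?_⟩
    · simp only [ENNReal.ofReal_one]
      exact (withDensity_one (μ := P)).symm
    · simp [dotProduct]
  · have key : ∀ f : Obs M X → ℝ, MemLp f 2 P → ∃ C : ℝ≥0, ∀ᶠ _ : Fin 0 → ℝ in 𝓝 0,
        ∫⁻ o, ‖f o‖ₑ ^ 2 ∂P ≤ C := fun f hf => by
      obtain ⟨C, -, hC⟩ := lintegral_sq_dens_le (p := fun _ => 1) (fun _ => by norm_num) hf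
      refine ⟨C, Eventually.of_forall fun _ => ?_⟩
      have : dens P (fun _ => 1) = P := by
        simp only [dens, ENNReal.ofReal_one]
        exact withDensity_one
      rwa [this] at hC
    intro f hf
    rcases hf with rfl | rfl
    · exact key _ hr
    · exact key _ hm

end Submodel

/-! ### The efficiency bound -/

section EfficiencyBound

variable {K : ℕ} {M : Fin K → ℕ} {X : Fin K → Type*} [∀ k, MeasurableSpace (X k)]
  {P : Measure (Obs M X)} [IsProbabilityMeasure P] {w : RegFun M X} {e : PropFun M X} {c : ℝ}
  {v : Fin K → ℝ → ℝ}

theorem memLp_ind (Q : Measure (Obs M X)) [IsFiniteMeasure Q] (k : Fin K) {p : ℝ≥0∞} :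
    MemLp (ind k : Obs M X → ℝ) p Q :=
  MemLp.of_bound (measurable_ind k).aestronglyMeasurable 1 (Eventually.of_forall (abs_ind_le k))

/-- The AIPW function with correct nuisance functions is unbiased. -/
theorem LawConditions.integral_ind_mul_aipwObs (hP : LawConditions P w e c)
    (hr : MemLp (weightedResidual w (outcomeReg P)) 2 P)
    (hm : MemLp (weightedRegression w (outcomeReg P)) 2 P) (k : Fin K) :
    ∫ o, ind k o * aipwObs w (outcomeReg P) e o ∂P = typeProb P k * typeMean w P k := by
  have h1 := (hP.memLp_ind_mul_aipwObs (measurable_outcomeReg P) hr hm k).1.integrable (by norm_num)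
  have h2 := Integrable.typeLaw P h1 k
  simp only [ind, if_true, one_mul] at h2
  rw [integral_ind_mul, ← typeProb_mul_integral]
  congr 1
  have h3 := integral_aipw_of_regression (w := w k) (ε := e k) (hP.moments.integrable_resp k)
    (fun a => Eventually.of_forall fun x => rfl) h2
  refine h3.trans ?_
  rw [integral_finsetSum _ fun a _ => ?_]
  · rfl
  · exact hP.weight_integrable k a

theorem LawConditions.integral_effInfluence (hP : LawConditions P w e c)
    (hr : MemLp (weightedResidual w (outcomeReg P)) 2 P)
    (hm : MemLp (weightedRegression w (outcomeReg P)) 2 P) :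
    ∫ o, effInfluence w v e P o ∂P = 0 := by
  have hi : ∀ k, Integrable (ind k : Obs M X → ℝ) P := fun k =>
    memLp_one_iff_integrable.1 (memLp_ind P k)
  have i1 : ∀ k, Integrable (fun o => ind k o * aipwObs w (outcomeReg P) e o) P := fun k =>
    (hP.memLp_ind_mul_aipwObs (measurable_outcomeReg P) hr hm k).1.integrable (by norm_num)
  have i2 : ∀ k, Integrable (fun o => v k (typeProb P k) / typeProb P k *
      (ind k o * aipwObs w (outcomeReg P) e o - typeMean w P k * ind k o)) P := fun k =>
    ((i1 k).sub ((hi k).const_mul _)).const_mul _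
  have i3 : ∀ k, Integrable (fun o : Obs M X => weightDeriv v P k * typeMean w P k *
      (ind k o - typeProb P k)) P := fun k => ((hi k).sub (integrable_const _)).const_mul _
  unfold effInfluence
  rw [integral_finsetSum _ fun k _ => by exact (i2 k).add (i3 k)]
  refine Finset.sum_eq_zero fun k _ => ?_
  rw [integral_add (i2 k) (i3 k), integral_const_mul, integral_const_mul,
    integral_sub (i1 k) ((hi k).const_mul _), integral_sub (hi k) (integrable_const _),
    integral_const_mul, hP.integral_ind_mul_aipwObs hr hm, integral_ind]
  simp
  right
  ring

/-- The part of the influence function that depends on the outcome. -/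
def outcomePart (w : RegFun M X) (v : Fin K → ℝ → ℝ) (e : PropFun M X) (P : Measure (Obs M X))
    (o : Obs M X) : ℝ :=
  weightedResidual w (outcomeReg P) o *
    (v o.1 (typeProb P o.1) / typeProb P o.1 / e o.1 o.2.2.1 o.2.2.2)

/-- The part of the influence function that depends on the type and the covariates. -/
def covariatePart (w : RegFun M X) (v : Fin K → ℝ → ℝ) (P : Measure (Obs M X))
    (q : Σ k, X k) : ℝ :=
  ∑ k, (v k (typeProb P k) / typeProb P k *
      ((if q.1 = k then 1 else 0) * (∑ a, w q.1 a q.2 ⬝ᵥ outcomeReg P q.1 a q.2) -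
        typeMean w P k * (if q.1 = k then 1 else 0)) +
    weightDeriv v P k * typeMean w P k * ((if q.1 = k then 1 else 0) - typeProb P k))

/-- The type and the covariates. -/
def typeCov (o : Obs M X) : Σ k, X k := ⟨o.1, o.2.2.2⟩

theorem measurable_typeCov : Measurable (typeCov : Obs M X → Σ k, X k) :=
  measurable_of_sigmaMk fun k =>
    (measurableEmbedding_sigmaMk k).measurable.comp (measurable_snd.comp measurable_snd)

/-- This places the influence function in the closed span of the scores that leave the propensity
score fixed: one part is conditionally centred given treatment and covariates, the other depends on
type and covariates only. There is no part along the treatment mechanism. -/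
theorem effInfluence_eq_add (o : Obs M X) :
    effInfluence w v e P o = outcomePart w v e P o + covariatePart w v P (typeCov o) := by
  have h1 : outcomePart w v e P o = ∑ k, v k (typeProb P k) / typeProb P k *
      (ind k o * (weightedResidual w (outcomeReg P) o / e o.1 o.2.2.1 o.2.2.2)) := by
    rw [Finset.sum_eq_single o.1]
    · simp only [outcomePart, ind, if_true]
      ring
    · intro k _ hk
      simp [ind, hk.symm]
    · simp
  rw [h1, covariatePart, effInfluence, ← Finset.sum_add_distrib]
  refine Finset.sum_congr rfl fun k _ => ?_
  have e1 : (if (typeCov o).1 = k then (1 : ℝ) else 0) = ind k o := rfl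
  have e2 : ∑ a, w (typeCov o).1 a (typeCov o).2 ⬝ᵥ outcomeReg P (typeCov o).1 a (typeCov o).2 =
      weightedRegression w (outcomeReg P) o := rfl
  rw [aipwObs, e1, e2]
  ring

theorem LawConditions.measurable_outcomePart (hP : LawConditions P w e c) :
    Measurable (outcomePart w v e P) := by
  refine (measurable_weightedResidual hP.weight_measurable (measurable_outcomeReg P)).mul ?_
  exact measurable_obs_prop (h := fun k a x => v k (typeProb P k) / typeProb P k / e k a x)
    fun k a => measurable_const.div (hP.prop_measurable k a)

theorem LawConditions.measurable_covariatePart (hP : LawConditions P w e c) :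
    Measurable (covariatePart w v P) := by
  refine Finset.measurable_sum _ fun k _ => ?_
  have h1 : Measurable fun q : Σ k, X k => (if q.1 = k then (1 : ℝ) else 0) :=
    measurable_of_sigmaMk fun j => measurable_const (a := if j = k then (1 : ℝ) else 0)
  have h2 : Measurable fun q : Σ k, X k => ∑ a, w q.1 a q.2 ⬝ᵥ outcomeReg P q.1 a q.2 :=
    measurable_of_sigmaMk fun j => by
      change Measurable fun x : X j => ∑ a, w j a x ⬝ᵥ outcomeReg P j a x
      exact Finset.measurable_sum _ fun a _ =>
        measurable_dotProduct (hP.weight_measurable j a) (measurable_outcomeReg P j a)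
  exact (((h1.mul h2).sub (h1.const_mul _)).const_mul _).add ((h1.sub_const _).const_mul _)

theorem LawConditions.memLp_outcomePart (hP : LawConditions P w e c)
    (hr : MemLp (weightedResidual w (outcomeReg P)) 2 P) : MemLp (outcomePart w v e P) 2 P := by
  have hm : Measurable fun o : Obs M X =>
      v o.1 (typeProb P o.1) / typeProb P o.1 / e o.1 o.2.2.1 o.2.2.2 :=
    measurable_obs_prop (h := fun k a x => v k (typeProb P k) / typeProb P k / e k a x)
      fun k a => measurable_const.div (hP.prop_measurable k a)
  have h1 := memLp_bdd_mul (B := (∑ k, |v k (typeProb P k) / typeProb P k|) / c) hm (fun o => ?_) hr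
  · refine h1.ae_eq (Eventually.of_forall fun o => ?_)
    simp only [outcomePart]
    ring
  · have he := (hP.overlap o.1 o.2.2.1 o.2.2.2).1
    rw [abs_div, abs_of_pos (hP.c_pos.trans he)]
    exact div_le_div₀ (Finset.sum_nonneg fun _ _ => abs_nonneg _)
      (Finset.single_le_sum (f := fun k => |v k (typeProb P k) / typeProb P k|)
        (fun _ _ => abs_nonneg _) (Finset.mem_univ o.1)) hP.c_pos he.le

theorem LawConditions.ae_integral_outcomePart (hP : LawConditions P w e c) (k : Fin K) :
    ∀ᵐ p ∂trtCovLaw (typeLaw P k),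
      ∫ y, outcomePart w v e P ⟨k, y, p⟩ ∂respKernel (typeLaw P k) p = 0 := by
  refine ae_trtCovLaw_of_ae fun a => ?_
  filter_upwards [hP.moments.integrable_resp k a] with x hx
  have h1 := integral_dotProduct_sub hx (w k a x) (outcomeReg P k a x)
  simp only [outcomePart, weightedResidual]
  rw [integral_mul_const, h1.2]
  have : (fun j => ∫ y, y j ∂respKernel (typeLaw P k) (a, x)) = outcomeReg P k a x := rfl
  rw [this]
  simp

/-- Approximate by a bounded function and subtract its conditional mean given treatment and
covariates. The target is conditionally centred, so this subtraction cannot increase the distance.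
-/
theorem exists_outcome_score (hP : LawConditions P w e c)
    (hr : MemLp (weightedResidual w (outcomeReg P)) 2 P) {δ : ℝ} (hδ : 0 < δ) :
    ∃ (sY : Obs M X → ℝ) (B : ℝ), Measurable sY ∧ (∀ o, |sY o| ≤ B) ∧
      (∀ k p, ∫ y, sY ⟨k, y, p⟩ ∂respKernel (typeLaw P k) p = 0) ∧
      ∫ o, (outcomePart w v e P o - sY o) ^ 2 ∂P < δ := by
  obtain ⟨g, B, hgm, hB0, hB, hgL, hg⟩ := exists_bounded_approx
    (hP.memLp_outcomePart (v := v) hr) hδ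
  have hgk : ∀ k, Measurable fun z : ClusterObs M X k => g ⟨k, z⟩ := fun k =>
    hgm.comp (measurableEmbedding_sigmaMk k).measurable
  -- Using the kernel itself makes the centring exact at every treatment and covariate value, and
  -- not merely almost everywhere.
  set G : Obs M X → ℝ := fun o => ∫ y, g ⟨o.1, y, o.2.2⟩ ∂respKernel (typeLaw P o.1) o.2.2 with hG
  have hGk : ∀ k, Measurable fun z : ClusterObs M X k => G ⟨k, z⟩ := fun k =>
    (stronglyMeasurable_integral_resp (ν := typeLaw P k) (hgk k)).measurable.comp measurable_snd
  have hGB : ∀ o, |G o| ≤ B := fun o => by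
    have := norm_integral_le_of_norm_le_const (μ := respKernel (typeLaw P o.1) o.2.2) (C := B)
      (f := fun y => g ⟨o.1, y, o.2.2⟩) (Eventually.of_forall fun y => hB _)
    simpa using this
  have ig : ∀ k p, Integrable (fun y => g ⟨k, y, p⟩) (respKernel (typeLaw P k) p) := fun k p =>
    Integrable.of_bound ((hgk k).comp measurable_prodMk_right).aestronglyMeasurable B
      (Eventually.of_forall fun y => hB _)
  have hsm : Measurable fun o => g o - G o := hgm.sub (measurable_of_sigmaMk hGk)
  have hsB : ∀ o, |g o - G o| ≤ 2 * B := fun o => by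
    have h1 := abs_le.1 (hB o)
    have h2 := abs_le.1 (hGB o)
    rw [abs_le]
    constructor <;> linarith
  refine ⟨fun o => g o - G o, 2 * B, hsm, hsB, fun k p => ?_, lt_of_le_of_lt ?_ hg⟩
  · change ∫ y, (g ⟨k, y, p⟩ - ∫ y', g ⟨k, y', p⟩ ∂respKernel (typeLaw P k) p)
      ∂respKernel (typeLaw P k) p = 0
    rw [integral_sub (ig k p) (integrable_const _)]
    simp
  · have hL := hP.memLp_outcomePart (v := v) hr
    have j1 : MemLp (fun o => outcomePart w v e P o - (g o - G o)) 2 P :=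
      hL.sub (MemLp.of_bound hsm.aestronglyMeasurable (2 * B) (Eventually.of_forall hsB))
    have j2 : MemLp (fun o => outcomePart w v e P o - g o) 2 P := hL.sub hgL
    rw [integral_sigma P j1.integrable_sq, integral_sigma P j2.integrable_sq]
    refine Finset.sum_le_sum fun k _ => mul_le_mul_of_nonneg_left ?_ measureReal_nonneg
    have l1 := Integrable.typeLaw P j1.integrable_sq k
    have l2 := Integrable.typeLaw P j2.integrable_sq k
    rw [integral_resp l1, integral_resp l2]
    refine integral_mono_ae (integrable_integral_resp l1) (integrable_integral_resp l2) ?_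
    have hm2 : Measurable fun z : ClusterObs M X k => outcomePart w v e P ⟨k, z⟩ :=
      hP.measurable_outcomePart.comp (measurableEmbedding_sigmaMk k).measurable
    filter_upwards [hP.ae_integral_outcomePart (v := v) k, ae_integrable_resp l2,
      ae_integrable_resp (Integrable.typeLaw P (hL.integrable (by norm_num)) k)] with p h0 h1 h2
    have h3 : MemLp (fun y => outcomePart w v e P ⟨k, y, p⟩ - g ⟨k, y, p⟩) 2
        (respKernel (typeLaw P k) p) :=
      (memLp_two_iff_integrable_sq ((hm2.comp measurable_prodMk_right).sub
        ((hgk k).comp measurable_prodMk_right)).aestronglyMeasurable).2 h1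
    have h4 := integral_sub_mean_sq_le h3 0
    rw [integral_sub h2 (ig k p), h0] at h4
    simp only [sub_zero, zero_sub, sub_neg_eq_add] at h4
    refine le_trans (le_of_eq ?_) h4
    refine integral_congr_ae (Eventually.of_forall fun y => ?_)
    simp only [hG]
    ring

/-- The approximation is made under the law of `(L, X)`, so the bounded approximant is again a
function of type and covariates. Its mean is then subtracted, which is harmless because the
covariate part is centred. -/
theorem exists_covariate_score (hP : LawConditions P w e c)
    (hr : MemLp (weightedResidual w (outcomeReg P)) 2 P)
    (hm : MemLp (weightedRegression w (outcomeReg P)) 2 P) {δ : ℝ} (hδ : 0 < δ) :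
    ∃ (sX : ∀ k, X k → ℝ) (B : ℝ), (∀ k, Measurable (sX k)) ∧ (∀ k x, |sX k x| ≤ B) ∧
      ∫ o : Obs M X, sX o.1 o.2.2.2 ∂P = 0 ∧
      MemLp (fun o => covariatePart w v P (typeCov o)) 2 P ∧
      ∫ o, (covariatePart w v P (typeCov o) - sX o.1 o.2.2.2) ^ 2 ∂P < δ := by
  have hY := hP.memLp_outcomePart (v := v) hr
  have hY0 : ∫ o, outcomePart w v e P o ∂P = 0 := by
    rw [integral_sigma P (hY.integrable (by norm_num))]
    refine Finset.sum_eq_zero fun k _ => ?_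
    rw [integral_resp (Integrable.typeLaw P (hY.integrable (by norm_num)) k),
      integral_eq_zero_of_ae (hP.ae_integral_outcomePart k), mul_zero]
  have hD := hP.memLp_effInfluence (v := v) hr hm
  have hX : MemLp (fun o => covariatePart w v P (typeCov o)) 2 P := by
    refine (hD.sub hY).ae_eq (Eventually.of_forall fun o => ?_)
    simp [effInfluence_eq_add]
  have hX0 : ∫ o, covariatePart w v P (typeCov o) ∂P = 0 := by
    have h1 := hP.integral_effInfluence (v := v) hr hm
    simp_rw [effInfluence_eq_add] at h1
    rw [integral_add (hY.integrable (by norm_num)) (hX.integrable (by norm_num)), hY0] at h1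
    linarith
  have hT := measurable_typeCov (M := M) (X := X)
  have hcm := hP.measurable_covariatePart (v := v)
  have hR : IsProbabilityMeasure (P.map typeCov) := Measure.isProbabilityMeasure_map hT.aemeasurable
  have hXR : MemLp (covariatePart w v P) 2 (P.map typeCov) :=
    (memLp_map_measure_iff hcm.aestronglyMeasurable hT.aemeasurable).2 hX
  obtain ⟨g, B, hgm, hB0, hB, hgL, hg⟩ := exists_bounded_approx hXR hδ
  set m := ∫ q, g q ∂P.map typeCov with hm_def
  have hmB : |m| ≤ B := by
    have := norm_integral_le_of_norm_le_const (μ := P.map typeCov) (C := B) (f := g)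
      (Eventually.of_forall hB)
    simpa using this
  have hmP : ∫ o, g (typeCov o) ∂P = m := by
    rw [hm_def, integral_map hT.aemeasurable hgm.aestronglyMeasurable]
  have igP : Integrable (fun o => g (typeCov o)) P :=
    Integrable.of_bound (hgm.comp hT).aestronglyMeasurable B (Eventually.of_forall fun o => hB _)
  refine ⟨fun k x => g ⟨k, x⟩ - m, 2 * B, fun k => ?_, fun k x => ?_, ?_, hX, lt_of_le_of_lt ?_ hg⟩
  · exact (hgm.comp (measurableEmbedding_sigmaMk k).measurable).sub_const m
  · have h1 := abs_le.1 (hB ⟨k, x⟩)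
    have h2 := abs_le.1 hmB
    rw [abs_le]
    constructor <;> linarith
  · change ∫ o : Obs M X, (g (typeCov o) - m) ∂P = 0
    rw [integral_sub igP (integrable_const _), hmP]
    simp
  · have h3 := integral_sub_mean_sq_le (hXR.sub hgL) 0
    have e1 : ∫ q, (covariatePart w v P - g) q ∂P.map typeCov = -m := by
      simp only [Pi.sub_apply]
      rw [integral_sub (hXR.integrable (by norm_num)) (hgL.integrable (by norm_num)),
        integral_map hT.aemeasurable hcm.aestronglyMeasurable, hX0, zero_sub]
    rw [e1] at h3
    simp only [Pi.sub_apply, sub_neg_eq_add, sub_zero] at h3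
    refine le_trans (le_of_eq ?_) h3
    rw [integral_map (f := fun q => (covariatePart w v P q - g q + m) ^ 2) hT.aemeasurable
      (((hcm.sub hgm).add_const m).pow_const 2).aestronglyMeasurable]
    refine integral_congr_ae (Eventually.of_forall fun o => ?_)
    simp only [typeCov]
    ring

/-- Bounded scores approximate the efficient influence function. -/
theorem exists_boundedScore (hP : LawConditions P w e c)
    (hr : MemLp (weightedResidual w (outcomeReg P)) 2 P)
    (hm : MemLp (weightedRegression w (outcomeReg P)) 2 P) {δ : ℝ} (hδ : 0 < δ) :
    ∃ (sY : Obs M X → ℝ) (sX : ∀ k, X k → ℝ) (B : ℝ), IsBoundedScore P sY sX B ∧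
      ∫ o, (effInfluence w v e P o - boundedScore sY sX o) ^ 2 ∂P < δ := by
  -- The square of a sum of two errors costs a factor 2 for each, so `δ / 4` apiece gives `δ`.
  obtain ⟨sY, B₁, h1, h2, h3, h4⟩ := exists_outcome_score (v := v) hP hr (δ := δ / 4) (by linarith)
  obtain ⟨sX, B₂, h5, h6, h7, hX, h8⟩ := exists_covariate_score (v := v) hP hr hm (δ := δ / 4)
    (by linarith)
  have hs : IsBoundedScore P sY sX (max B₁ B₂) :=
    ⟨h1, h5, fun o => (h2 o).trans (le_max_left _ _), fun k x => (h6 k x).trans (le_max_right _ _),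
      h3, h7⟩
  refine ⟨sY, sX, max B₁ B₂, hs, ?_⟩
  have hY := hP.memLp_outcomePart (v := v) hr
  have i1 : MemLp (fun o => outcomePart w v e P o - sY o) 2 P :=
    hY.sub (MemLp.of_bound h1.aestronglyMeasurable B₁ (Eventually.of_forall h2))
  have i2 : MemLp (fun o => covariatePart w v P (typeCov o) - sX o.1 o.2.2.2) 2 P :=
    hX.sub (MemLp.of_bound hs.measurable_sX_obs.aestronglyMeasurable B₂
      (Eventually.of_forall fun o => h6 _ _))
  calc _ ≤ ∫ o, (2 * (outcomePart w v e P o - sY o) ^ 2 +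
        2 * (covariatePart w v P (typeCov o) - sX o.1 o.2.2.2) ^ 2) ∂P := by
        refine integral_mono (((hP.memLp_effInfluence hr hm).sub hs.memLp).integrable_sq)
          ((i1.integrable_sq.const_mul 2).add (i2.integrable_sq.const_mul 2)) fun o => ?_
        refine le_trans (le_of_eq ?_) (add_sq_le_two_mul _ _)
        simp only [effInfluence_eq_add, boundedScore]
        ring
    _ < δ := by
        rw [integral_add (i1.integrable_sq.const_mul 2) (i2.integrable_sq.const_mul 2),
          integral_const_mul, integral_const_mul]
        linarith

theorem IsRegularSubmodel.mono {𝓞 : Type*} [MeasurableSpace 𝓞] {𝓜 𝓜' : Set (Measure 𝓞)}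
    {𝓗 : Set (𝓞 → ℝ)} {P : Measure 𝓞} {d : ℕ} {Q : (Fin d → ℝ) → Measure 𝓞} {η₀ : Fin d → ℝ}
    {s : 𝓞 → Fin d → ℝ} (h : IsRegularSubmodel 𝓜 𝓗 P Q η₀ s) (h𝓜 : 𝓜 ⊆ 𝓜') :
    IsRegularSubmodel 𝓜' 𝓗 P Q η₀ s :=
  { h with mem_model := h.mem_model.mono fun _ hη => h𝓜 hη }

theorem LawConditions.submodelGradient_eq (hP : LawConditions P w e c)
    (hv : ∀ k, ContDiffOn ℝ 1 (v k) (Set.Ioc 0 1)) {d : ℕ}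
    {Q : (Fin d → ℝ) → Measure (Obs M X)} {η₀ : Fin d → ℝ} {s : Obs M X → Fin d → ℝ}
    (hQ : IsRegularSubmodel (modelNP w c) (momentFunctions w P) P Q η₀ s) (j : Fin d) :
    submodelGradient (estimand w v) Q η₀ j = ∫ o, effInfluence w v e P o * s o j ∂P := by
  rw [submodelGradient, (hP.hasFDerivAt_estimand hv hQ).fderiv]
  simp [_root_.sum_apply, _root_.smul_apply, Pi.single_apply]

/-- The second moment of the efficient influence function is the efficiency bound, whether or not
the propensity score is known. -/
theorem LawConditions.isEfficiencyBound (hP : LawConditions P w e c)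
    (hv : ∀ k, ContDiffOn ℝ 1 (v k) (Set.Ioc 0 1))
    (hr : MemLp (weightedResidual w (outcomeReg P)) 2 P)
    (hm : MemLp (weightedRegression w (outcomeReg P)) 2 P) {𝓜 : Set (Measure (Obs M X))}
    (h1 : modelNPKnown w c e ⊆ 𝓜) (h2 : 𝓜 ⊆ modelNP w c) :
    IsEfficiencyBound 𝓜 (momentFunctions w P) P (estimand w v)
      (∫ o, effInfluence w v e P o ^ 2 ∂P) := by
  have hD := hP.memLp_effInfluence (v := v) hr hm
  refine ⟨fun d Q η₀ s hQ => (hP.hasFDerivAt_estimand hv (hQ.mono h2)).differentiableAt, ?_, ?_⟩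
  · rintro b ⟨d, Q, η₀, s, hQ, rfl⟩
    exact cramerRao_le hQ.score_memLp hD hQ.information_nonsingular
      (hP.submodelGradient_eq hv (hQ.mono h2))
  · intro b hb
    -- The submodel of dimension zero makes every upper bound nonnegative. This excludes below that
    -- the approximating score vanishes in `L²`, where the information would be singular.
    have hb0 : 0 ≤ b := hb ⟨0, _, _, _, isRegularSubmodel_const hr hm (h1 hP.mem_modelNPKnown),
      by simp [dotProduct]⟩
    by_contra! hlt
    -- The tolerance is the assumed gap `∫ D² - b`.
    obtain ⟨sY, sX, B, hs, hδ⟩ := exists_boundedScore (v := v) hP hr hm (sub_pos.2 hlt)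
    set D := effInfluence w v e P
    set s := boundedScore sY sX
    have hsL := hs.memLp
    have iDs := integrable_mul_of_memLp hD hsL
    have e1 : ∫ o, (D o - s o) ^ 2 ∂P =
        ∫ o, D o ^ 2 ∂P - 2 * ∫ o, D o * s o ∂P + ∫ o, s o ^ 2 ∂P := by
      have i4 : Integrable (fun o => D o ^ 2 - 2 * (D o * s o)) P :=
        hD.integrable_sq.sub (iDs.const_mul 2)
      rw [← integral_const_mul, ← integral_sub hD.integrable_sq (iDs.const_mul 2),
        ← integral_add i4 hsL.integrable_sq]
      exact integral_congr_ae (Eventually.of_forall fun o => by simp only; ring)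
    have hs0 : 0 ≤ ∫ o, s o ^ 2 ∂P := integral_nonneg fun o => sq_nonneg _
    have hne : ∫ o, s o ^ 2 ∂P ≠ 0 := fun h0 => by
      have h3 := abs_integral_mul_le hD hsL
      rw [h0, Real.sqrt_zero, mul_zero] at h3
      rw [abs_nonpos_iff.1 h3, h0] at e1
      linarith
    have hsub := hs.isRegularSubmodel hP hr hm h1 hne
    have hle := hb ⟨1, _, _, _, hsub, rfl⟩
    have hg := hP.submodelGradient_eq hv (hsub.mono h2) 0
    set g := submodelGradient (estimand w v)
      (fun η : Fin 1 → ℝ => dens P (tiltDensity sY sX (η 0))) 0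
    set x := (information P fun o (_ : Fin 1) => s o)⁻¹ *ᵥ g with hx
    have hIx : information P (fun o (_ : Fin 1) => s o) *ᵥ x = g := by
      rw [hx, Matrix.mulVec_mulVec, Matrix.mul_nonsing_inv _ hsub.information_nonsingular,
        Matrix.one_mulVec]
    have hIx0 := congrFun hIx 0
    simp only [Matrix.mulVec, dotProduct, information, Matrix.of_apply, Finset.univ_unique,
      Fin.default_eq_zero, Finset.sum_singleton, ← sq] at hIx0 hle
    rw [← hIx0] at hle hg
    rw [← hg] at e1
    have hpos := lt_of_le_of_ne hs0 hne.symm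
    -- With `S = ∫ s²` and `x S = ∫ D s`, the Cramér–Rao bound gives `x² S ≤ b`, and the
    -- approximation gives `b < 2 x S - S`. Together they contradict `S (x - 1)² ≥ 0`.
    nlinarith [mul_nonneg hs0 (sq_nonneg (x 0 - 1))]

end EfficiencyBound

/-! ### Stochastic order symbols -/

section StochasticOrder

variable {Ω : Type*} [MeasurableSpace Ω] {Pr : Measure Ω}

/-- The filter of sets that contain `(N, ω)` with probability tending to one; convergence in
probability is convergence along this filter. -/
def inProb (Pr : Measure Ω) : Filter (ℕ × Ω) where
  sets := {S | Tendsto (fun N => Pr {ω | (N, ω) ∉ S}) atTop (𝓝 0)}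
  univ_sets := by simp
  sets_of_superset {S T} hS hST := by
    refine tendsto_of_tendsto_of_tendsto_of_le_of_le tendsto_const_nhds hS (fun _ => zero_le)
      fun N => measure_mono fun ω hω h => hω (hST h)
  inter_sets {S T} hS hT := by
    have h : Tendsto (fun N => Pr {ω | (N, ω) ∉ S} + Pr {ω | (N, ω) ∉ T}) atTop (𝓝 0) := by
      simpa using Tendsto.add hS hT
    refine tendsto_of_tendsto_of_tendsto_of_le_of_le tendsto_const_nhds h (fun _ => zero_le)
      fun N => (measure_mono fun ω hω => ?_).trans (measure_union_le _ _)
    by_contra hc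
    simp only [Set.mem_union, Set.mem_ofPred_eq, not_or, not_not] at hc
    exact hω ⟨hc.1, hc.2⟩

theorem eventually_inProb {p : ℕ × Ω → Prop} :
    (∀ᶠ q in inProb Pr, p q) ↔ Tendsto (fun N => Pr {ω | ¬ p (N, ω)}) atTop (𝓝 0) := Iff.rfl

theorem eventually_inProb_of_ae {p : ℕ × Ω → Prop} (h : ∀ᵐ ω ∂Pr, ∀ N, p (N, ω)) :
    ∀ᶠ q in inProb Pr, p q := by
  rw [eventually_inProb]
  have : ∀ N, Pr {ω | ¬ p (N, ω)} = 0 := fun N => ae_iff.1 (h.mono fun ω hω => hω N)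
  simp [this]

theorem tendsto_fst_inProb : Tendsto Prod.fst (inProb Pr) atTop := by
  intro S hS
  refine tendsto_const_nhds.congr' ?_
  filter_upwards [hS] with N hN
  have : {ω : Ω | (N, ω) ∉ (Prod.fst ⁻¹' S : Set (ℕ × Ω))} = ∅ := by
    ext ω
    simpa using hN
  rw [this, measure_empty]

theorem tendstoInMeasure_iff_inProb {E : Type*} [PseudoMetricSpace E] {f : ℕ → Ω → E} {c : E} :
    TendstoInMeasure Pr f atTop (fun _ => c) ↔
      Tendsto (fun q : ℕ × Ω => f q.1 q.2) (inProb Pr) (𝓝 c) := by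
  rw [tendstoInMeasure_iff_dist, Metric.tendsto_nhds]
  refine forall₂_congr fun ε _ => ?_
  rw [eventually_inProb]
  simp only [not_lt]

/-- Stochastic boundedness, expressed by `O_p(1) o_p(1) = o_p(1)`. -/
def IsOp (Pr : Measure Ω) (Z : ℕ × Ω → ℝ) : Prop :=
  ∀ X : ℕ × Ω → ℝ, Tendsto X (inProb Pr) (𝓝 0) →
    Tendsto (fun q => X q * Z q) (inProb Pr) (𝓝 0)

theorem IsOp.add {Z Z' : ℕ × Ω → ℝ} (h : IsOp Pr Z) (h' : IsOp Pr Z') :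
    IsOp Pr fun q => Z q + Z' q := fun X hX => by
  simpa [mul_add] using (h X hX).add (h' X hX)

theorem IsOp.sum {ι : Type*} {s : Finset ι} {Z : ι → ℕ × Ω → ℝ} (h : ∀ i ∈ s, IsOp Pr (Z i)) :
    IsOp Pr fun q => ∑ i ∈ s, Z i q := fun X hX => by
  simp_rw [Finset.mul_sum]
  simpa using tendsto_finsetSum s fun i hi => h i hi X hX

theorem IsOp.const_mul {Z : ℕ × Ω → ℝ} (h : IsOp Pr Z) (a : ℝ) : IsOp Pr fun q => a * Z q :=
  fun X hX => by
    refine ((h X hX).const_mul a).congr (fun q => by ring) |>.trans ?_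
    rw [mul_zero]

theorem IsOp.of_abs_le {Z Z' : ℕ × Ω → ℝ} (h : IsOp Pr Z)
    (hle : ∀ᶠ q in inProb Pr, |Z' q| ≤ |Z q|) : IsOp Pr Z' := fun X hX => by
  refine squeeze_zero_norm' ?_ (by simpa using (h X hX).norm)
  filter_upwards [hle] with q hq
  rw [norm_mul]
  simp only [Real.norm_eq_abs]
  exact mul_le_mul_of_nonneg_left hq (abs_nonneg _)

theorem IsOp.abs {Z : ℕ × Ω → ℝ} (h : IsOp Pr Z) : IsOp Pr fun q => |Z q| :=
  h.of_abs_le (Eventually.of_forall fun q => by simp)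

/-- Chebyshev-type bounds imply stochastic boundedness. -/
theorem isOp_of_measure_le {Z : ℕ × Ω → ℝ} {A : ℝ}
    (h : ∀ C : ℝ, 0 < C → ∀ᶠ N in atTop, Pr {ω | C ≤ |Z (N, ω)|} ≤ ENNReal.ofReal (A / C ^ 2)) :
    IsOp Pr Z := by
  intro X hX
  rw [Metric.tendsto_nhds] at hX ⊢
  intro ε hε
  rw [eventually_inProb, ENNReal.tendsto_nhds_zero]
  intro δ hδ
  have h1 : Tendsto (fun C : ℝ => ENNReal.ofReal (A / C ^ 2)) atTop (𝓝 0) := by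
    have : Tendsto (fun C : ℝ => A / C ^ 2) atTop (𝓝 0) :=
      tendsto_const_nhds.div_atTop (tendsto_pow_atTop (by norm_num))
    simpa using ENNReal.tendsto_ofReal this
  have hδ2 : 0 < δ / 2 := ENNReal.half_pos hδ.ne'
  -- `Z` exceeds `C` with probability at most `δ / 2`, and `X` is eventually below `ε / C` outside
  -- an event of the same size.
  obtain ⟨C, hC0, hC⟩ := ((eventually_gt_atTop (0 : ℝ)).and
    ((ENNReal.tendsto_nhds_zero.1 h1) (δ / 2) hδ2)).exists
  have h2 := eventually_inProb.1 (hX (ε / C) (div_pos hε hC0))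
  filter_upwards [h C hC0, (ENNReal.tendsto_nhds_zero.1 h2) (δ / 2) hδ2] with N h3 h4
  calc _ ≤ Pr ({ω | ¬ dist (X (N, ω)) 0 < ε / C} ∪ {ω | C ≤ |Z (N, ω)|}) := by
        refine measure_mono fun ω hω => ?_
        by_contra hc
        simp only [Set.mem_union, Set.mem_ofPred_eq, not_or, not_not, not_le,
          Real.dist_eq, sub_zero] at hc hω
        refine hω ?_
        rw [abs_mul]
        calc |X (N, ω)| * |Z (N, ω)| ≤ |X (N, ω)| * C := by gcongr; exact hc.2.le
          _ < ε / C * C := by gcongr; exact hc.1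
          _ = ε := div_mul_cancel₀ _ hC0.ne'
    _ ≤ _ := measure_union_le _ _
    _ ≤ δ / 2 + δ / 2 := add_le_add h4 (h3.trans hC)
    _ = δ := ENNReal.add_halves δ

end StochasticOrder

/-! ### Averages of independent copies -/

section Average

variable {Ω 𝓞 : Type*} [MeasurableSpace Ω] [MeasurableSpace 𝓞] {Pr : Measure Ω}
  [IsProbabilityMeasure Pr] {O : ℕ → Ω → 𝓞} {P : Measure 𝓞}

/-- The average of `f` over the first `N` observations. -/
def avg {E : Type*} [AddCommGroup E] [Module ℝ E] (O : ℕ → Ω → 𝓞) (f : 𝓞 → E) (q : ℕ × Ω) : E :=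
  (q.1 : ℝ)⁻¹ • ∑ i ∈ Finset.range q.1, f (O i q.2)

/-- `O 0, O 1, …` are independent with law `P`. -/
structure IsSample (Pr : Measure Ω) (O : ℕ → Ω → 𝓞) (P : Measure 𝓞) : Prop where
  measurable : ∀ i, Measurable (O i)
  map_eq : ∀ i, Pr.map (O i) = P
  indep : iIndepFun O Pr

theorem IsSample.identDistrib (h : IsSample Pr O P) (i : ℕ) : IdentDistrib (O i) (O 0) Pr Pr :=
  ⟨(h.measurable i).aemeasurable, (h.measurable 0).aemeasurable, by rw [h.map_eq, h.map_eq]⟩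

theorem IsSample.ae (h : IsSample Pr O P) {p : 𝓞 → Prop} (hp : ∀ᵐ o ∂P, p o) :
    ∀ᵐ ω ∂Pr, ∀ i, p (O i ω) := by
  refine ae_all_iff.2 fun i => ?_
  rw [← h.map_eq i] at hp
  exact ae_of_ae_map (h.measurable i).aemeasurable hp

/-- Weak law of large numbers. -/
theorem IsSample.tendsto_avg (h : IsSample Pr O P) {E : Type*} [NormedAddCommGroup E]
    [NormedSpace ℝ E] [CompleteSpace E] {f : 𝓞 → E} (hf : Integrable f P) :
    Tendsto (avg O f) (inProb Pr) (𝓝 (∫ o, f o ∂P)) := by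
  borelize E
  have hfi : ∀ i, AEStronglyMeasurable f (Pr.map (O i)) := fun i => by rw [h.map_eq i]; exact hf.1
  have hm : ∀ i, AEStronglyMeasurable (fun ω => f (O i ω)) Pr := fun i =>
    (hfi i).comp_measurable (h.measurable i)
  have h0 : Integrable (fun ω => f (O 0 ω)) Pr := by
    rw [← h.map_eq 0] at hf
    exact hf.comp_measurable (h.measurable 0)
  have hind : iIndepFun (fun i ω => f (O i ω)) Pr :=
    h.indep.comp₀ (fun _ => f) (fun i => (h.measurable i).aemeasurable)
      (fun i => (hfi i).aemeasurable)
  have hid : ∀ i, IdentDistrib (fun ω => f (O i ω)) (fun ω => f (O 0 ω)) Pr Pr := fun i =>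
    (h.identDistrib i).comp_of_aemeasurable (hfi i).aemeasurable
  have h1 := strong_law_ae (fun i ω => f (O i ω)) h0 (fun i j hij => hind.indepFun hij) hid
  have h2 : ∫ ω, f (O 0 ω) ∂Pr = ∫ o, f o ∂P := by
    rw [← h.map_eq 0, integral_map (h.measurable 0).aemeasurable (hfi 0)]
  rw [h2] at h1
  refine (tendstoInMeasure_iff_inProb (f := fun N ω => avg O f (N, ω))).1 ?_
  refine tendstoInMeasure_of_tendsto_ae (fun N => ?_) h1
  have h3 : AEStronglyMeasurable (fun ω => ∑ i ∈ Finset.range N, f (O i ω)) Pr :=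
    Finset.aestronglyMeasurable_fun_sum _ fun i _ => hm i
  exact h3.const_smul (N : ℝ)⁻¹

/-- Averages of centred square-integrable variables are of order `N^{-1/2}`. -/
theorem IsSample.isOp_sqrt_mul_avg (h : IsSample Pr O P) {f : 𝓞 → ℝ} (hf : MemLp f 2 P)
    (h0 : ∫ o, f o ∂P = 0) : IsOp Pr fun q => √(q.1 : ℝ) * avg O f q := by
  have hfi : ∀ i, AEStronglyMeasurable f (Pr.map (O i)) := fun i => by rw [h.map_eq i]; exact hf.1
  have hL : ∀ i, MemLp (fun ω => f (O i ω)) 2 Pr := fun i => by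
    have := hf
    rw [← h.map_eq i] at this
    exact this.comp_of_map (h.measurable i).aemeasurable
  have hind : iIndepFun (fun i ω => f (O i ω)) Pr :=
    h.indep.comp₀ (fun _ => f) (fun i => (h.measurable i).aemeasurable)
      (fun i => (hfi i).aemeasurable)
  have hE : ∀ i, ∫ ω, f (O i ω) ∂Pr = 0 := fun i => by
    rw [← integral_map (h.measurable i).aemeasurable (hfi i), h.map_eq i, h0]
  have hV : ∀ i, Var[fun ω => f (O i ω); Pr] = ∫ o, f o ^ 2 ∂P := fun i => by
    rw [variance_of_integral_eq_zero (hL i).1.aemeasurable (hE i), ← h.map_eq i,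
      integral_map (f := fun o => f o ^ 2) (h.measurable i).aemeasurable ((hfi i).pow 2)]
  have hS : ∀ N, MemLp (fun ω => ∑ i ∈ Finset.range N, f (O i ω)) 2 Pr := fun N =>
    memLp_finsetSum _ fun i _ => hL i
  have hSV : ∀ N : ℕ, Var[fun ω => ∑ i ∈ Finset.range N, f (O i ω); Pr] =
      N * ∫ o, f o ^ 2 ∂P := fun N => by
    have := IndepFun.variance_sum (s := Finset.range N) (fun i _ => hL i)
      (fun i _ j _ hij => hind.indepFun hij)
    rw [show (∑ i ∈ Finset.range N, fun ω => f (O i ω)) =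
      fun ω => ∑ i ∈ Finset.range N, f (O i ω) from by ext; simp] at this
    rw [this]
    simp [hV]
  refine isOp_of_measure_le (A := ∫ o, f o ^ 2 ∂P) fun C hC => ?_
  filter_upwards [eventually_gt_atTop 0] with N hN
  have hN' : (0 : ℝ) < N := Nat.cast_pos.2 hN
  have h1 := meas_ge_le_variance_div_sq (hS N) (c := C * √N) (by positivity)
  have h2 : ∫ ω, ∑ i ∈ Finset.range N, f (O i ω) ∂Pr = 0 := by
    rw [integral_finsetSum _ fun i _ => (hL i).integrable (by norm_num)]
    simp [hE]
  rw [h2, hSV, mul_pow, Real.sq_sqrt hN'.le, mul_comm (C ^ 2), mul_div_mul_left _ _ hN'.ne'] at h1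
  refine le_trans (measure_mono fun ω hω => ?_) h1
  simp only [Set.mem_ofPred_eq, sub_zero, avg, smul_eq_mul, ← mul_assoc] at hω ⊢
  rw [abs_mul, abs_of_nonneg (by positivity)] at hω
  have h3 : √(N : ℝ) * (N : ℝ)⁻¹ = (√N)⁻¹ := by
    rw [← Real.sqrt_div_self, div_eq_mul_inv]
  rw [h3, ← div_eq_inv_mul, le_div_iff₀ (by positivity)] at hω
  exact hω

/-- Central limit theorem for centred averages. -/
theorem IsSample.tendstoInDistribution_avg (h : IsSample Pr O P) {f : 𝓞 → ℝ} (hf : MemLp f 2 P)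
    (h0 : ∫ o, f o ∂P = 0) :
    TendstoInDistribution (fun (N : ℕ) ω => √(N : ℝ) * avg O f (N, ω)) atTop id (fun _ => Pr)
      (gaussianReal 0 (∫ o, f o ^ 2 ∂P).toNNReal) := by
  have hfi : ∀ i, AEStronglyMeasurable f (Pr.map (O i)) := fun i => by rw [h.map_eq i]; exact hf.1
  have hL : MemLp (fun ω => f (O 0 ω)) 2 Pr := by
    have := hf
    rw [← h.map_eq 0] at this
    exact this.comp_of_map (h.measurable 0).aemeasurable
  have hind : iIndepFun (fun i ω => f (O i ω)) Pr :=
    h.indep.comp₀ (fun _ => f) (fun i => (h.measurable i).aemeasurable)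
      (fun i => (hfi i).aemeasurable)
  have hE : ∫ ω, f (O 0 ω) ∂Pr = 0 := by
    rw [← integral_map (h.measurable 0).aemeasurable (hfi 0), h.map_eq 0, h0]
  have hV : Var[fun ω => f (O 0 ω); Pr] = ∫ o, f o ^ 2 ∂P := by
    rw [variance_of_integral_eq_zero hL.1.aemeasurable hE, ← h.map_eq 0,
      integral_map (f := fun o => f o ^ 2) (h.measurable 0).aemeasurable ((hfi 0).pow 2)]
  have hid : ∀ i, IdentDistrib (fun ω => f (O i ω)) (fun ω => f (O 0 ω)) Pr Pr := fun i =>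
    (h.identDistrib i).comp_of_aemeasurable (hfi i).aemeasurable
  have h1 := tendstoInDistribution_inv_sqrt_mul_sum_sub (X := fun i ω => f (O i ω)) (Y := id)
    (P := Pr) (P' := gaussianReal 0 (∫ o, f o ^ 2 ∂P).toNNReal)
    (by rw [hV]; exact HasLaw.id) hL hind hid
  refine h1.congr (fun N => Eventually.of_forall fun ω => ?_) ?_
  · simp only [hE, avg, smul_eq_mul, ← mul_assoc, mul_zero, sub_zero]
    rw [← div_eq_mul_inv, Real.sqrt_div_self]
  · rfl

end Average

/-! ### Taylor expansion of the estimating function -/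

/-- Apply the mean value inequality twice: to the derivative on the ball, and to the function minus
its linear part on the segment. The usual factor 1/2 is not needed. -/
theorem norm_taylor_sub_le {E F : Type*} [NormedAddCommGroup E] [NormedSpace ℝ E]
    [NormedAddCommGroup F] [NormedSpace ℝ F] {f : E → F} {z₀ : E} {r H : ℝ}
    (hf : ContDiffOn ℝ 2 f (Metric.ball z₀ r))
    (hH : ∀ z ∈ Metric.ball z₀ r, ‖iteratedFDeriv ℝ 2 f z‖ ≤ H) {z : E}
    (hz : z ∈ Metric.ball z₀ r) :
    ‖f z - f z₀ - fderiv ℝ f z₀ (z - z₀)‖ ≤ H * ‖z - z₀‖ ^ 2 := by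
  have hr : z₀ ∈ Metric.ball z₀ r := Metric.mem_ball_self (dist_nonneg.trans_lt hz)
  have hH0 : 0 ≤ H := (norm_nonneg _).trans (hH z hz)
  have hfd : ContDiffOn ℝ 1 (fderiv ℝ f) (Metric.ball z₀ r) :=
    hf.fderiv_of_isOpen Metric.isOpen_ball (by norm_num)
  have h2 : ∀ y ∈ Metric.ball z₀ r, ‖fderiv ℝ (fderiv ℝ f) y‖ ≤ H := fun y hy => by
    rw [← norm_iteratedFDeriv_one, norm_iteratedFDeriv_fderiv]
    exact hH y hy
  have h3 : ∀ y ∈ Metric.ball z₀ r, ‖fderiv ℝ f y - fderiv ℝ f z₀‖ ≤ H * ‖y - z₀‖ := fun y hy =>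
    (convex_ball z₀ r).norm_image_sub_le_of_norm_fderiv_le
      (fun x hx => (hfd.differentiableOn (by norm_num)).differentiableAt
        (Metric.isOpen_ball.mem_nhds hx)) h2 hr hy
  have hsub : ∀ y ∈ segment ℝ z₀ z, y ∈ Metric.ball z₀ r ∧ ‖y - z₀‖ ≤ ‖z - z₀‖ := fun y hy => by
    refine ⟨(convex_ball z₀ r).segment_subset hr hz hy, ?_⟩
    rw [← dist_eq_norm, ← dist_eq_norm]
    have := (convex_closedBall z₀ (dist z z₀)).segment_subset
      (Metric.mem_closedBall_self dist_nonneg) (Metric.mem_closedBall.2 le_rfl) hy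
    exact Metric.mem_closedBall.1 this
  have h4 := (convex_segment (𝕜 := ℝ) z₀ z).norm_image_sub_le_of_norm_fderiv_le'
    (f := f) (φ := fderiv ℝ f z₀) (C := H * ‖z - z₀‖)
    (fun x hx => (hf.differentiableOn (by norm_num)).differentiableAt
        (Metric.isOpen_ball.mem_nhds (hsub x hx).1))
    (fun x hx => (h3 x (hsub x hx).1).trans
      (mul_le_mul_of_nonneg_left (hsub x hx).2 hH0))
    (left_mem_segment ℝ z₀ z) (right_mem_segment ℝ z₀ z)
  refine h4.trans (le_of_eq ?_)
  ring

section Expansion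

variable {𝓞 : Type*} [MeasurableSpace 𝓞] {K de dg : ℕ} {P : Measure 𝓞}
  {Ψ : Par K de dg → 𝓞 → Par K de dg} {Ω₀ : Set (Par K de dg)} {z₀ : Par K de dg}

theorem RegularityConditions.exists_taylor (hR : RegularityConditions P Ψ Ω₀ z₀) :
    ∃ r > 0, ∃ H : 𝓞 → ℝ, Integrable H P ∧ ∀ᵐ o ∂P, ∀ z ∈ Metric.ball z₀ r,
      ‖Ψ z o - Ψ z₀ o - fderiv ℝ (fun z => Ψ z o) z₀ (z - z₀)‖ ≤ H o * ‖z - z₀‖ ^ 2 := by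
  obtain ⟨U, hU, H, hH, hd⟩ := hR.dominated
  obtain ⟨r, hr, hsub⟩ := Metric.mem_nhds_iff.1 (inter_mem hU (hR.isOpen.mem_nhds hR.mem))
  refine ⟨r, hr, H, hH, ?_⟩
  filter_upwards [hd, hR.contDiff] with o h1 h2 z hz
  exact norm_taylor_sub_le (f := fun z => Ψ z o) (h2.mono fun y hy => (hsub hy).2)
    (fun y hy => h1 y (hsub hy).1) hz

/-- Integrate the pointwise expansion. The dominated remainder also yields integrability of `Ψ z`
away from the root, where it is not among the regularity conditions. -/
theorem norm_integral_taylor_le [IsFiniteMeasure P] {J : 𝓞 → Par K de dg →L[ℝ] Par K de dg}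
    {H : 𝓞 → ℝ} {z : Par K de dg} (hz₀ : Integrable (Ψ z₀) P) (hJ : Integrable J P)
    (hH : Integrable H P) (hm : AEStronglyMeasurable (Ψ z) P)
    (h : ∀ᵐ o ∂P, ‖Ψ z o - Ψ z₀ o - J o (z - z₀)‖ ≤ H o * ‖z - z₀‖ ^ 2) :
    Integrable (Ψ z) P ∧
      ‖∫ o, Ψ z o ∂P - ∫ o, Ψ z₀ o ∂P - (∫ o, J o ∂P) (z - z₀)‖ ≤
        (∫ o, H o ∂P) * ‖z - z₀‖ ^ 2 := by
  have hJz : Integrable (fun o => J o (z - z₀)) P := hJ.apply_continuousLinearMap _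
  have hrem : Integrable (fun o => Ψ z o - Ψ z₀ o - J o (z - z₀)) P :=
    (hH.mul_const (‖z - z₀‖ ^ 2)).mono' ((hm.sub hz₀.1).sub hJz.1) h
  have hz : Integrable (Ψ z) P := by
    refine ((hrem.add hJz).add hz₀).congr (Eventually.of_forall fun o => ?_)
    simp only [Pi.add_apply]
    abel
  refine ⟨hz, ?_⟩
  have hd : Integrable (fun o => Ψ z o - Ψ z₀ o) P := hz.sub hz₀
  rw [ContinuousLinearMap.integral_apply hJ, ← integral_sub hz hz₀, ← integral_sub hd hJz,
    ← integral_mul_const]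
  exact norm_integral_le_of_norm_le (hH.mul_const _) h

theorem norm_avg_taylor_le {Ω : Type*} {O : ℕ → Ω → 𝓞}
    {J : 𝓞 → Par K de dg →L[ℝ] Par K de dg} {H : 𝓞 → ℝ} {z : Par K de dg} {q : ℕ × Ω}
    (h : ∀ i, ‖Ψ z (O i q.2) - Ψ z₀ (O i q.2) - J (O i q.2) (z - z₀)‖ ≤
      H (O i q.2) * ‖z - z₀‖ ^ 2) :
    ‖avg O (Ψ z) q - avg O (Ψ z₀) q - avg O J q (z - z₀)‖ ≤ avg O H q * ‖z - z₀‖ ^ 2 := by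
  have e1 : avg O (Ψ z) q - avg O (Ψ z₀) q - avg O J q (z - z₀) = (q.1 : ℝ)⁻¹ •
      ∑ i ∈ Finset.range q.1, (Ψ z (O i q.2) - Ψ z₀ (O i q.2) - J (O i q.2) (z - z₀)) := by
    simp only [avg, Finset.sum_sub_distrib, smul_sub, _root_.smul_apply, _root_.sum_apply]
  rw [e1, norm_smul, Real.norm_of_nonneg (by positivity), avg, smul_eq_mul, mul_assoc,
    Finset.sum_mul]
  exact mul_le_mul_of_nonneg_left (norm_sum_le_of_le _ fun i _ => h i) (by positivity)

end Expansion

/-! ### Expansion at the estimated nuisance parameter -/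

section RootExpansion

variable {Ω 𝓞 : Type*} [MeasurableSpace Ω] [MeasurableSpace 𝓞] {Pr : Measure Ω}
  [IsProbabilityMeasure Pr] {O : ℕ → Ω → 𝓞} {P : Measure 𝓞} [IsProbabilityMeasure P]
  {K de dg : ℕ}

theorem norm_le_sum_abs {n : ℕ} (x : Fin n → ℝ) : ‖x‖ ≤ ∑ i, |x i| :=
  (pi_norm_le_iff_of_nonneg (Finset.sum_nonneg fun _ _ => abs_nonneg _)).2 fun i =>
    Finset.single_le_sum (f := fun i => |x i|) (fun _ _ => abs_nonneg _) (Finset.mem_univ i)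

theorem avg_clm {E F : Type*} [NormedAddCommGroup E] [NormedSpace ℝ E] [NormedAddCommGroup F]
    [NormedSpace ℝ F] (L : E →L[ℝ] F) (f : 𝓞 → E) (q : ℕ × Ω) :
    avg O (fun o => L (f o)) q = L (avg O f q) := by
  simp [avg]

theorem IsSample.isOp_sqrt_mul_clm_avg (h : IsSample Pr O P) {E : Type*} [NormedAddCommGroup E]
    [NormedSpace ℝ E] [CompleteSpace E] {f : 𝓞 → E} (hf : MemLp f 2 P) (h0 : ∫ o, f o ∂P = 0)
    (L : E →L[ℝ] ℝ) : IsOp Pr fun q => √(q.1 : ℝ) * L (avg O f q) := by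
  have h1 : MemLp (fun o => L (f o)) 2 P := L.comp_memLp' hf
  have h2 : ∫ o, L (f o) ∂P = 0 := by
    rw [L.integral_comp_comm (hf.integrable (by norm_num)), h0, map_zero]
  simpa only [avg_clm] using h.isOp_sqrt_mul_avg h1 h2

theorem IsSample.isOp_sqrt_mul_norm_avg (h : IsSample Pr O P) {f : 𝓞 → Par K de dg}
    (hf : MemLp f 2 P) (h0 : ∫ o, f o ∂P = 0) : IsOp Pr fun q => √(q.1 : ℝ) * ‖avg O f q‖ := by
  have h1 := h.isOp_sqrt_mul_clm_avg hf h0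
  have hA : IsOp Pr fun q => ∑ i, |√(q.1 : ℝ) * (avg O f q).1 i| := IsOp.sum fun i _ =>
    (h1 ((ContinuousLinearMap.proj i).comp (ContinuousLinearMap.fst ℝ _ _))).abs
  have hB : IsOp Pr fun q => ∑ i, |√(q.1 : ℝ) * (avg O f q).2.1 i| := IsOp.sum fun i _ =>
    (h1 ((ContinuousLinearMap.proj i).comp ((ContinuousLinearMap.fst ℝ _ _).comp
      (ContinuousLinearMap.snd ℝ _ _)))).abs
  have hC : IsOp Pr fun q => ∑ i, |√(q.1 : ℝ) * (avg O f q).2.2 i| := IsOp.sum fun i _ =>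
    (h1 ((ContinuousLinearMap.proj i).comp ((ContinuousLinearMap.snd ℝ _ _).comp
      (ContinuousLinearMap.snd ℝ _ _)))).abs
  refine ((hA.add hB).add hC).of_abs_le (Eventually.of_forall fun q => ?_)
  have hs := Real.sqrt_nonneg (q.1 : ℝ)
  simp only [abs_mul, abs_of_nonneg hs, ← Finset.mul_sum, ← mul_add, abs_norm]
  rw [abs_of_nonneg (by positivity)]
  refine mul_le_mul_of_nonneg_left ?_ hs
  have a1 := norm_le_sum_abs (avg O f q).1
  have a2 := norm_le_sum_abs (avg O f q).2.1
  have a3 := norm_le_sum_abs (avg O f q).2.2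
  have b1 := norm_nonneg (avg O f q).1
  have b2 := norm_nonneg (avg O f q).2.1
  have b3 := norm_nonneg (avg O f q).2.2
  rw [Prod.norm_def, Prod.norm_def]
  exact max_le (by linarith) (max_le (by linarith) (by linarith))

variable {Ψ : Par K de dg → 𝓞 → Par K de dg} {Ω₀ : Set (Par K de dg)} {θ₀ : Fin K → ℝ}
  {β₀ : Nuis de dg}

/-- If the expected Jacobian of the `θ`-components in the direction of the nuisance parameter
vanishes, then estimating the nuisance parameter has no first-order effect on the
`θ`-components. -/
theorem RegularityConditions.tendsto_sqrt_mul_norm_sub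
    (hR : RegularityConditions P Ψ Ω₀ (θ₀, β₀)) (h : IsSample Pr O P)
    (hJ : ∀ b, ((∫ o, fderiv ℝ (fun z => Ψ z o) (θ₀, β₀) ∂P) (0, b)).1 = 0)
    {βhat : ℕ → Ω → Nuis de dg}
    (hβ : Tendsto (fun q : ℕ × Ω => βhat q.1 q.2) (inProb Pr) (𝓝 β₀))
    (hroot : ∀ᶠ q in inProb Pr, (avg O (Ψ (θ₀, βhat q.1 q.2)) q).2 = 0) :
    Tendsto (fun q : ℕ × Ω => √(q.1 : ℝ) *
      ‖(avg O (Ψ (θ₀, βhat q.1 q.2)) q - avg O (Ψ (θ₀, β₀)) q).1‖) (inProb Pr) (𝓝 0) := by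
  obtain ⟨r, hr, H, hH, hT⟩ := hR.exists_taylor
  set D : 𝓞 → Par K de dg →L[ℝ] Par K de dg := fun o => fderiv ℝ (fun z => Ψ z o) (θ₀, β₀)
  set J := ∫ o, D o ∂P with hJdef
  obtain ⟨u, hu⟩ := hR.jacobian_nonsingular
  change (u : Par K de dg →L[ℝ] Par K de dg) = J at hu
  set κ := ‖((u⁻¹ : (Par K de dg →L[ℝ] Par K de dg)ˣ) : Par K de dg →L[ℝ] Par K de dg)‖ with hκ
  have hκ0 : 0 ≤ κ := norm_nonneg _
  have hinv : ∀ x, ‖x‖ ≤ κ * ‖J x‖ := fun x => by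
    have h1 : ((u⁻¹ : (Par K de dg →L[ℝ] Par K de dg)ˣ) : Par K de dg →L[ℝ] Par K de dg) (J x) = x := by
      rw [← hu, ← mul_apply_eq_comp, Units.inv_mul]
      rfl
    calc ‖x‖ = ‖((u⁻¹ : (Par K de dg →L[ℝ] Par K de dg)ˣ) : Par K de dg →L[ℝ] Par K de dg) (J x)‖ := by
          rw [h1]
      _ ≤ κ * ‖J x‖ := ContinuousLinearMap.le_opNorm _ _
  set b : ℕ × Ω → Nuis de dg := fun q => βhat q.1 q.2 - β₀ with hb
  have hb0 : Tendsto (fun q => ‖b q‖) (inProb Pr) (𝓝 0) := by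
    have := (hβ.sub_const β₀).norm
    simpa using this
  have hJN : Tendsto (fun q => ‖avg O D q - J‖) (inProb Pr) (𝓝 0) := by
    have := ((h.tendsto_avg (f := D) hR.jacobian_integrable).sub_const J).norm
    rwa [← hJdef, sub_self, norm_zero] at this
  have hHN := h.tendsto_avg hH
  -- The error of the linearisation with the expected Jacobian is at most `ρ ‖b‖`: one term is the
  -- Taylor remainder, the other the fluctuation of the empirical Jacobian.
  set ρ : ℕ × Ω → ℝ := fun q => avg O H q * ‖b q‖ + ‖avg O D q - J‖ with hρ
  have hρ0 : Tendsto ρ (inProb Pr) (𝓝 0) := by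
    simpa using (hHN.mul hb0).add hJN
  set Z : ℕ × Ω → Par K de dg := avg O (Ψ (θ₀, β₀))
  have hZ : IsOp Pr fun q => √(q.1 : ℝ) * ‖Z q‖ := h.isOp_sqrt_mul_norm_avg hR.memLp hR.root
  have hTN : ∀ᶠ q in inProb Pr, ‖avg O (Ψ (θ₀, βhat q.1 q.2)) q - Z q - avg O D q (0, b q)‖ ≤
      avg O H q * ‖b q‖ ^ 2 := by
    filter_upwards [eventually_inProb_of_ae (p := fun q : ℕ × Ω => ∀ i, ∀ z ∈ Metric.ball (θ₀, β₀) r,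
      ‖Ψ z (O i q.2) - Ψ (θ₀, β₀) (O i q.2) - D (O i q.2) (z - (θ₀, β₀))‖ ≤
        H (O i q.2) * ‖z - (θ₀, β₀)‖ ^ 2) ((h.ae hT).mono fun ω hω _ => hω),
      hb0.eventually (gt_mem_nhds hr)] with q h1 h2
    have e1 : ((θ₀, βhat q.1 q.2) : Par K de dg) - (θ₀, β₀) = (0, b q) := by simp [hb]
    have e2 : ‖((0, b q) : Par K de dg)‖ = ‖b q‖ := by simp [Prod.norm_def]
    have h3 : ((θ₀, βhat q.1 q.2) : Par K de dg) ∈ Metric.ball (θ₀, β₀) r := by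
      rw [Metric.mem_ball, dist_eq_norm, e1, e2]
      exact h2
    have h4 := norm_avg_taylor_le (O := O) (q := q) (J := D) (H := H) fun i => h1 i _ h3
    rwa [e1, e2] at h4
  -- Since the `θ`-part of `J (0, b)` vanishes, the nuisance equations alone determine its norm, and
  -- invertibility gives `‖b‖ ≤ κ (ρ ‖b‖ + ‖Z‖)`. Once `κ ρ < 1/2` the first term is absorbed. In
  -- the `θ`-components only the linearisation error remains.
  have hkey : ∀ᶠ q in inProb Pr, ‖b q‖ ≤ 2 * κ * ‖Z q‖ ∧
      ‖(avg O (Ψ (θ₀, βhat q.1 q.2)) q - Z q).1‖ ≤ ρ q * ‖b q‖ := by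
    have hκρ : Tendsto (fun q => κ * ρ q) (inProb Pr) (𝓝 0) := by simpa using hρ0.const_mul κ
    filter_upwards [hTN, hroot, hκρ.eventually (gt_mem_nhds (show (0 : ℝ) < 1 / 2 by norm_num))]
      with q h1 h2 h3
    set A := avg O (Ψ (θ₀, βhat q.1 q.2)) q
    set x : Par K de dg := (0, b q) with hx
    have hxn : ‖x‖ = ‖b q‖ := by simp [hx, Prod.norm_def]
    have h4 : ‖(avg O D q - J) x‖ ≤ ‖avg O D q - J‖ * ‖b q‖ := by
      rw [← hxn]
      exact ContinuousLinearMap.le_opNorm _ _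
    set R := A - Z q - J x with hRdef
    have h5 : ‖R‖ ≤ ρ q * ‖b q‖ := by
      have e1 : R = (A - Z q - avg O D q x) + (avg O D q - J) x := by
        rw [hRdef, _root_.sub_apply]
        abel
      rw [e1, hρ]
      refine (norm_add_le _ _).trans ((add_le_add h1 h4).trans (le_of_eq ?_))
      ring
    have h6 : (J x).1 = 0 := hJ (b q)
    constructor
    · have h7 : ‖J x‖ = ‖(J x).2‖ := by
        rw [Prod.norm_def, h6, norm_zero, max_eq_right (norm_nonneg _)]
      have h8 : (J x).2 = -(R.2 + (Z q).2) := by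
        rw [hRdef]
        simp only [Prod.snd_sub, h2]
        abel
      have h9 : ‖J x‖ ≤ ρ q * ‖b q‖ + ‖Z q‖ := by
        rw [h7, h8, norm_neg]
        exact (norm_add_le _ _).trans (add_le_add ((norm_snd_le R).trans h5) (norm_snd_le _))
      have h10 := hinv x
      rw [hxn] at h10
      have h11 := mul_le_mul_of_nonneg_left h9 hκ0
      nlinarith [norm_nonneg (b q)]
    · have e1 : (A - Z q).1 = R.1 := by
        rw [hRdef, Prod.fst_sub (A - Z q), h6, sub_zero]
      rw [e1]
      exact (norm_fst_le R).trans h5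
  -- The nuisance error is of order `N^{-1/2}`, so multiplying it by `ρ → 0` gives the claim.
  have hbOp : IsOp Pr fun q => √(q.1 : ℝ) * ‖b q‖ := by
    refine (hZ.const_mul (2 * κ)).of_abs_le ?_
    filter_upwards [hkey] with q hq
    rw [abs_of_nonneg (by positivity), abs_of_nonneg (by positivity)]
    calc _ ≤ √(q.1 : ℝ) * (2 * κ * ‖Z q‖) := by gcongr; exact hq.1
      _ = _ := by ring
  refine squeeze_zero_norm' ?_ (hbOp ρ hρ0)
  filter_upwards [hkey] with q hq
  rw [Real.norm_of_nonneg (by positivity)]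
  calc _ ≤ √(q.1 : ℝ) * (ρ q * ‖b q‖) := by gcongr; exact hq.2
    _ = _ := by ring

end RootExpansion

/-! ### The augmented inverse probability weighted estimator -/

section Estimator

variable {K : ℕ} {M : Fin K → ℕ} {X : Fin K → Type*} [∀ k, MeasurableSpace (X k)]
  {P : Measure (Obs M X)} [IsProbabilityMeasure P] {w : RegFun M X} {eStar : PropFun M X} {c : ℝ}
  {v : Fin K → ℝ → ℝ} {de dg : ℕ} {e : (Fin de → ℝ) → PropFun M X}
  {g : (Fin dg → ℝ) → RegFun M X}
  {ψe : (Fin de → ℝ) → Obs M X → Fin de → ℝ} {ψg : (Fin dg → ℝ) → Obs M X → Fin dg → ℝ}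
  {Ω₀ : Set (Par K de dg)} {θ₀ : Fin K → ℝ} {β₀ : Nuis de dg}

theorem psiTheta_eq (z : Par K de dg) (o : Obs M X) (k : Fin K) :
    psiTheta w e g z o k = ind k o * (aipwObs w (g z.2.2) (e z.2.1) o - z.1 k) := by
  unfold psiTheta ind aipwObs
  split_ifs <;> simp

theorem measurable_psi (hw : ∀ k a, Measurable (w k a)) (he : ∀ β k a, Measurable (e β k a))
    (hg : ∀ β k a, Measurable (g β k a)) (hψe : ∀ β, Measurable (ψe β))
    (hψg : ∀ β, Measurable (ψg β)) (z : Par K de dg) : Measurable (psi w e g ψe ψg z) := by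
  refine Measurable.prodMk (measurable_pi_lambda _ fun k => ?_)
    ((hψe z.2.1).prodMk (hψg z.2.2))
  simp_rw [psiTheta_eq]
  exact (measurable_ind k).mul ((measurable_aipwObs hw (hg _) (he _)).sub_const _)

theorem aipwObs_ae_eq {g g' : RegFun M X} {e e' : PropFun M X} (hg : RegEq P g g')
    (he : PropEq P e e') : aipwObs w g e =ᵐ[P] aipwObs w g' e' := by
  refine ae_sigma P fun k => ?_
  have h1 : ∀ᵐ z : ClusterObs M X k ∂typeLaw P k, ∀ a, g k a z.2.2 = g' k a z.2.2 :=
    ae_all_iff.2 fun a =>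
      ae_of_ae_map (f := fun o : ClusterObs M X k => o.2.2) (by fun_prop) (hg k a)
  have h2 : ∀ᵐ z : ClusterObs M X k ∂typeLaw P k, ∀ a, e k a z.2.2 = e' k a z.2.2 :=
    ae_all_iff.2 fun a =>
      ae_of_ae_map (f := fun o : ClusterObs M X k => o.2.2) (by fun_prop) (he k a)
  filter_upwards [h1, h2] with z hz1 hz2
  simp only [aipwObs, weightedResidual, weightedRegression, hz1, hz2]

theorem integrable_psiTheta {z : Par K de dg} {Ψ : Obs M X → Par K de dg}
    (h : Integrable Ψ P) (hΨ : ∀ o, (Ψ o).1 = psiTheta w e g z o) (k : Fin K) :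
    Integrable (fun o => ind k o * (aipwObs w (g z.2.2) (e z.2.1) o - z.1 k)) P ∧
      ∫ o, ind k o * (aipwObs w (g z.2.2) (e z.2.1) o - z.1 k) ∂P = (∫ o, Ψ o ∂P).1 k := by
  let L : Par K de dg →L[ℝ] ℝ :=
    (ContinuousLinearMap.proj k).comp (ContinuousLinearMap.fst ℝ (Fin K → ℝ) (Nuis de dg))
  have e1 : ∀ o, L (Ψ o) = ind k o * (aipwObs w (g z.2.2) (e z.2.1) o - z.1 k) := fun o => by
    rw [← psiTheta_eq, ← hΨ]
    rfl
  simp_rw [← e1]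
  exact ⟨L.integrable_comp h, L.integral_comp_comm h⟩

/-- Double robustness. -/
theorem LawConditions.integral_ind_mul_sub (hP : LawConditions P w eStar c) {g : RegFun M X}
    {e : PropFun M X} {t : ℝ} {k : Fin K}
    (hi : Integrable (fun o => ind k o * (aipwObs w g e o - t)) P)
    (h : RegEq P g (outcomeReg P) ∨ PropEq P e eStar) :
    ∫ o, ind k o * (aipwObs w g e o - t) ∂P = typeProb P k * (typeMean w P k - t) := by
  have h2 := Integrable.typeLaw P hi k
  simp only [ind, if_true, one_mul] at h2
  have := isProbabilityMeasure_typeLaw P (hP.typeProb_pos k)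
  have h3 : Integrable (fun z => aipwObs w g e ⟨k, z⟩) (typeLaw P k) := by
    refine (h2.add (integrable_const t)).congr (Eventually.of_forall fun z => ?_)
    simp
  have h4 : ∫ z, aipwObs w g e ⟨k, z⟩ ∂typeLaw P k = typeMean w P k := by
    have h5 : ∫ z, aipwObs w g e ⟨k, z⟩ ∂typeLaw P k =
        ∫ x, ∑ a, w k a x ⬝ᵥ outcomeReg P k a x ∂covLaw P k := by
      rcases h with h | h
      · exact integral_aipw_of_regression (w := w k) (g := g k) (ε := e k)
          (hP.moments.integrable_resp k) (fun a => h k a) h3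
      · refine integral_aipw_of_propensity (w := w k) (g := g k) (ε := e k)
          (hP.moments.integrable_resp k) (fun a => ?_) h3
        filter_upwards [hP.prop_eq k a, h k a] with x h6 h7
        rw [h7]
        exact ⟨h6, (hP.c_pos.trans (hP.overlap k a x).1).ne'⟩
    rw [h5, integral_finsetSum _ fun a _ => hP.weight_integrable k a]
    rfl
  rw [integral_ind_mul, ← typeProb_mul_integral, integral_sub h3 (integrable_const _), h4]
  simp

/-- At correct nuisance values the `θ`-components of `Ψ` are AIPW functions at the true nuisance
functions, up to constants. The second moment of `Ψ` at the root therefore supplies the square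
integrability on which a finite bound depends. -/
theorem LawConditions.memLp_of_memLp_psi (hP : LawConditions P w eStar c)
    (hMe : PropEq P (e β₀.1) eStar) (hMg : RegEq P (g β₀.2) (outcomeReg P))
    (hL : MemLp (psi w e g ψe ψg (θ₀, β₀)) 2 P) :
    MemLp (weightedResidual w (outcomeReg P)) 2 P ∧
      MemLp (weightedRegression w (outcomeReg P)) 2 P := by
  have key : ∀ k, MemLp (fun o => ∑ a, w k a o.2.2 ⬝ᵥ outcomeReg P k a o.2.2) 2 (typeLaw P k) ∧
      MemLp (fun o => w k o.2.1 o.2.2 ⬝ᵥ (o.1 - outcomeReg P k o.2.1 o.2.2)) 2 (typeLaw P k) := by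
    intro k
    let L : Par K de dg →L[ℝ] ℝ :=
      (ContinuousLinearMap.proj k).comp (ContinuousLinearMap.fst ℝ (Fin K → ℝ) (Nuis de dg))
    have h1 : MemLp (fun o => L (psi w e g ψe ψg (θ₀, β₀) o)) 2 P := L.comp_memLp' hL
    have e1 : ∀ o, L (psi w e g ψe ψg (θ₀, β₀) o) =
        ind k o * (aipwObs w (g β₀.2) (e β₀.1) o - θ₀ k) := fun o =>
      psiTheta_eq (w := w) (e := e) (g := g) (θ₀, β₀) o k
    have h2 : MemLp (fun o => ind k o * (aipwObs w (g β₀.2) (e β₀.1) o - θ₀ k)) 2 P := by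
      simp_rw [e1] at h1
      exact h1
    have h3 := MemLp.typeLaw P h2 k
    simp only [ind, if_true, one_mul] at h3
    have h4 : MemLp (fun z => aipwObs w (g β₀.2) (e β₀.1) ⟨k, z⟩) 2 (typeLaw P k) := by
      refine (h3.add (memLp_const (θ₀ k))).ae_eq (Eventually.of_forall fun z => ?_)
      simp
    have h5 : MemLp (aipw (w k) (outcomeReg P k) (eStar k)) 2 (typeLaw P k) :=
      h4.ae_eq (ae_typeLaw P (aipwObs_ae_eq (w := w) hMg hMe) k)
    exact memLp_of_memLp_aipw (hP.weight_measurable k) (measurable_outcomeReg P k)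
      (hP.prop_measurable k) (hP.moments.integrable_resp k)
      (fun a => Eventually.of_forall fun x => rfl)
      (fun a x => ⟨hP.c_pos.trans (hP.overlap k a x).1, by
        linarith [(hP.overlap k a x).2, hP.c_pos]⟩) h5
  exact ⟨memLp_two_sigma P
      (measurable_weightedResidual hP.weight_measurable (measurable_outcomeReg P)) fun k => (key k).2,
    memLp_two_sigma P
      (measurable_weightedRegression hP.weight_measurable (measurable_outcomeReg P))
      fun k => (key k).1⟩

/-- By double robustness the expected `k`-th component of `Ψ_θ` is `pr(L = k)` times the difference
of the two sides, and it vanishes at the root. -/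
theorem LawConditions.root_eq_typeMean (hP : LawConditions P w eStar c)
    (hR : RegularityConditions P (psi w e g ψe ψg) Ω₀ (θ₀, β₀))
    (hMe : PropEq P (e β₀.1) eStar) (k : Fin K) : θ₀ k = typeMean w P k := by
  obtain ⟨h1, h2⟩ := integrable_psiTheta (w := w) (e := e) (g := g) (z := (θ₀, β₀))
    (hR.memLp.integrable (by norm_num)) (fun o => rfl) k
  rw [hR.root, hP.integral_ind_mul_sub h1 (Or.inr hMe)] at h2
  rcases mul_eq_zero.1 h2 with h | h
  · exact absurd h (hP.typeProb_pos k).ne'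
  · exact (sub_eq_zero.1 h).symm

/-- Along the ray the left side is linear in `t` and the bound quadratic; divide by `t` and let it
tend to zero. -/
theorem fst_apply_eq_zero_of_quadratic {L : Par K de dg →L[ℝ] Par K de dg} {x : Par K de dg}
    {C r : ℝ} (hr : 0 < r)
    (h : ∀ t : ℝ, 0 < t → t * ‖x‖ < r → ‖(L (t • x)).1‖ ≤ C * ‖t • x‖ ^ 2) : (L x).1 = 0 := by
  have h1 : ∀ᶠ t : ℝ in 𝓝[>] 0, ‖(L x).1‖ ≤ C * ‖x‖ ^ 2 * t := by
    have h2 : Tendsto (fun t : ℝ => t * ‖x‖) (𝓝[>] 0) (𝓝 0) := by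
      have : Tendsto (fun t : ℝ => t * ‖x‖) (𝓝 0) (𝓝 (0 * ‖x‖)) :=
        (continuous_id.mul continuous_const).tendsto _
      rw [zero_mul] at this
      exact this.mono_left nhdsWithin_le_nhds
    filter_upwards [self_mem_nhdsWithin, h2.eventually (gt_mem_nhds hr)] with t ht h3
    have ht0 : 0 < t := ht
    have h4 := h t ht0 h3
    rw [map_smul, Prod.smul_fst, norm_smul, norm_smul, Real.norm_of_nonneg ht0.le] at h4
    refine le_of_mul_le_mul_left ?_ ht0
    calc _ ≤ _ := h4
      _ = _ := by ring
  have h5 : Tendsto (fun t : ℝ => C * ‖x‖ ^ 2 * t) (𝓝[>] 0) (𝓝 0) := by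
    have : Tendsto (fun t : ℝ => C * ‖x‖ ^ 2 * t) (𝓝 0) (𝓝 (C * ‖x‖ ^ 2 * 0)) :=
      (continuous_const.mul continuous_id).tendsto _
    rw [mul_zero] at this
    exact this.mono_left nhdsWithin_le_nhds
  exact norm_le_zero_iff.1 (ge_of_tendsto h5 h1)

/-- When both working models are correct, the expected Jacobian of `Ψ_θ` in the direction of the
nuisance parameters vanishes. -/
theorem LawConditions.jacobian_fst_eq_zero (hP : LawConditions P w eStar c)
    (he : ∀ β k a, Measurable (e β k a)) (hg : ∀ β k a, Measurable (g β k a))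
    (hψe : ∀ β, Measurable (ψe β)) (hψg : ∀ β, Measurable (ψg β))
    (hR : RegularityConditions P (psi w e g ψe ψg) Ω₀ (θ₀, β₀))
    (hMe : PropEq P (e β₀.1) eStar) (hMg : RegEq P (g β₀.2) (outcomeReg P)) (b : Nuis de dg) :
    ((∫ o, fderiv ℝ (fun z => psi w e g ψe ψg z o) (θ₀, β₀) ∂P) (0, b)).1 = 0 := by
  obtain ⟨r, hr, H, hH, hT⟩ := hR.exists_taylor
  set J := ∫ o, fderiv ℝ (fun z => psi w e g ψe ψg z o) (θ₀, β₀) ∂P with hJ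
  -- As long as one model stays correct, double robustness keeps the expected `Ψ_θ` at zero along
  -- the ray, so the linear term of its expansion is of second order and must vanish.
  have key : ∀ b : Nuis de dg, (∀ t : ℝ, RegEq P (g (β₀ + t • b).2) (outcomeReg P) ∨
      PropEq P (e (β₀ + t • b).1) eStar) → (J (0, b)).1 = 0 := by
    intro b hb
    refine fst_apply_eq_zero_of_quadratic (C := ∫ o, H o ∂P) hr fun t ht htr => ?_
    set z : Par K de dg := (θ₀, β₀ + t • b) with hz
    have hzsub : z - (θ₀, β₀) = t • ((0, b) : Par K de dg) := by
      rw [hz]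
      ext <;> simp
    have hzball : z ∈ Metric.ball ((θ₀, β₀) : Par K de dg) r := by
      rw [Metric.mem_ball, dist_eq_norm, hzsub, norm_smul, Real.norm_of_nonneg ht.le]
      exact htr
    obtain ⟨h1, h2⟩ := norm_integral_taylor_le (hR.memLp.integrable (by norm_num))
      hR.jacobian_integrable hH
      (measurable_psi hP.weight_measurable he hg hψe hψg z).aestronglyMeasurable
      (hT.mono fun o ho => ho z hzball)
    have h3 : (∫ o, psi w e g ψe ψg z o ∂P).1 = 0 := by
      funext k
      obtain ⟨i1, i2⟩ := integrable_psiTheta (w := w) (e := e) (g := g) (z := z) h1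
        (fun o => rfl) k
      rw [← i2, hP.integral_ind_mul_sub i1 (hb t), ← hP.root_eq_typeMean hR hMe k]
      simp [hz]
    rw [hR.root, sub_zero, hzsub] at h2
    refine le_trans (le_of_eq ?_) ((norm_fst_le _).trans h2)
    rw [Prod.fst_sub, h3, zero_sub, norm_neg]
  -- Moving `β_e` alone keeps the regression correct, and moving `β_g` alone keeps the propensity
  -- score correct; linearity combines the two directions.
  have h1 := key (b.1, 0) fun t => Or.inl (by simpa using hMg)
  have h2 := key (0, b.2) fun t => Or.inr (by simpa using hMe)
  have h3 : ((0, b) : Par K de dg) = (0, (b.1, 0)) + (0, (0, b.2)) := by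
    ext <;> simp
  rw [h3, map_add, Prod.fst_add, h1, h2, add_zero]

end Estimator

/-! ### Asymptotic linearity -/

section AsymptoticLinearity

variable {Ω : Type*} [MeasurableSpace Ω] {Pr : Measure Ω} [IsProbabilityMeasure Pr]

/-- First-order expansion of `√N (v(p̂) θ̂ - v(p) θ)`. -/
theorem tendsto_delta {v : ℝ → ℝ} {p θ : ℝ} {ph th ζ : ℕ × Ω → ℝ}
    (hv : ContDiffOn ℝ 1 v (Set.Ioc 0 1)) (hp0 : 0 < p) (hp1 : p ≤ 1)
    (hph : Tendsto ph (inProb Pr) (𝓝 p)) (hph1 : ∀ q, ph q ≤ 1)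
    (hphOp : IsOp Pr fun q => √(q.1 : ℝ) * (ph q - p))
    (hζ : IsOp Pr fun q => √(q.1 : ℝ) * ζ q)
    (hlin : Tendsto (fun q => √(q.1 : ℝ) * (ph q * (th q - θ) - ζ q)) (inProb Pr) (𝓝 0)) :
    Tendsto (fun q => √(q.1 : ℝ) * (v (ph q) * th q - v p * θ) -
      √(q.1 : ℝ) * (v p / p * ζ q + derivWithin v (Set.Ioc 0 1) p * θ * (ph q - p)))
      (inProb Pr) (𝓝 0) := by
  set v' := derivWithin v (Set.Ioc 0 1) p with hv'
  have hpm : p ∈ Set.Ioc (0 : ℝ) 1 := ⟨hp0, hp1⟩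
  have hpos : ∀ᶠ q in inProb Pr, 0 < ph q := hph.eventually (lt_mem_nhds hp0)
  have hphw : Tendsto ph (inProb Pr) (𝓝[Set.Ioc 0 1] p) :=
    tendsto_nhdsWithin_iff.2 ⟨hph, hpos.mono fun q hq => ⟨hq, hph1 q⟩⟩
  have hvc : Tendsto (fun q => v (ph q) / ph q) (inProb Pr) (𝓝 (v p / p)) :=
    ((hv.continuousOn p hpm).tendsto.comp hphw).div hph hp0.ne'
  have hdv : HasDerivWithinAt v v' (Set.Ioc 0 1) p :=
    (hv.differentiableOn (by norm_num) p hpm).hasDerivWithinAt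
  -- The relative error of the linear approximation; it is `0 / 0 = 0` at `p`, so the factorisation
  -- of `v x - v p` also holds there.
  set s : ℝ → ℝ := fun x => (v x - v p - (x - p) * v') / (x - p) with hs
  have hs0 : Tendsto (fun q => s (ph q)) (inProb Pr) (𝓝 0) := by
    have h1 := (hasDerivWithinAt_iff_isLittleO.1 hdv).tendsto_div_nhds_zero
    exact h1.comp hphw
  have hsx : ∀ x, v x - v p = (v' + s x) * (x - p) := fun x => by
    by_cases hx : x - p = 0
    · have : x = p := sub_eq_zero.1 hx
      rw [this]
      simp
    · rw [hs]
      field_simp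
      ring
  have t1 : Tendsto (fun q => v (ph q) / ph q * (√(q.1 : ℝ) * (ph q * (th q - θ) - ζ q)))
      (inProb Pr) (𝓝 0) := by simpa using hvc.mul hlin
  have t2 : Tendsto (fun q => (v (ph q) / ph q - v p / p) * (√(q.1 : ℝ) * ζ q))
      (inProb Pr) (𝓝 0) := hζ _ (by simpa using hvc.sub_const (v p / p))
  have t3 : Tendsto (fun q => θ * s (ph q) * (√(q.1 : ℝ) * (ph q - p))) (inProb Pr) (𝓝 0) :=
    hphOp _ (by simpa using hs0.const_mul θ)
  have t4 := (t1.add t2).add t3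
  simp only [add_zero] at t4
  refine t4.congr' ?_
  filter_upwards [hpos] with q hq
  -- The factor `v(p̂)/p̂` appears because the estimating equation controls `p̂ (θ̂ - θ)` and not
  -- `θ̂ - θ`.
  have e1 : v (ph q) * th q - v p * θ =
      v (ph q) / ph q * (ph q * (th q - θ)) + (v (ph q) - v p) * θ := by
    field_simp
    ring
  rw [e1, hsx]
  ring

variable {K : ℕ} {M : Fin K → ℕ} {X : Fin K → Type*} [∀ k, MeasurableSpace (X k)]
  {P : Measure (Obs M X)} [IsProbabilityMeasure P] {w : RegFun M X} {eStar : PropFun M X} {c : ℝ}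
  {v : Fin K → ℝ → ℝ} {de dg : ℕ} {e : (Fin de → ℝ) → PropFun M X}
  {g : (Fin dg → ℝ) → RegFun M X}
  {ψe : (Fin de → ℝ) → Obs M X → Fin de → ℝ} {ψg : (Fin dg → ℝ) → Obs M X → Fin dg → ℝ}
  {Ω₀ : Set (Par K de dg)} {θ₀ : Fin K → ℝ} {β₀ : Nuis de dg}
  {O : ℕ → Ω → Obs M X} {βhat : ℕ → Ω → Nuis de dg} {θhat : ℕ → Ω → Fin K → ℝ}

theorem typeFreq_eq_avg (q : ℕ × Ω) (k : Fin K) :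
    typeFreq (fun i => O i q.2) q.1 k = avg O (ind k) q := by
  simp only [typeFreq, avg, ind, smul_eq_mul, Finset.sum_boole, div_eq_inv_mul]

theorem typeFreq_le_one (o : ℕ → Obs M X) (N : ℕ) (k : Fin K) : typeFreq o N k ≤ 1 := by
  refine div_le_one_of_le₀ ?_ (Nat.cast_nonneg _)
  exact_mod_cast (Finset.card_filter_le _ _).trans (Finset.card_range N).le

/-- `Ψ_θ` is affine in `θ` with slope minus the type indicator, so moving from the root to `θ₀` is
exact. This makes a consistency assumption on `θ̂` superfluous. -/
theorem avg_psi_fst_of_root {β : Nuis de dg} {θ : Fin K → ℝ} {q : ℕ × Ω}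
    (h : ∑ i ∈ Finset.range q.1, psiTheta w e g (θ, β) (O i q.2) = 0) (k : Fin K) :
    (avg O (psi w e g ψe ψg (θ₀, β)) q).1 k = avg O (ind k) q * (θ k - θ₀ k) := by
  have h1 : ∀ o, (psi w e g ψe ψg (θ₀, β) o).1 k =
      psiTheta w e g (θ, β) o k + ind k o * (θ k - θ₀ k) := fun o => by
    change psiTheta w e g (θ₀, β) o k = _
    rw [psiTheta_eq, psiTheta_eq]
    ring
  have h2 := congrFun h k
  rw [Finset.sum_apply, Pi.zero_apply] at h2
  simp only [avg, Prod.smul_fst, Prod.fst_sum, Pi.smul_apply, Finset.sum_apply, h1,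
    Finset.sum_add_distrib, h2, zero_add, smul_eq_mul, Finset.sum_mul, mul_assoc]

theorem avg_psi_snd_of_root {β : Nuis de dg} {q : ℕ × Ω}
    (h : ∑ i ∈ Finset.range q.1, psiBeta ψe ψg β (O i q.2) = 0) :
    (avg O (psi w e g ψe ψg (θ₀, β)) q).2 = 0 := by
  have h1 : (∑ i ∈ Finset.range q.1, psi w e g ψe ψg (θ₀, β) (O i q.2)).2 =
      ∑ i ∈ Finset.range q.1, psiBeta ψe ψg β (O i q.2) := by
    rw [Prod.snd_sum]
    rfl
  rw [avg, Prod.smul_snd, h1, h, smul_zero]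

/-- The estimator is asymptotically linear with the efficient influence function. -/
theorem LawConditions.tendsto_estimator (hP : LawConditions P w eStar c)
    (hv : ∀ k, ContDiffOn ℝ 1 (v k) (Set.Ioc 0 1))
    (he : ∀ β k a, Measurable (e β k a)) (hg : ∀ β k a, Measurable (g β k a))
    (hψe : ∀ β, Measurable (ψe β)) (hψg : ∀ β, Measurable (ψg β))
    (hR : RegularityConditions P (psi w e g ψe ψg) Ω₀ (θ₀, β₀))
    (hMe : PropEq P (e β₀.1) eStar) (hMg : RegEq P (g β₀.2) (outcomeReg P))
    (hO : IsSample Pr O P)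
    (hβ : Tendsto (fun q : ℕ × Ω => βhat q.1 q.2) (inProb Pr) (𝓝 β₀))
    (hβroot : ∀ᶠ q : ℕ × Ω in inProb Pr,
      ∑ i ∈ Finset.range q.1, psiBeta ψe ψg (βhat q.1 q.2) (O i q.2) = 0)
    (hθroot : ∀ᶠ q : ℕ × Ω in inProb Pr,
      ∑ i ∈ Finset.range q.1, psiTheta w e g (θhat q.1 q.2, βhat q.1 q.2) (O i q.2) = 0) :
    Tendsto (fun q : ℕ × Ω => √(q.1 : ℝ) *
        (∑ k, v k (typeFreq (fun i => O i q.2) q.1 k) * θhat q.1 q.2 k - estimand w v P) -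
      √(q.1 : ℝ) * avg O (effInfluence w v eStar P) q) (inProb Pr) (𝓝 0) := by
  have hexp := hR.tendsto_sqrt_mul_norm_sub hO
    (hP.jacobian_fst_eq_zero he hg hψe hψg hR hMe hMg) hβ
    (hβroot.mono fun q hq => avg_psi_snd_of_root hq)
  set Z : ℕ × Ω → Par K de dg := avg O (psi w e g ψe ψg (θ₀, β₀)) with hZ
  have hθ := hP.root_eq_typeMean hR hMe
  have hsum : ∀ k, Tendsto (fun q : ℕ × Ω => √(q.1 : ℝ) *
      (v k (typeFreq (fun i => O i q.2) q.1 k) * θhat q.1 q.2 k - v k (typeProb P k) * θ₀ k) -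
      √(q.1 : ℝ) * (v k (typeProb P k) / typeProb P k * (Z q).1 k + weightDeriv v P k * θ₀ k *
        (typeFreq (fun i => O i q.2) q.1 k - typeProb P k))) (inProb Pr) (𝓝 0) := by
    intro k
    have hi : Integrable (ind k : Obs M X → ℝ) P := memLp_one_iff_integrable.1 (memLp_ind P k)
    refine tendsto_delta (hv k) (hP.typeProb_pos k) measureReal_le_one ?_
      (fun q => typeFreq_le_one _ _ _) ?_ ?_ ?_
    · simp_rw [typeFreq_eq_avg]
      rw [← integral_ind]
      exact hO.tendsto_avg hi
    · have h1 := hO.isOp_sqrt_mul_avg (f := fun o => ind k o - typeProb P k)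
        ((memLp_ind P k).sub (memLp_const _)) (by
          rw [integral_sub hi (integrable_const _), integral_ind]
          simp)
      refine h1.of_abs_le ?_
      filter_upwards [tendsto_fst_inProb.eventually (eventually_gt_atTop 0)] with q hq
      refine le_of_eq ?_
      rw [typeFreq_eq_avg]
      congr 2
      have : (q.1 : ℝ) ≠ 0 := Nat.cast_ne_zero.2 hq.ne'
      simp only [avg, Finset.sum_sub_distrib, Finset.sum_const, Finset.card_range, smul_eq_mul,
        nsmul_eq_mul]
      field_simp
    · exact hO.isOp_sqrt_mul_clm_avg hR.memLp hR.root
        ((ContinuousLinearMap.proj k).comp (ContinuousLinearMap.fst ℝ (Fin K → ℝ) (Nuis de dg)))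
    · refine squeeze_zero_norm' ?_ hexp
      filter_upwards [hθroot] with q hq
      rw [norm_mul, Real.norm_of_nonneg (Real.sqrt_nonneg _), typeFreq_eq_avg,
        ← avg_psi_fst_of_root (ψe := ψe) (ψg := ψg) (θ₀ := θ₀) hq k]
      exact mul_le_mul_of_nonneg_left (norm_le_pi_norm
        (avg O (psi w e g ψe ψg (θ₀, βhat q.1 q.2)) q - Z q).1 k) (Real.sqrt_nonneg _)
  have htot := tendsto_finsetSum Finset.univ fun k _ => hsum k
  rw [Finset.sum_const_zero] at htot
  refine htot.congr' ?_
  -- At correct nuisance values the linear terms of the delta method are the summands of the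
  -- efficient influence function.
  have hD : ∀ᵐ o ∂P, effInfluence w v eStar P o = ∑ k, (v k (typeProb P k) / typeProb P k *
      (psi w e g ψe ψg (θ₀, β₀) o).1 k + weightDeriv v P k * θ₀ k * (ind k o - typeProb P k)) := by
    filter_upwards [aipwObs_ae_eq (w := w) hMg hMe] with o ho
    rw [effInfluence]
    refine Finset.sum_congr rfl fun k _ => ?_
    change _ = _ * psiTheta w e g (θ₀, β₀) o k + _
    rw [psiTheta_eq, ho, ← hθ]
    ring
  filter_upwards [eventually_inProb_of_ae (p := fun q : ℕ × Ω => ∀ i,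
      effInfluence w v eStar P (O i q.2) = ∑ k, (v k (typeProb P k) / typeProb P k *
      (psi w e g ψe ψg (θ₀, β₀) (O i q.2)).1 k +
        weightDeriv v P k * θ₀ k * (ind k (O i q.2) - typeProb P k)))
      ((hO.ae hD).mono fun ω hω _ => hω),
    tendsto_fst_inProb.eventually (eventually_gt_atTop 0)] with q hq hq0
  have hN : (q.1 : ℝ) ≠ 0 := Nat.cast_ne_zero.2 hq0.ne'
  have e1 : avg O (effInfluence w v eStar P) q = ∑ k, (v k (typeProb P k) / typeProb P k *
      (Z q).1 k + weightDeriv v P k * θ₀ k *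
        (typeFreq (fun i => O i q.2) q.1 k - typeProb P k)) := by
    simp only [avg, hq, typeFreq_eq_avg, hZ, Prod.smul_fst, Prod.fst_sum, Pi.smul_apply,
      Finset.sum_apply, smul_eq_mul]
    rw [Finset.sum_comm, Finset.mul_sum]
    refine Finset.sum_congr rfl fun k _ => ?_
    rw [Finset.sum_add_distrib, ← Finset.mul_sum, ← Finset.mul_sum, Finset.sum_sub_distrib]
    simp only [Finset.sum_const, Finset.card_range, nsmul_eq_mul]
    field_simp
  have e2 : estimand w v P = ∑ k, v k (typeProb P k) * θ₀ k := by
    simp_rw [hθ]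
    rfl
  rw [e1, e2, ← Finset.sum_sub_distrib, Finset.mul_sum, Finset.mul_sum, ← Finset.sum_sub_distrib]

/-- The frequency factors through a count in `ℕ`, so `f` may be arbitrary; the weight functions `v
k` are controlled only on `(0, 1]`, and `p̂ₖ` can be zero. -/
theorem measurable_typeFreq_comp (hO : ∀ i, Measurable (O i)) (N : ℕ) (k : Fin K) (f : ℝ → ℝ) :
    Measurable fun ω => f (typeFreq (fun i => O i ω) N k) := by
  have h1 : Measurable fun ω => ((Finset.range N).filter fun i => (O i ω).1 = k).card := by
    simp_rw [Finset.card_filter]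
    refine Finset.measurable_sum _ fun i _ => Measurable.ite ?_ measurable_const measurable_const
    exact (measurable_sigma_fst.comp (hO i)) (measurableSet_singleton k)
  have h2 : Measurable fun n : ℕ => f ((n : ℝ) / N) := measurable_from_top
  exact h2.comp h1

end AsymptoticLinearity

/-! ### The law of the observed data -/

section ObservedLaw

variable {K : ℕ} {M : Fin K → ℕ} {X : Fin K → Type*} [∀ k, MeasurableSpace (X k)]
  [∀ k, StandardBorelSpace (X k)] {F : Measure (Full M X)} [IsProbabilityMeasure F]
  {eStar : PropFun M X} {c : ℝ} {w : RegFun M X}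

theorem CausalAssumptions.identification (hF : CausalAssumptions F eStar c)
    (hw : ∀ k a, Measurable (w k a))
    (hwY : ∀ k a, Integrable (fun z : ClusterFull M X k => w k a z.2.2.2 ⬝ᵥ z.1 a) (typeLaw F k))
    (k : Fin K) (a : Treat (M k)) :
    Integrable (fun x => w k a x ⬝ᵥ outcomeReg (F.map observe) k a x) (covLaw (F.map observe) k) ∧
      ∫ z : ClusterFull M X k, w k a z.2.2.2 ⬝ᵥ z.1 a ∂typeLaw F k =
        ∫ x, w k a x ⬝ᵥ outcomeReg (F.map observe) k a x ∂covLaw (F.map observe) k := by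
  have key : ∀ (ν : Measure (ClusterObs M X k)) [IsFiniteMeasure ν],
      (typeLaw F k).map Prod.snd = ν →
      (∀ᵐ x ∂covMarginal ν, (trtKernel ν x).real {a} = eStar k a x) →
      (∀ᵐ x ∂covMarginal ν, ∀ j,
        Integrable (fun y : Outcome (M k) => y j) (respKernel ν (a, x))) →
      Integrable (fun x => w k a x ⬝ᵥ respMean ν a x) (covMarginal ν) ∧
        ∫ z : ClusterFull M X k, w k a z.2.2.2 ⬝ᵥ z.1 a ∂typeLaw F k =
          ∫ x, w k a x ⬝ᵥ respMean ν a x ∂covMarginal ν := by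
    rintro ν _ rfl h1 h2
    exact integral_potentialOutcome (ae_typeLaw F hF.consistency k) a (by fun_prop)
      (hF.ignorability k a) (hF.prop_measurable k a)
      (fun x => hF.c_pos.trans (hF.overlap k a x).1) h1 h2 (hw k a) (hwY k a)
  exact key _ (typeLaw_map_observe F k).symm (hF.prop_eq k a) (hF.moments.integrable_resp k a)

theorem CausalAssumptions.lawConditions (hF : CausalAssumptions F eStar c)
    (hw : ∀ k a, Measurable (w k a))
    (hwY : ∀ k a, Integrable (fun z : ClusterFull M X k => w k a z.2.2.2 ⬝ᵥ z.1 a) (typeLaw F k)) :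
    LawConditions (F.map observe) w eStar c where
  typeProb_pos k := by
    rw [typeProb_map_observe]
    exact hF.typeProb_pos k
  prop_measurable := hF.prop_measurable
  prop_eq := hF.prop_eq
  c_pos := hF.c_pos
  overlap := hF.overlap
  moments := hF.moments
  weight_measurable := hw
  weight_integrable k a := (hF.identification hw hwY k a).1

theorem CausalAssumptions.causalEstimand_eq (hF : CausalAssumptions F eStar c)
    (hw : ∀ k a, Measurable (w k a))
    (hwY : ∀ k a, Integrable (fun z : ClusterFull M X k => w k a z.2.2.2 ⬝ᵥ z.1 a) (typeLaw F k))
    (v : Fin K → ℝ → ℝ) : causalEstimand w v F = estimand w v (F.map observe) := by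
  refine Finset.sum_congr rfl fun k _ => ?_
  rw [typeProb_map_observe]
  congr 1
  exact Finset.sum_congr rfl fun a _ => (hF.identification hw hwY k a).2

end ObservedLaw

end PartialInterference

end

theorem mainTheorem10
    {K : ℕ} {M : Fin K → ℕ} {X : Fin K → Type*} [∀ k, MeasurableSpace (X k)]
    [∀ k, StandardBorelSpace (X k)]
    -- law of the full data of a cluster, true propensity score, overlap constant
    (F : Measure (Full M X)) [IsProbabilityMeasure F] (eStar : PropFun M X) (c : ℝ)
    (hF : CausalAssumptions F eStar c)
    -- the estimand
    (w : RegFun M X) (hw : ∀ k a, Measurable (w k a))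
    (hwY : ∀ k a, Integrable (fun z : ClusterFull M X k => w k a z.2.2.2 ⬝ᵥ z.1 a) (typeLaw F k))
    (v : Fin K → ℝ → ℝ) (hv : ∀ k, ContDiffOn ℝ 1 (v k) (Set.Ioc 0 1))
    -- parametric working models and estimating functions
    {de dg : ℕ} (e : (Fin de → ℝ) → PropFun M X) (g : (Fin dg → ℝ) → RegFun M X)
    (he : ∀ β k a, Measurable (e β k a)) (hg : ∀ β k a, Measurable (g β k a))
    (ψe : (Fin de → ℝ) → Obs M X → Fin de → ℝ) (ψg : (Fin dg → ℝ) → Obs M X → Fin dg → ℝ)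
    (hψe : ∀ β, Measurable (ψe β)) (hψg : ∀ β, Measurable (ψg β))
    (Ω₀ : Set (Par K de dg)) (θ₀ : Fin K → ℝ) (β₀ : Nuis de dg)
    (hR : RegularityConditions (F.map observe) (psi w e g ψe ψg) Ω₀ (θ₀, β₀))
    -- both working models are correct
    (hMe : PropEq (F.map observe) (e β₀.1) eStar)
    (hMe' : ∀ z ∈ Ω₀, PropEq (F.map observe) (e z.2.1) eStar → z.2.1 = β₀.1)
    (hMg : RegEq (F.map observe) (g β₀.2) (outcomeReg (F.map observe)))
    (hMg' : ∀ z ∈ Ω₀, RegEq (F.map observe) (g z.2.2) (outcomeReg (F.map observe)) →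
      z.2.2 = β₀.2)
    -- independent observed clusters
    {Ω : Type*} [MeasurableSpace Ω] (Pr : Measure Ω) [IsProbabilityMeasure Pr]
    (O : ℕ → Ω → Obs M X) (hO : ∀ i, Measurable (O i))
    (hO_law : ∀ i, Pr.map (O i) = F.map observe) (hO_indep : iIndepFun O Pr)
    -- estimators
    (βhat : ℕ → Ω → Nuis de dg) (hβ : ∀ N, Measurable (βhat N))
    (hβ_root : Tendsto (fun N : ℕ =>
      Pr {ω | ∑ i ∈ Finset.range N, psiBeta ψe ψg (βhat N ω) (O i ω) ≠ 0}) atTop (𝓝 0))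
    (hβ_lim : TendstoInMeasure Pr βhat atTop (fun _ => β₀))
    (θhat : ℕ → Ω → Fin K → ℝ) (hθ : ∀ N, Measurable (θhat N))
    (hθ_root : Tendsto (fun N : ℕ =>
      Pr {ω | ∑ i ∈ Finset.range N, psiTheta w e g (θhat N ω, βhat N ω) (O i ω) ≠ 0})
      atTop (𝓝 0)) :
    causalEstimand w v F = estimand w v (F.map observe) ∧
    ∃ V : ℝ≥0,
      TendstoInDistribution
        (fun (N : ℕ) ω => √(N : ℝ) *
          (∑ k, v k (typeFreq (fun i => O i ω) N k) * θhat N ω k - causalEstimand w v F))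
        atTop id (fun _ => Pr) (gaussianReal 0 V) ∧
      IsEfficiencyBound (modelNPKnown w c eStar) (momentFunctions w (F.map observe))
        (F.map observe) (estimand w v) V ∧
      IsEfficiencyBound (modelNP w c) (momentFunctions w (F.map observe))
        (F.map observe) (estimand w v) V := by
  have hprob : IsProbabilityMeasure (F.map observe) :=
    Measure.isProbabilityMeasure_map measurable_observe.aemeasurable
  have hP := hF.lawConditions hw hwY
  have hτ := hF.causalEstimand_eq hw hwY v
  obtain ⟨hr, hm⟩ := hP.memLp_of_memLp_psi hMe hMg hR.memLp
  have hD := hP.memLp_effInfluence (v := v) hr hm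
  have hS : IsSample Pr O (F.map observe) := ⟨hO, hO_law, hO_indep⟩
  have hV0 : 0 ≤ ∫ o, effInfluence w v eStar (F.map observe) o ^ 2 ∂F.map observe :=
    integral_nonneg fun o => sq_nonneg _
  refine ⟨hτ, (∫ o, effInfluence w v eStar (F.map observe) o ^ 2 ∂F.map observe).toNNReal,
    ?_, ?_, ?_⟩
  · refine tendstoInDistribution_of_tendstoInMeasure_sub _ _
      (hS.tendstoInDistribution_avg hD (hP.integral_effInfluence hr hm)) ?_ fun N => ?_
    · refine tendstoInMeasure_iff_inProb.2 ?_
      rw [hτ]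
      exact hP.tendsto_estimator hv he hg hψe hψg hR hMe hMg hS
        (tendstoInMeasure_iff_inProb.1 hβ_lim) (eventually_inProb.2 hβ_root)
        (eventually_inProb.2 hθ_root)
    · refine Measurable.aemeasurable (Measurable.const_mul (Measurable.sub_const ?_ _) _)
      exact Finset.measurable_sum _ fun k _ =>
        (measurable_typeFreq_comp hO N k (v k)).mul ((measurable_pi_apply k).comp (hθ N))
  · rw [Real.coe_toNNReal _ hV0]
    -- The two models are the smallest and the largest between which the bound was computed, so the
    -- same value serves both.
    exact hP.isEfficiencyBound hv hr hm subset_rfl fun Q hQ => hQ.1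
  · rw [Real.coe_toNNReal _ hV0]
    exact hP.isEfficiencyBound hv hr hm (fun Q hQ => hQ.1) subset_rfl
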